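/- **Setting.** Let $\theta$ be a random input parameter with belief distribution $\pi$ (a probability measure), let $\xi$ be a noise with conditional law $\kappa(\theta)$ given $\theta$ (a Markov kernel; a law not depending on $\theta$ is a special case), and let $h(\theta;\xi)$ be a real response, $h$ jointly measurable. Put $H(\theta)=\mathbb E_\xi[h(\theta;\xi)]$. Fix $0<\alpha<1$, and let $v_\alpha=\inf\{t:\Pr(H(\theta)\le t)\ge\alpha\}$ and $c_\alpha=v_\alpha+\frac1{1-\alpha}\mathbb E[(H(\theta)-v_\alpha)^+]$. **Sampling.** Let $\theta_1,\theta_2,\dots$ be i.i.d. from $\pi$; given $\theta_i$, let $\xi_{i1},\xi_{i2},\dots$ be i.i.d. from $\kappa(\theta_i)$; the families $(\theta_i,(\xi_{ij})_j)$ are independent over $i$. For sample sizes $N,M$ write $h_{ij}=h(\theta_i;\xi_{ij})$, $\widehat H_i=\frac1M\sum_{j=1}^M h_{ij}$ and $s_i^2=\frac1{M-1}\sum_{j=1}^M(h_{ij}-\widehat H_i)^2$, $i\le N$. Let $\widetilde v$ be the $\lceil\alpha N\rceil$-th smallest of $\widehat H_1,\dots,\widehat H_N$, attained at the index $i^*$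 (ties broken by index), and $$\widetilde c=\widetilde v+\frac1{(1-\alpha)N}\sum_{i=1}^N(\widehat H_i-\widetilde v)^+ .$$ **Variance estimates.** Let $b_N>0$ be bandwidths with $b_N\to0$ and $Nb_N\to\infty$, let $\varphi$ be the standard normal density, and let $\widehat f(x)=\frac1{Nb_N}\sum_{i=1}^N\varphi\big((x-\widehat H_i)/b_N\big)$. Put $$\widehat\sigma_v=\frac{\sqrt{\alpha(1-\alpha)}}{\widehat f(\widetilde v)},\qquad \widehat\sigma_c=\frac{S}{1-\alpha},\qquad \widehat\tau_v=s_{i^*},\qquad \widehat\tau_c^2=\frac1{(1-\alpha)N}\sum_{i\le N:\ \widehat H_i\ge\widetilde v}s_i^2,$$ where $S^2$ is the sample variance (divisor $N-1$) of $(\widehat H_i-\widetilde v)^+$, $i\le N$. Let $t_{\gamma,L}$ be the $\gamma$-quantile of Student's t-distribution with $L$ degrees of freedom ($L>0$ real). **Weak Assumption.** (W1) $\mathbb E[h(\theta;\xi)^2\mid\theta]<\infty$ almost surely, and $\mathbb E[h(\theta;\xi)^2]<\infty$. (W2) $H(\theta)$ has a probability density that is positive and continuously differentiable in a neighbourhood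 of $v_\alpha$. **Strong Assumption.** (W1), (W2), and: for each $M\ge1$ the pair $\big(H(\theta),\bar{\mathcal E}_M\big)$, where $\bar{\mathcal E}_M=\frac1{\sqrt M}\sum_{j=1}^M(h(\theta;\xi_j)-H(\theta))$ with $\xi_1,\xi_2,\dots$ i.i.d. from $\kappa(\theta)$ given $\theta$, has a joint density $p_M(y,e)$ whose partial derivatives $\partial_yp_M$ and $\partial_y^2p_M$ exist everywhere, and there are nonnegative functions $g_{0,M},g_{1,M},g_{2,M}$ with $p_M(y,e)\le g_{0,M}(e)$, $|\partial_yp_M(y,e)|\le g_{1,M}(e)$, $|\partial_y^2p_M(y,e)|\le g_{2,M}(e)$ for all $(y,e)$ and $\sup_{M\ge1}\int|e|^rg_{i,M}(e)\,de<\infty$ for $i=0,1,2$ and all real $0\le r\le4$. **Theorem 3.5 (Asymptotic Validity of CIs).** (i) Let the Weak Assumption hold, and let $\beta_O,\beta_I>0$ with $\beta=\beta_O+\beta_I<1$. For the intervals $$[lb^w_v,ub^w_v]=\Big[\widetilde v+\tfrac{t_{\beta_O/2,N-1}\widehat\sigma_v}{\sqrt N}+\tfrac{t_{\beta_I/2,M-1}\widehat\tau_v}{\sqrt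 M},\ \widetilde v+\tfrac{t_{1-\beta_O/2,N-1}\widehat\sigma_v}{\sqrt N}+\tfrac{t_{1-\beta_I/2,M-1}\widehat\tau_v}{\sqrt M}\Big],$$ $$[lb^w_c,ub^w_c]=\Big[\widetilde c+\tfrac{t_{\beta_O/2,N-1}\widehat\sigma_c}{\sqrt N}+\tfrac{t_{\beta_I/2,(1-\alpha)NM-1}\widehat\tau_c}{\sqrt{(1-\alpha)NM}},\ \widetilde c+\tfrac{t_{1-\beta_O/2,N-1}\widehat\sigma_c}{\sqrt N}+\tfrac{t_{1-\beta_I/2,(1-\alpha)NM-1}\widehat\tau_c}{\sqrt{(1-\alpha)NM}}\Big]$$ the following iterated limits exist (the inner ones for all sufficiently large $N$) and satisfy $$\lim_{N\to\infty}\lim_{M\to\infty}\Pr\{lb^w_v\le v_\alpha\le ub^w_v\}\ge1-\beta,\qquad \lim_{N\to\infty}\lim_{M\to\infty}\Pr\{lb^w_c\le c_\alpha\le ub^w_c\}\ge1-\beta .$$ (ii) Let the Strong Assumption hold, and let $0<\beta<1$. For the intervals $$[lb^s_v,ub^s_v]=\Big[\widetilde v+\tfrac{t_{\beta/2,N-1}\widehat\sigma_v}{\sqrt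 N},\ \widetilde v+\tfrac{t_{1-\beta/2,N-1}\widehat\sigma_v}{\sqrt N}\Big],\qquad [lb^s_c,ub^s_c]=\Big[\widetilde c+\tfrac{t_{\beta/2,N-1}\widehat\sigma_c}{\sqrt N},\ \widetilde c+\tfrac{t_{1-\beta/2,N-1}\widehat\sigma_c}{\sqrt N}\Big],$$ as $N,M\to\infty$ jointly with $N=o(M^2)$, that is, along every sequence of pairs $(N_k,M_k)$ with $N_k\to\infty$, $M_k\to\infty$ and $N_k/M_k^2\to0$, the following limits exist, do not depend on the sequence, and satisfy $$\lim\Pr\{lb^s_v\le v_\alpha\le ub^s_v\}\ge1-\beta,\qquad \lim\Pr\{lb^s_c\le c_\alpha\le ub^s_c\}\ge1-\beta .$$ -/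

import Mathlib

open MeasureTheory ProbabilityTheory Filter Topology

noncomputable section

namespace NestedCI

/-! ### Quantiles and Student's t-distribution -/

/-- The `γ`-quantile `inf {x : F x ≥ γ}` of a probability measure on the real line. -/
def quantile (μ : Measure ℝ) (γ : ℝ) : ℝ :=
  sInf {x : ℝ | γ ≤ μ.real (Set.Iic x)}

/-- The density of Student's t-distribution with `d` degrees of freedom (`d > 0` real). -/
def studentTPDF (d x : ℝ) : ℝ :=
  Real.Gamma ((d + 1) / 2) / (√(d * Real.pi) * Real.Gamma (d / 2)) *
    (1 + x ^ 2 / d) ^ (-((d + 1) / 2))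

/-- Student's t-distribution with `d` degrees of freedom. -/
def studentT (d : ℝ) : Measure ℝ :=
  volume.withDensity fun x => ENNReal.ofReal (studentTPDF d x)

/-- `t_{γ,d}`, the `γ`-quantile of the t-distribution with `d` degrees of freedom. -/
def tQuantile (γ d : ℝ) : ℝ := quantile (studentT d) γ

/-! ### The nested sampling scheme -/

section Model

variable {Θ Ξ Ω : Type*} [MeasurableSpace Θ] [MeasurableSpace Ξ] [MeasurableSpace Ω]

/-- The scenarios `θ i` are i.i.d. from the belief distribution; given `θ i`, the noises `ξ i j`
(`j = 0, 1, …`) are i.i.d. from `κ (θ i)` (a constant kernel `κ` is a noise whose law does not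
depend on the scenario); different scenarios, with their noises, are independent. -/
structure IsNestedSample (belief : Measure Θ) (κ : Kernel Θ Ξ) (P : Measure Ω)
    (θ : ℕ → Ω → Θ) (ξ : ℕ → ℕ → Ω → Ξ) : Prop where
  measurable_scenario : ∀ i, Measurable (θ i)
  measurable_noise : ∀ i j, Measurable (ξ i j)
  indep : iIndepFun (fun i ω => (θ i ω, fun j => ξ i j ω)) P
  law : ∀ (i M : ℕ) (A : Set Θ) (B : ℕ → Set Ξ), MeasurableSet A → (∀ j, MeasurableSet (B j)) →
    P (θ i ⁻¹' A ∩ ⋂ j ∈ Finset.range M, ξ i j ⁻¹' B j) =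
      ∫⁻ t in A, ∏ j ∈ Finset.range M, κ t (B j) ∂belief

/-- The mean response `H(θ) = E_ξ[h(θ; ξ)]`. -/
def meanResponse (κ : Kernel Θ Ξ) (h : Θ → Ξ → ℝ) (t : Θ) : ℝ := ∫ x, h t x ∂(κ t)

/-- VaR of the mean response. -/
def VaR (belief : Measure Θ) (κ : Kernel Θ Ξ) (h : Θ → Ξ → ℝ) (α : ℝ) : ℝ :=
  quantile (belief.map (meanResponse κ h)) α

/-- CVaR of the mean response. -/
def CVaR (belief : Measure Θ) (κ : Kernel Θ Ξ) (h : Θ → Ξ → ℝ) (α : ℝ) : ℝ :=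
  VaR belief κ h α +
    1 / (1 - α) * ∫ t, max (meanResponse κ h t - VaR belief κ h α) 0 ∂belief

/-- The responses `h(θ_i; ξ_ij)`. -/
def response (h : Θ → Ξ → ℝ) (θ : ℕ → Ω → Θ) (ξ : ℕ → ℕ → Ω → Ξ) (ω : Ω) (i j : ℕ) : ℝ :=
  h (θ i ω) (ξ i j ω)

/-- The normalized noise `M^{1/2} · M⁻¹ ∑_{j<M} (h(θ_i; ξ_ij) - H(θ_i))`. -/
def normalizedNoise (κ : Kernel Θ Ξ) (h : Θ → Ξ → ℝ) (θ : ℕ → Ω → Θ) (ξ : ℕ → ℕ → Ω → Ξ)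
    (M i : ℕ) (ω : Ω) : ℝ :=
  √(M : ℝ) * ((∑ j ∈ Finset.range M, (h (θ i ω) (ξ i j ω) - meanResponse κ h (θ i ω))) / M)

/-! ### Assumptions -/

/-- The conditional second moments of the response are finite almost surely and have a finite
mean. -/
def FiniteSecondMoment (belief : Measure Θ) (κ : Kernel Θ Ξ) (h : Θ → Ξ → ℝ) : Prop :=
  (∀ᵐ t ∂belief, Integrable (fun x => h t x ^ 2) (κ t)) ∧
    Integrable (fun t => ∫ x, h t x ^ 2 ∂(κ t)) belief

/-- The mean response has a probability density that is positive and continuously differentiable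
in a neighbourhood of VaR. -/
def RegularDensity (belief : Measure Θ) (κ : Kernel Θ Ξ) (h : Θ → Ξ → ℝ) (α : ℝ) : Prop :=
  ∃ f : ℝ → ℝ, Measurable f ∧ (∀ y, 0 ≤ f y) ∧
    belief.map (meanResponse κ h) = volume.withDensity (fun y => ENNReal.ofReal (f y)) ∧
    (∀ᶠ y in 𝓝 (VaR belief κ h α), 0 < f y) ∧
    ContDiffAt ℝ 1 f (VaR belief κ h α)

/-- The Weak Assumption. -/
structure WeakAssumption (belief : Measure Θ) (κ : Kernel Θ Ξ) (h : Θ → Ξ → ℝ) (α : ℝ) :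
    Prop where
  secondMoment : FiniteSecondMoment belief κ h
  density : RegularDensity belief κ h α

/-- For every `M ≥ 1` the pair (mean response, normalized noise) has a joint density `p M` that is
twice differentiable in its first variable, and `p M`, `∂p M/∂h`, `∂²p M/∂h²` are dominated by
functions `g i M` of the noise variable alone (`i = 0, 1, 2`) whose absolute moments of orders
`0 ≤ r ≤ 4` are bounded in `M`. -/
def RegularJointDensity (κ : Kernel Θ Ξ) (h : Θ → Ξ → ℝ) (P : Measure Ω)
    (θ : ℕ → Ω → Θ) (ξ : ℕ → ℕ → Ω → Ξ) : Prop :=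
  ∃ (p : ℕ → ℝ → ℝ → ℝ) (g : Fin 3 → ℕ → ℝ → ℝ),
    (∀ M, 1 ≤ M →
      Measurable (fun z : ℝ × ℝ => p M z.1 z.2) ∧
      (∀ y e, 0 ≤ p M y e) ∧
      P.map (fun ω => (meanResponse κ h (θ 0 ω), normalizedNoise κ h θ ξ M 0 ω)) =
        (volume : Measure (ℝ × ℝ)).withDensity (fun z => ENNReal.ofReal (p M z.1 z.2)) ∧
      (∀ e, Differentiable ℝ (fun y => p M y e)) ∧
      (∀ e, Differentiable ℝ (deriv fun y => p M y e)) ∧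
      (∀ i e, 0 ≤ g i M e) ∧
      (∀ y e, p M y e ≤ g 0 M e) ∧
      (∀ y e, |deriv (fun y' => p M y' e) y| ≤ g 1 M e) ∧
      (∀ y e, |deriv (deriv fun y' => p M y' e) y| ≤ g 2 M e)) ∧
    ∀ r : ℝ, 0 ≤ r → r ≤ 4 → ∃ C : ℝ, ∀ (i : Fin 3) (M : ℕ), 1 ≤ M →
      Integrable (fun e => |e| ^ r * g i M e) ∧ ∫ e, |e| ^ r * g i M e ≤ C

/-- The Strong Assumption; it contains the Weak Assumption. -/
structure StrongAssumption (belief : Measure Θ) (κ : Kernel Θ Ξ) (h : Θ → Ξ → ℝ) (α : ℝ)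
    (P : Measure Ω) (θ : ℕ → Ω → Θ) (ξ : ℕ → ℕ → Ω → Ξ) : Prop
    extends WeakAssumption belief κ h α where
  jointDensity : RegularJointDensity κ h P θ ξ

end Model

/-! ### Estimators

A sample of size `n` is a sequence `y : ℕ → ℝ` of which `y 0, …, y (n - 1)` are used; a nested
sample of sizes `N`, `M` is an array `z : ℕ → ℕ → ℝ` of which `z i j`, `i < N`, `j < M` are used.
-/

/-- Sample mean. -/
def sampleMean (n : ℕ) (y : ℕ → ℝ) : ℝ := (∑ i ∈ Finset.range n, y i) / n

/-- Unbiased sample variance. -/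
def sampleVar (n : ℕ) (y : ℕ → ℝ) : ℝ :=
  (∑ i ∈ Finset.range n, (y i - sampleMean n y) ^ 2) / ((n : ℝ) - 1)

/-- The index of the `⌈α n⌉`-th smallest among `y 0, …, y (n - 1)`. -/
def quantileIndex (α : ℝ) (n : ℕ) (y : ℕ → ℝ) : ℕ :=
  if hk : ⌈α * n⌉₊ - 1 < n then (Tuple.sort (fun i : Fin n => y i) ⟨⌈α * n⌉₊ - 1, hk⟩ : ℕ) else 0

/-- The VaR estimator: the `⌈α n⌉`-th order statistic. -/
def varEst (α : ℝ) (n : ℕ) (y : ℕ → ℝ) : ℝ := y (quantileIndex α n y)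

/-- The excesses `(y i - varEst)⁺`. -/
def excess (α : ℝ) (n : ℕ) (y : ℕ → ℝ) (i : ℕ) : ℝ := max (y i - varEst α n y) 0

/-- The CVaR estimator. -/
def cvarEst (α : ℝ) (n : ℕ) (y : ℕ → ℝ) : ℝ :=
  varEst α n y + 1 / ((1 - α) * n) * ∑ i ∈ Finset.range n, excess α n y i

/-- The Gaussian kernel density estimate with bandwidth `b`, at the point `x`. -/
def kde (b : ℝ) (n : ℕ) (y : ℕ → ℝ) (x : ℝ) : ℝ :=
  (∑ i ∈ Finset.range n, gaussianPDFReal 0 1 ((x - y i) / b)) / (n * b)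

/-- Estimate of `σ_v = (α (1 - α))^{1/2} / f(v_α)`. -/
def sigmaV (α b : ℝ) (n : ℕ) (y : ℕ → ℝ) : ℝ :=
  √(α * (1 - α)) / kde b n y (varEst α n y)

/-- Estimate of `σ_c = Var[(H(θ) - v_α)⁺]^{1/2} / (1 - α)`. -/
def sigmaC (α : ℝ) (n : ℕ) (y : ℕ → ℝ) : ℝ :=
  √(sampleVar n (excess α n y)) / (1 - α)

/-- The inner sample averages. -/
def innerMean (M : ℕ) (z : ℕ → ℕ → ℝ) (i : ℕ) : ℝ := sampleMean M (z i)

/-- Estimate of `τ_v`: the sample standard deviation of the responses at the scenario whose inner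
average is the VaR estimate. -/
def tauV (α : ℝ) (N M : ℕ) (z : ℕ → ℕ → ℝ) : ℝ :=
  √(sampleVar M (z (quantileIndex α N (innerMean M z))))

/-- Estimate of `τ_c`: the sample variances of the responses are averaged over the scenarios whose
inner average is at least the VaR estimate. -/
def tauC (α : ℝ) (N M : ℕ) (z : ℕ → ℕ → ℝ) : ℝ :=
  √((∑ i ∈ Finset.range N with varEst α N (innerMean M z) ≤ innerMean M z i,
      sampleVar M (z i)) / ((1 - α) * N))

/-! ### Confidence intervals -/

/-- Two-level interval for VaR. -/
def weakCIV (α βO βI b : ℝ) (N M : ℕ) (z : ℕ → ℕ → ℝ) : Set ℝ :=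
  let y := innerMean M z
  let bound : ℝ → ℝ → ℝ := fun γO γI =>
    varEst α N y + tQuantile γO (N - 1) * sigmaV α b N y / √(N : ℝ) +
      tQuantile γI (M - 1) * tauV α N M z / √(M : ℝ)
  Set.Icc (bound (βO / 2) (βI / 2)) (bound (1 - βO / 2) (1 - βI / 2))

/-- Two-level interval for CVaR. -/
def weakCIC (α βO βI : ℝ) (N M : ℕ) (z : ℕ → ℕ → ℝ) : Set ℝ :=
  let y := innerMean M z
  let bound : ℝ → ℝ → ℝ := fun γO γI =>
    cvarEst α N y + tQuantile γO (N - 1) * sigmaC α N y / √(N : ℝ) +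
      tQuantile γI ((1 - α) * N * M - 1) * tauC α N M z / √((1 - α) * N * M)
  Set.Icc (bound (βO / 2) (βI / 2)) (bound (1 - βO / 2) (1 - βI / 2))

/-- Single-level interval for VaR. -/
def strongCIV (α β b : ℝ) (N M : ℕ) (z : ℕ → ℕ → ℝ) : Set ℝ :=
  let y := innerMean M z
  let bound : ℝ → ℝ := fun γ =>
    varEst α N y + tQuantile γ (N - 1) * sigmaV α b N y / √(N : ℝ)
  Set.Icc (bound (β / 2)) (bound (1 - β / 2))

/-- Single-level interval for CVaR. -/
def strongCIC (α β : ℝ) (N M : ℕ) (z : ℕ → ℕ → ℝ) : Set ℝ :=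
  let y := innerMean M z
  let bound : ℝ → ℝ := fun γ =>
    cvarEst α N y + tQuantile γ (N - 1) * sigmaC α N y / √(N : ℝ)
  Set.Icc (bound (β / 2)) (bound (1 - β / 2))

/-! ### Limits -/

/-- `lim_{N → ∞} lim_{M → ∞} F N M = L`: the inner limit exists for all large `N`, and the outer
limit exists and equals `L`. -/
def IteratedLimit (F : ℕ → ℕ → ℝ) (L : ℝ) : Prop :=
  ∃ q : ℕ → ℝ, (∀ᶠ N in atTop, Tendsto (fun M => F N M) atTop (𝓝 (q N))) ∧
    Tendsto q atTop (𝓝 L)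

/-- `F N M → L` as `N, M → ∞` jointly with `N = o(M²)`. -/
def JointLimit (F : ℕ → ℕ → ℝ) (L : ℝ) : Prop :=
  ∀ N M : ℕ → ℕ, Tendsto N atTop atTop → Tendsto M atTop atTop →
    Tendsto (fun k => (N k : ℝ) / (M k : ℝ) ^ 2) atTop (𝓝 0) →
    Tendsto (fun k => F (N k) (M k)) atTop (𝓝 L)

end NestedCI

end

open NestedCI

open NestedCI

noncomputable section

/-! Both parts rest on one limit theorem for an array of i.i.d. rows `Y k i`, coupled to the exact
mean responses `X i` and converging to them in mean square (`IsRegularArray`). The order statistic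
is at most `v + t / √n` exactly when at least `α n` entries lie at or below that level. Replacing
the indicator of `Y ≤ v + t / √n` by that of `X ≤ v` changes the centred count by `o(√n)` in
probability, since the variance of a single difference tends to zero. The mean of the difference
contributes `c t`, with `c` the density at `v`, and the central limit theorem for `X` yields the
normal limit (`tendsto_cdf_varEst`). The CVaR estimator is the minimum of a convex function attained
at the VaR estimate, so moving the argument to `v` costs only the product of the VaR error and the
error of the empirical distribution function at `v` (`abs_cvarEst_sub_le`); the central limit
theorem for the excesses then applies (`tendsto_cdf_cvarEst`). Consistent scale estimates, Slutsky's
theorem and the convergence of t-quantiles to normal ones give coverage tending to `1 - β`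
(`tendsto_sampleCIV`, `tendsto_sampleCIC`).

The delicate scale estimate is the kernel density estimate at a random, data-dependent point, with
only `N b → ∞` available. Given which index carries the order statistic, its value `x`, and which
indices lie below it, the other observations are independent, each with the common law conditioned
to the left or to the right of `x`. Chebyshev's inequality then bounds the fluctuation by a multiple
of `1 / (n b)` uniformly in `x` near `v` (`measure_kde_varEst_le`), and the conditional mean tends
to the density (`tendsto_condKDEMean`).

For part (i), fix `N` and let `M → ∞`. The inner errors and the terms with `tauV`, `tauC` vanish,
and the endpoints converge to the endpoints of the single-level interval built from the exact mean
responses. Those limits are translation equivariant statistics of an absolutely continuous sample,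
hence almost surely miss the target, so the coverage probabilities converge
(`tendsto_measureReal_twoLevel`). The outer limit is `1 - βO`, which is at least `1 - β`.

For part (ii), an inner average is `H + ε / √M` where `ε` has conditional mean zero given `H`. In
the distribution function at `v` and in the mean excess the first order term in `1 / √M` therefore
cancels and leaves a bias of order `1 / M` (`abs_cdf_sub_le`, `abs_integral_excess_sub_le`). This is
`o(1 / √N)` precisely because `N = o(M²)`, so the inner averages form a regular array and the limit
is `1 - β`. -/

namespace NestedCI

/-! ### Convergence in probability and Slutsky's theorem. -/

section InProbability

variable {Ω : Type*} [MeasurableSpace Ω] {P : Measure Ω}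

/-- Convergence in probability of real random variables to a constant. -/
def TendstoInProb (P : Measure Ω) (X : ℕ → Ω → ℝ) (c : ℝ) : Prop :=
  ∀ ε : ℝ, 0 < ε → Tendsto (fun k => P.real {ω | ε ≤ |X k ω - c|}) atTop (𝓝 0)

lemma TendstoInProb.of_ae [IsFiniteMeasure P] {X : ℕ → Ω → ℝ} {c : ℝ}
    (hm : ∀ k, AEStronglyMeasurable (X k) P)
    (h : ∀ᵐ ω ∂P, Tendsto (fun k => X k ω) atTop (𝓝 c)) : TendstoInProb P X c := by
  have := tendstoInMeasure_of_tendsto_ae (g := fun _ => c) hm h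
  rw [tendstoInMeasure_iff_measureReal_norm] at this
  simpa [TendstoInProb, Real.norm_eq_abs] using this

lemma TendstoInProb.of_tendsto {x : ℕ → ℝ} {c : ℝ} (h : Tendsto x atTop (𝓝 c)) :
    TendstoInProb P (fun k _ => x k) c := by
  intro ε hε
  refine tendsto_const_nhds.congr' ?_
  filter_upwards [(tendsto_order.1 ((tendsto_iff_dist_tendsto_zero.1 h))).2 ε hε] with k hk
  have : {ω : Ω | ε ≤ |x k - c|} = ∅ := by
    ext ω; simp only [Set.mem_ofPred_eq, Set.mem_empty_iff_false, iff_false, not_le]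
    rwa [Real.dist_eq] at hk
  simp [this]

lemma TendstoInProb.comp_tendsto {X : ℕ → Ω → ℝ} {c : ℝ} (h : TendstoInProb P X c) {n : ℕ → ℕ}
    (hn : Tendsto n atTop atTop) : TendstoInProb P (fun k => X (n k)) c :=
  fun ε hε => (h ε hε).comp hn

/-- The continuous mapping theorem for constant limits. Continuity at the limit point alone
suffices, which covers the division by the density estimate. -/
lemma TendstoInProb.map₂ [IsFiniteMeasure P] {X Y : ℕ → Ω → ℝ} {a b : ℝ}
    (hX : TendstoInProb P X a) (hY : TendstoInProb P Y b) {f : ℝ → ℝ → ℝ}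
    (hf : ContinuousAt (Function.uncurry f) (a, b)) :
    TendstoInProb P (fun k ω => f (X k ω) (Y k ω)) (f a b) := by
  intro ε hε
  obtain ⟨δ, hδ, h⟩ := Metric.continuousAt_iff.1 hf ε hε
  refine squeeze_zero (fun _ => measureReal_nonneg) (fun k => ?_)
    (by simpa using (hX δ hδ).add (hY δ hδ))
  refine (measureReal_mono ?_).trans (measureReal_union_le _ _)
  intro ω hω
  by_contra hcon
  simp only [Set.mem_union, Set.mem_ofPred_eq, not_or, not_le] at hcon
  have := @h (X k ω, Y k ω) (by
    rw [Prod.dist_eq, max_lt_iff]; simpa [Real.dist_eq] using hcon)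
  rw [Real.dist_eq] at this
  exact absurd hω (not_le.2 this)

lemma TendstoInProb.map [IsFiniteMeasure P] {X : ℕ → Ω → ℝ} {a : ℝ}
    (hX : TendstoInProb P X a) {f : ℝ → ℝ} (hf : ContinuousAt f a) :
    TendstoInProb P (fun k ω => f (X k ω)) (f a) :=
  hX.map₂ hX (f := fun x _ => f x)
    (ContinuousAt.comp (x := (a, a)) (f := Prod.fst) hf continuousAt_fst)

lemma TendstoInProb.add [IsFiniteMeasure P] {X Y : ℕ → Ω → ℝ} {a b : ℝ}
    (hX : TendstoInProb P X a) (hY : TendstoInProb P Y b) :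
    TendstoInProb P (fun k ω => X k ω + Y k ω) (a + b) :=
  hX.map₂ hY (f := fun x y => x + y) (by
    exact Continuous.continuousAt (by unfold Function.uncurry; fun_prop))

lemma TendstoInProb.mul [IsFiniteMeasure P] {X Y : ℕ → Ω → ℝ} {a b : ℝ}
    (hX : TendstoInProb P X a) (hY : TendstoInProb P Y b) :
    TendstoInProb P (fun k ω => X k ω * Y k ω) (a * b) :=
  hX.map₂ hY (f := fun x y => x * y) (by
    exact Continuous.continuousAt (by unfold Function.uncurry; fun_prop))

lemma TendstoInProb.squeeze [IsFiniteMeasure P] {X Z : ℕ → Ω → ℝ} {a : ℝ}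
    (hZ : TendstoInProb P Z 0) (h : ∀ᶠ k in atTop, ∀ ω, |X k ω - a| ≤ Z k ω) :
    TendstoInProb P X a := by
  intro ε hε
  refine squeeze_zero' (Eventually.of_forall fun _ => measureReal_nonneg) ?_ (hZ ε hε)
  filter_upwards [h] with k hk
  refine measureReal_mono fun ω hω => ?_
  simp only [Set.mem_ofPred_eq, sub_zero] at hω ⊢
  exact hω.trans ((hk ω).trans (le_abs_self _))

lemma TendstoInProb.congr {X Y : ℕ → Ω → ℝ} {a : ℝ} (hX : TendstoInProb P X a)
    (h : ∀ᶠ k in atTop, ∀ ω, Y k ω = X k ω) : TendstoInProb P Y a := by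
  intro ε hε
  refine (hX ε hε).congr' ?_
  filter_upwards [h] with k hk
  simp [hk]

lemma TendstoInProb.of_integral_abs [IsFiniteMeasure P] {Z : ℕ → Ω → ℝ}
    (hZ : ∀ k, Integrable (Z k) P) (h : Tendsto (fun k => ∫ ω, |Z k ω| ∂P) atTop (𝓝 0)) :
    TendstoInProb P Z 0 := by
  intro ε hε
  refine squeeze_zero (fun _ => measureReal_nonneg) (fun k => ?_)
    (by simpa using h.const_mul ε⁻¹)
  have := mul_meas_ge_le_integral_of_nonneg (μ := P) (f := fun ω => |Z k ω|)
    (ae_of_all _ fun _ => abs_nonneg _) (hZ k).abs ε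
  simp only [sub_zero]
  rw [inv_mul_eq_div, le_div_iff₀ hε, mul_comm]
  exact this

lemma TendstoInProb.of_integral_sq [IsFiniteMeasure P] {Z : ℕ → Ω → ℝ}
    (hZ : ∀ k, MemLp (Z k) 2 P) (h : Tendsto (fun k => ∫ ω, Z k ω ^ 2 ∂P) atTop (𝓝 0)) :
    TendstoInProb P Z 0 := by
  have h1 : TendstoInProb P (fun k ω => Z k ω ^ 2) 0 :=
    .of_integral_abs (fun k => (hZ k).integrable_sq) (by simpa using h)
  have h2 := h1.map (f := fun x => √x) Real.continuous_sqrt.continuousAt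
  rw [Real.sqrt_zero] at h2
  refine h2.squeeze (Eventually.of_forall fun k ω => ?_)
  rw [sub_zero, Real.sqrt_sq_eq_abs]

/-- Slutsky's theorem for distribution functions. -/
lemma tendsto_measureReal_of_slutsky [IsFiniteMeasure P] {S T C : ℕ → Ω → ℝ} {G : ℝ → ℝ} {c : ℝ}
    (hS : ∀ x, Tendsto (fun k => P.real {ω | S k ω ≤ x}) atTop (𝓝 (G x)))
    (hG : ContinuousAt G c) (hT : TendstoInProb P (fun k ω => T k ω - S k ω) 0)
    (hC : TendstoInProb P C c) {E : ℕ → Set Ω}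
    (hE₁ : ∀ᶠ k in atTop, {ω | T k ω < C k ω} ⊆ E k)
    (hE₂ : ∀ᶠ k in atTop, E k ⊆ {ω | T k ω ≤ C k ω}) :
    Tendsto (fun k => P.real (E k)) atTop (𝓝 (G c)) := by
  have key : ∀ ε : ℝ, 0 < ε → Tendsto (fun k => P.real {ω | ε ≤ |T k ω - S k ω - 0|} +
      P.real {ω | ε ≤ |C k ω - c|}) atTop (𝓝 0) := fun ε hε => by
    simpa using (hT ε hε).add (hC ε hε)
  rw [tendsto_order]
  constructor
  · intro a ha
    obtain ⟨δ, hδ, h⟩ := Metric.eventually_nhds_iff.1 (hG.eventually (lt_mem_nhds ha))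
    -- The margin absorbs an error below `δ / 4` in `T - S` and another in `C`: off both exceptional
    -- events, `S ≤ c - 3 (δ / 4)` forces `T < C`. In the other direction `T ≤ C` forces `S ≤ c + 2
    -- (δ / 4)`.
    have h1 : a < G (c - 3 * (δ / 4)) := h (by
      rw [Real.dist_eq, show c - 3 * (δ / 4) - c = -(3 * (δ / 4)) by ring, abs_neg,
        abs_of_pos (by positivity)]; linarith)
    have h2 := (hS (c - 3 * (δ / 4))).sub (key (δ / 4) (by positivity))
    rw [sub_zero] at h2
    filter_upwards [h2.eventually (lt_mem_nhds h1), hE₁] with k hk hk1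
    refine hk.trans_le ?_
    rw [sub_le_iff_le_add]
    refine (measureReal_mono (?_ : _ ⊆ E k ∪ (_ ∪ _))).trans ((measureReal_union_le _ _).trans
      (add_le_add le_rfl (measureReal_union_le _ _)))
    intro ω hω
    by_contra hcon
    simp only [Set.mem_union, Set.mem_ofPred_eq, not_or, not_le, sub_zero, abs_lt] at hcon hω
    exact hcon.1 (hk1 (by simp only [Set.mem_ofPred_eq]; linarith))
  · intro a ha
    obtain ⟨δ, hδ, h⟩ := Metric.eventually_nhds_iff.1 (hG.eventually (gt_mem_nhds ha))
    have h1 : G (c + 2 * (δ / 4)) < a := h (by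
      rw [Real.dist_eq, show c + 2 * (δ / 4) - c = (2 * (δ / 4)) by ring,
        abs_of_pos (by positivity)]; linarith)
    have h2 := (hS (c + 2 * (δ / 4))).add (key (δ / 4) (by positivity))
    rw [add_zero] at h2
    filter_upwards [h2.eventually (gt_mem_nhds h1), hE₂] with k hk hk1
    refine lt_of_le_of_lt ?_ hk
    refine (measureReal_mono (?_ : E k ⊆ _ ∪ (_ ∪ _))).trans ((measureReal_union_le _ _).trans
      (add_le_add le_rfl (measureReal_union_le _ _)))
    intro ω hω
    by_contra hcon
    simp only [Set.mem_union, Set.mem_ofPred_eq, not_or, not_le, sub_zero, abs_lt] at hcon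
    have := hk1 hω
    simp only [Set.mem_ofPred_eq] at this
    linarith

/-- A sequence whose distribution functions converge to a probability distribution function is
tight; its product with a sequence tending to `0` in probability tends to `0`. -/
lemma TendstoInProb.mul_of_tendsto_cdf [IsProbabilityMeasure P] {S Z : ℕ → Ω → ℝ} {G : ℝ → ℝ}
    (hSm : ∀ k, Measurable (S k))
    (hS : ∀ x, Tendsto (fun k => P.real {ω | S k ω ≤ x}) atTop (𝓝 (G x)))
    (hG₀ : Tendsto G atBot (𝓝 0)) (hG₁ : Tendsto G atTop (𝓝 1))
    (hZ : TendstoInProb P Z 0) : TendstoInProb P (fun k ω => S k ω * Z k ω) 0 := by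
  intro ε hε
  rw [tendsto_order]
  refine ⟨fun a ha => Eventually.of_forall fun _ => ha.trans_le measureReal_nonneg, fun η hη => ?_⟩
  -- Tightness: outside events of eventual probability below `η / 4` at each end, `|S k|` is at most
  -- `K = max x y`.
  obtain ⟨x, hx0, hx⟩ : ∃ x : ℝ, 0 < x ∧ G (-x) < η / 4 := by
    have h := (tendsto_neg_atTop_atBot.eventually (hG₀.eventually (gt_mem_nhds
      (show (0 : ℝ) < η / 4 by positivity)))).and (eventually_gt_atTop (0 : ℝ))
    obtain ⟨x, hx⟩ := h.exists
    exact ⟨x, hx.2, hx.1⟩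
  obtain ⟨y, hy0, hy⟩ : ∃ y : ℝ, 0 < y ∧ 1 - η / 4 < G y := by
    have h := (hG₁.eventually (lt_mem_nhds
      (show (1 : ℝ) - η / 4 < 1 by linarith))).and (eventually_gt_atTop (0 : ℝ))
    obtain ⟨x, hx⟩ := h.exists
    exact ⟨x, hx.2, hx.1⟩
  set K := max x y
  have hK : 0 < K := hx0.trans_le (le_max_left _ _)
  filter_upwards [(hS (-x)).eventually (gt_mem_nhds hx), (hS y).eventually (lt_mem_nhds hy),
    (hZ (ε / K) (by positivity)).eventually (gt_mem_nhds (show (0 : ℝ) < η / 4 by positivity))]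
    with k h1 h2 h3
  have h4 : P.real {ω | S k ω ≤ y}ᶜ < η / 4 := by
    rw [probReal_compl_eq_one_sub (measurableSet_le (hSm k) measurable_const)]; linarith
  have : P.real {ω | ε ≤ |S k ω * Z k ω - 0|} ≤ P.real {ω | S k ω ≤ -x} +
      (P.real {ω | S k ω ≤ y}ᶜ + P.real {ω | ε / K ≤ |Z k ω - 0|}) := by
    refine le_trans ?_ ((measureReal_union_le _ _).trans
      (add_le_add le_rfl (measureReal_union_le _ _)))
    refine measureReal_mono fun ω hω => ?_
    by_contra hcon
    simp only [Set.mem_union, Set.mem_ofPred_eq, Set.mem_compl_iff, not_or, not_le, sub_zero,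
      not_lt, abs_mul] at hcon hω
    have hSK : |S k ω| ≤ K := abs_le.2 ⟨by
      have := le_max_left x y; linarith [hcon.1], hcon.2.1.trans (le_max_right _ _)⟩
    have : |S k ω| * |Z k ω| < ε := by
      calc _ ≤ K * |Z k ω| := by gcongr
        _ < K * (ε / K) := by gcongr; exact hcon.2.2
        _ = ε := by field_simp
    linarith
  linarith

end InProbability

/-! ### Sums of independent random variables -/

section Sums

variable {Ω : Type*} [MeasurableSpace Ω] {P : Measure Ω} [IsProbabilityMeasure P]

/-- The distribution function of the standard normal law. -/
def normalCDF (x : ℝ) : ℝ := (gaussianReal 0 1).real (Set.Iic x)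

/-- The jump of the distribution function at a point is the mass of that point. -/
lemma continuous_measureReal_Iic (μ : Measure ℝ) [IsProbabilityMeasure μ]
    (h : ∀ x, μ {x} = 0) : Continuous fun x => μ.real (Set.Iic x) := by
  have h1 : (fun x => μ.real (Set.Iic x)) = cdf μ := by ext x; rw [cdf_eq_real]
  rw [h1, continuous_iff_continuousAt]
  intro x
  have h2 := (cdf μ).measure_singleton x
  rw [measure_cdf, h x] at h2
  rw [(cdf μ).mono.continuousAt_iff_leftLim_eq_rightLim]
  have h3 : Function.rightLim (cdf μ) x = cdf μ x := (cdf μ).rightLim_eq x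
  rw [h3]
  have h4 := (cdf μ).mono.leftLim_le (le_refl x)
  have h5 := ENNReal.ofReal_eq_zero.1 h2.symm
  linarith

lemma continuous_normalCDF : Continuous normalCDF :=
  have : NullSingletonClass (gaussianReal 0 1) :=
    nullSingletonClass_gaussianReal (by norm_num)
  continuous_measureReal_Iic _ fun x => measure_singleton x

lemma normalCDF_neg (x : ℝ) : normalCDF (-x) = 1 - normalCDF x := by
  have : NullSingletonClass (gaussianReal 0 1) :=
    nullSingletonClass_gaussianReal (by norm_num)
  have h := gaussianReal_map_neg (μ := 0) (v := 1)
  rw [neg_zero] at h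
  unfold normalCDF
  conv_lhs => rw [← h]
  rw [map_measureReal_apply measurable_neg measurableSet_Iic]
  have : (fun x : ℝ => -x) ⁻¹' Set.Iic (-x) = Set.Ici x := by ext; simp
  rw [this, ← probReal_compl_eq_one_sub measurableSet_Iic, Set.compl_Iic]
  exact measureReal_congr Ioi_ae_eq_Ici.symm

lemma strictMono_normalCDF : StrictMono normalCDF := by
  intro x y hxy
  unfold normalCDF
  have hpos : 0 < (gaussianReal 0 1).real (Set.Ioc x y) := by
    rw [measureReal_def, ENNReal.toReal_pos_iff]
    refine ⟨?_, measure_lt_top _ _⟩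
    rw [pos_iff_ne_zero]
    intro h0
    have := gaussianReal_absolutelyContinuous' 0 (v := 1) (by norm_num) h0
    simp at this
    linarith
  have : (gaussianReal 0 1).real (Set.Iic y) = (gaussianReal 0 1).real (Set.Iic x) +
      (gaussianReal 0 1).real (Set.Ioc x y) := by
    rw [← measureReal_union (Set.Iic_disjoint_Ioc le_rfl) measurableSet_Ioc,
      Set.Iic_union_Ioc_eq_Iic hxy.le]
  linarith

lemma tendsto_normalCDF_atBot : Tendsto normalCDF atBot (𝓝 0) :=
  (tendsto_cdf_atBot (gaussianReal 0 1)).congr fun x => cdf_eq_real _ x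

lemma tendsto_normalCDF_atTop : Tendsto normalCDF atTop (𝓝 1) :=
  (tendsto_cdf_atTop (gaussianReal 0 1)).congr fun x => cdf_eq_real _ x

lemma exists_normalCDF_eq {γ : ℝ} (h0 : 0 < γ) (h1 : γ < 1) : ∃ z, normalCDF z = γ := by
  obtain ⟨a, ha⟩ := (tendsto_normalCDF_atBot.eventually (gt_mem_nhds h0)).exists
  obtain ⟨b, hb⟩ := (tendsto_normalCDF_atTop.eventually (lt_mem_nhds h1)).exists
  exact mem_range_of_exists_le_of_exists_ge continuous_normalCDF ⟨a, ha.le⟩ ⟨b, hb.le⟩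

/-- The central limit theorem for distribution functions. -/
lemma tendsto_cdf_of_iIndepFun {X : ℕ → Ω → ℝ} (hX : MemLp (X 0) 2 P) (hindep : iIndepFun X P)
    (hident : ∀ i, IdentDistrib (X i) (X 0) P P) (hvar : 0 < Var[X 0; P]) (x : ℝ) :
    Tendsto (fun n : ℕ => P.real {ω | (√n)⁻¹ * (∑ k ∈ Finset.range n, X k ω - n * P[X 0]) ≤ x})
      atTop (𝓝 (normalCDF (x / √Var[X 0; P]))) := by
  set v := Var[X 0; P]
  -- The Gaussian limit is realised by the identity map on the line.
  have hY : HasLaw id (gaussianReal 0 v.toNNReal) (gaussianReal 0 v.toNNReal) :=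
    ⟨by fun_prop, by simp⟩
  have hCLT := tendstoInDistribution_inv_sqrt_mul_sum_sub hY hX hindep hident
  have hv : v.toNNReal ≠ 0 := by simpa using hvar
  have : NullSingletonClass (gaussianReal 0 v.toNNReal) := nullSingletonClass_gaussianReal hv
  have h1 := ProbabilityMeasure.tendsto_measure_of_null_frontier_of_tendsto' hCLT.tendsto
    (E := Set.Iic x) (by
      simp only [ProbabilityMeasure.coe_mk, Measure.map_id]
      rw [frontier_Iic]; exact measure_singleton x)
  simp only [ProbabilityMeasure.coe_mk, Measure.map_id] at h1
  have h2 := (ENNReal.tendsto_toReal (measure_ne_top _ _)).comp h1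
  have h3 : (gaussianReal 0 v.toNNReal (Set.Iic x)).toReal = normalCDF (x / √v) := by
    have h4 := gaussianReal_map_const_mul (μ := 0) (v := 1) (√v)
    have h5 : gaussianReal (√v * 0) (NNReal.mk (√v ^ 2) (sq_nonneg _) * 1) =
        gaussianReal 0 v.toNNReal := by
      congr 1
      · simp
      · ext; simp [hvar.le]
    rw [h5] at h4
    rw [← h4, Measure.map_apply (by fun_prop) measurableSet_Iic, normalCDF, measureReal_def]
    congr 2
    ext y
    simp only [Set.mem_preimage, Set.mem_Iic]
    rw [le_div_iff₀ (Real.sqrt_pos.2 hvar), mul_comm]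
  rw [h3] at h2
  refine h2.congr fun n => ?_
  simp only [Function.comp_apply]
  rw [Measure.map_apply_of_aemeasurable (hCLT.forall_aemeasurable n) measurableSet_Iic,
    measureReal_def]
  rfl

/-- Variances add by independence, and each is at most the raw second moment. This bound drives the
weak law `tendstoInProb_sum`. -/
lemma variance_sum_range {W : ℕ → Ω → ℝ} (hW : MemLp (W 0) 2 P) (hindep : iIndepFun W P)
    (hident : ∀ i, IdentDistrib (W i) (W 0) P P) (n : ℕ) :
    MemLp (fun ω => ∑ i ∈ Finset.range n, W i ω - n * P[W 0]) 2 P ∧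
      ∫ ω, (∑ i ∈ Finset.range n, W i ω - n * P[W 0]) ^ 2 ∂P ≤ n * ∫ ω, W 0 ω ^ 2 ∂P := by
  have hL : ∀ i, MemLp (W i) 2 P := fun i => (hident i).memLp_iff.2 hW
  have hS : MemLp (∑ i ∈ Finset.range n, W i) 2 P := memLp_finsetSum' _ fun i _ => hL i
  have hmean : ∫ ω, (∑ i ∈ Finset.range n, W i) ω ∂P = n * P[W 0] := by
    simp only [Finset.sum_apply]
    rw [integral_finsetSum _ fun i _ => (hL i).integrable (by norm_num)]
    simp [fun i => (hident i).integral_eq]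
  have hfun : (fun ω => ∑ i ∈ Finset.range n, W i ω - n * P[W 0]) =
      fun ω => (∑ i ∈ Finset.range n, W i) ω - ∫ ω, (∑ i ∈ Finset.range n, W i) ω ∂P := by
    ext ω; rw [hmean]; simp
  constructor
  · rw [hfun]; exact hS.sub (memLp_const _)
  · have hv : Var[∑ i ∈ Finset.range n, W i; P] =
        ∫ ω, (∑ i ∈ Finset.range n, W i ω - n * P[W 0]) ^ 2 ∂P := by
      rw [variance_eq_integral hS.aemeasurable, hmean]; simp
    rw [← hv, IndepFun.variance_sum (fun i _ => hL i)
      (fun i _ j _ hij => hindep.indepFun hij)]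
    simp only [fun i => (hident i).variance_eq]
    rw [Finset.sum_const, Finset.card_range, nsmul_eq_mul]
    gcongr
    exact variance_le_expectation_sq hW.aestronglyMeasurable

end Sums

/-! ### Quantiles -/

/-- By monotonicity `a` is a lower bound of the set defining the quantile, and `b` belongs to it.
Finiteness of the measure is enough, so the total mass of `studentT d` need not be computed. -/
lemma quantile_mem_Icc {μ : Measure ℝ} [IsFiniteMeasure μ] {γ a b : ℝ}
    (ha : μ.real (Set.Iic a) < γ) (hb : γ ≤ μ.real (Set.Iic b)) :
    a ≤ quantile μ γ ∧ quantile μ γ ≤ b := by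
  have hlow : ∀ x ∈ {x : ℝ | γ ≤ μ.real (Set.Iic x)}, a ≤ x := by
    intro x hx
    by_contra! h
    exact absurd (hx.trans (measureReal_mono (Set.Iic_subset_Iic.2 h.le))) (not_le.2 ha)
  exact ⟨le_csInf ⟨b, hb⟩ hlow, csInf_le ⟨a, hlow⟩ hb⟩

/-- Without atoms the distribution function is continuous, so a value different from `γ` would
persist near the quantile and contradict its being an infimum. -/
lemma measureReal_Iic_quantile (μ : Measure ℝ) [IsProbabilityMeasure μ] (h : ∀ x, μ {x} = 0)
    {γ : ℝ} (h0 : 0 < γ) (h1 : γ < 1) : μ.real (Set.Iic (quantile μ γ)) = γ := by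
  have hc := continuous_measureReal_Iic μ h
  obtain ⟨a, ha⟩ := (((tendsto_cdf_atBot μ).congr fun x => cdf_eq_real _ x).eventually
    (gt_mem_nhds h0)).exists
  obtain ⟨b, hb⟩ := (((tendsto_cdf_atTop μ).congr fun x => cdf_eq_real _ x).eventually
    (lt_mem_nhds h1)).exists
  have hmono : Monotone fun x => μ.real (Set.Iic x) :=
    fun x y hxy => measureReal_mono (Set.Iic_subset_Iic.2 hxy)
  apply le_antisymm
  · refine le_of_forall_pos_le_add fun ε hε => ?_
    by_contra! hcon
    obtain ⟨δ, hδ, hδ'⟩ := Metric.eventually_nhds_iff.1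
      ((hc.tendsto (quantile μ γ)).eventually (lt_mem_nhds hcon))
    have h2 := @hδ' (quantile μ γ - δ / 2) (by
      rw [Real.dist_eq, sub_sub_cancel_left, abs_neg, abs_of_pos (by positivity)]; linarith)
    have := (quantile_mem_Icc (μ := μ) ha (b := quantile μ γ - δ / 2) (by linarith)).2
    linarith
  · refine le_of_forall_pos_le_add fun ε hε => ?_
    by_contra! hcon
    have hcon' : μ.real (Set.Iic (quantile μ γ)) < γ := by linarith
    obtain ⟨δ, hδ, hδ'⟩ := Metric.eventually_nhds_iff.1
      ((hc.tendsto (quantile μ γ)).eventually (gt_mem_nhds hcon'))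
    have h2 := @hδ' (quantile μ γ + δ / 2) (by
      rw [Real.dist_eq, add_sub_cancel_left, abs_of_pos (by positivity)]; linarith)
    have := (quantile_mem_Icc (μ := μ) h2 hb.le).1
    linarith

/-! ### Quantiles of Student's t-distribution with many degrees of freedom -/

/-- Logarithmic convexity of Gamma at the midpoint of `x` and `x + 1`, combined with the functional
equation. -/
lemma Gamma_add_half_le {x : ℝ} (hx : 0 < x) :
    Real.Gamma (x + 1 / 2) ≤ √x * Real.Gamma x := by
  have h := Real.Gamma_mul_add_mul_le_rpow_Gamma_mul_rpow_Gamma (s := x) (t := x + 1)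
    (a := 1 / 2) (b := 1 / 2) hx (by linarith) (by norm_num) (by norm_num) (by norm_num)
  have hG := Real.Gamma_pos_of_pos hx
  rw [show 1 / 2 * x + 1 / 2 * (x + 1) = x + 1 / 2 by ring, Real.Gamma_add_one hx.ne',
    ← Real.sqrt_eq_rpow, ← Real.sqrt_eq_rpow, Real.sqrt_mul hx.le] at h
  calc _ ≤ _ := h
    _ = √x * (√(Real.Gamma x) * √(Real.Gamma x)) := by ring
    _ = _ := by rw [Real.mul_self_sqrt hG.le]

/-- The upper bound `Gamma_add_half_le` at `x - 1 / 2`, turned around by the functional equation. -/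
lemma le_Gamma_add_half {x : ℝ} (hx : 1 / 2 < x) :
    √(x - 1 / 2) * Real.Gamma x ≤ Real.Gamma (x + 1 / 2) := by
  have h := Gamma_add_half_le (x := x - 1 / 2) (by linarith)
  rw [sub_add_cancel] at h
  have h2 := Real.Gamma_add_one (s := x - 1 / 2) (by linarith)
  rw [show x - 1 / 2 + 1 = x + 1 / 2 by ring] at h2
  rw [h2]
  calc _ ≤ √(x - 1 / 2) * (√(x - 1 / 2) * Real.Gamma (x - 1 / 2)) := by gcongr
    _ = _ := by rw [← mul_assoc, Real.mul_self_sqrt (by linarith)]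

lemma sqrt_mul_pi {d : ℝ} (hd : 0 ≤ d) : √(d * Real.pi) = √(d / 2) * √(2 * Real.pi) := by
  rw [← Real.sqrt_mul (by linarith)]
  congr 1; ring

/-- The two Gamma bounds at `x = d / 2` squeeze the normalising constant between `√(1 - 1 / d)`
times the Gaussian constant and the Gaussian constant itself. -/
lemma tendsto_studentT_const :
    Tendsto (fun d : ℝ => Real.Gamma ((d + 1) / 2) / (√(d * Real.pi) * Real.Gamma (d / 2)))
      atTop (𝓝 (√(2 * Real.pi))⁻¹) := by
  have hpi := Real.pi_pos
  have hlow : Tendsto (fun d : ℝ => √(1 - 1 / d) * (√(2 * Real.pi))⁻¹) atTop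
      (𝓝 (√(2 * Real.pi))⁻¹) := by
    have : Tendsto (fun d : ℝ => 1 - 1 / d) atTop (𝓝 1) := by
      simpa using tendsto_const_nhds.sub (tendsto_inv_atTop_zero (𝕜 := ℝ))
    simpa using (this.sqrt).mul_const (√(2 * Real.pi))⁻¹
  refine tendsto_of_tendsto_of_tendsto_of_le_of_le' hlow tendsto_const_nhds ?_ ?_
  · filter_upwards [eventually_gt_atTop 1] with d hd
    have hG := Real.Gamma_pos_of_pos (show 0 < d / 2 by linarith)
    have h := le_Gamma_add_half (x := d / 2) (by linarith)
    rw [le_div_iff₀ (by positivity), show (d + 1) / 2 = d / 2 + 1 / 2 by ring]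
    refine le_of_eq_of_le ?_ h
    have e1 : √(d / 2 - 1 / 2) = √(1 - 1 / d) * √(d / 2) := by
      rw [← Real.sqrt_mul' _ (by linarith)]
      congr 1; field_simp
    have hs : 0 < √(2 * Real.pi) := by positivity
    rw [e1, sqrt_mul_pi (d := d) (by linarith)]
    generalize √(2 * Real.pi) = s at *
    field_simp
  · filter_upwards [eventually_gt_atTop 1] with d hd
    have hG := Real.Gamma_pos_of_pos (show 0 < d / 2 by linarith)
    have h := Gamma_add_half_le (x := d / 2) (by linarith)
    rw [div_le_iff₀ (by positivity), show (d + 1) / 2 = d / 2 + 1 / 2 by ring]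
    refine h.trans (le_of_eq ?_)
    have hs : 0 < √(2 * Real.pi) := by positivity
    rw [sqrt_mul_pi (d := d) (by linarith)]
    generalize √(2 * Real.pi) = s at *
    field_simp

lemma studentTPDF_nonneg {d : ℝ} (hd : 0 < d) (x : ℝ) : 0 ≤ studentTPDF d x := by
  have h1 := Real.Gamma_pos_of_pos (show 0 < (d + 1) / 2 by linarith)
  have h2 := Real.Gamma_pos_of_pos (show 0 < d / 2 by linarith)
  unfold studentTPDF
  positivity

lemma tendsto_studentTPDF (x : ℝ) :
    Tendsto (fun d => studentTPDF d x) atTop (𝓝 (gaussianPDFReal 0 1 x)) := by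
  have h1 : Tendsto (fun d : ℝ => 1 + x ^ 2 / d) atTop (𝓝 1) := by
    simpa using tendsto_const_nhds.add (tendsto_const_nhds.div_atTop (a := x ^ 2) tendsto_id)
  -- The exponent `-(d + 1) / 2` is split into `d * (-1 / 2)` and `-1 / 2`, so that the limit of `(1
  -- + x² / d) ^ d` applies to the first factor.
  have h2 : Tendsto (fun d : ℝ => ((1 + x ^ 2 / d) ^ d) ^ (-(1 / 2) : ℝ) *
      (1 + x ^ 2 / d) ^ (-(1 / 2) : ℝ)) atTop (𝓝 (Real.exp (x ^ 2) ^ (-(1 / 2) : ℝ) * 1)) := by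
    refine Tendsto.mul ?_ ?_
    · exact (Real.tendsto_one_add_div_rpow_exp (x ^ 2)).rpow_const
        (Or.inl (Real.exp_pos _).ne')
    · simpa using h1.rpow_const (p := (-(1 / 2) : ℝ)) (Or.inl one_ne_zero)
  have h3 := tendsto_studentT_const.mul h2
  have h4 : gaussianPDFReal 0 1 x =
      (√(2 * Real.pi))⁻¹ * (Real.exp (x ^ 2) ^ (-(1 / 2) : ℝ) * 1) := by
    rw [gaussianPDFReal, mul_one, ← Real.exp_mul]
    simp only [NNReal.coe_one, mul_one, sub_zero]
    congr 2; ring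
  rw [h4]
  refine h3.congr' ?_
  filter_upwards [eventually_gt_atTop 0] with d hd
  have h5 : 0 < 1 + x ^ 2 / d := by positivity
  rw [studentTPDF, ← Real.rpow_mul h5.le, ← Real.rpow_add h5]
  congr 2; ring

/-- Bernoulli's inequality with exponent `d / 2 ≥ 1` produces `1 + x² / 2`, free of `d`. The
resulting Cauchy-type majorant permits dominated convergence of the t-densities. -/
lemma studentTPDF_le {d : ℝ} (hd : 2 ≤ d) (x : ℝ) :
    (1 + x ^ 2 / d) ^ (-((d + 1) / 2)) ≤ 2 * (1 + x ^ 2)⁻¹ := by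
  have h5 : 1 ≤ 1 + x ^ 2 / d := le_add_of_nonneg_right (by positivity)
  have h1 : 1 + x ^ 2 / 2 ≤ (1 + x ^ 2 / d) ^ ((d + 1) / 2) := by
    calc 1 + x ^ 2 / 2 = 1 + d / 2 * (x ^ 2 / d) := by field_simp
      _ ≤ (1 + x ^ 2 / d) ^ (d / 2) := one_add_mul_self_le_rpow_one_add
          (le_trans (by norm_num) (show 0 ≤ x ^ 2 / d by positivity)) (by linarith)
      _ ≤ _ := Real.rpow_le_rpow_of_exponent_le h5 (by linarith)
  rw [Real.rpow_neg (by linarith), ← div_eq_mul_inv, inv_eq_one_div,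
    div_le_div_iff₀ (by positivity) (by positivity)]
  nlinarith

lemma measurable_studentTPDF (d : ℝ) : Measurable (studentTPDF d) := by
  unfold studentTPDF; fun_prop

lemma eventually_studentTPDF_le : ∃ C : ℝ, ∀ᶠ d in atTop, ∀ x,
    ‖studentTPDF d x‖ ≤ C * (1 + x ^ 2)⁻¹ := by
  refine ⟨((√(2 * Real.pi))⁻¹ + 1) * 2, ?_⟩
  filter_upwards [tendsto_studentT_const.eventually (gt_mem_nhds (lt_add_one _)),
    eventually_ge_atTop 2] with d h1 h2 x
  rw [Real.norm_of_nonneg (studentTPDF_nonneg (by linarith) x), studentTPDF, mul_assoc _ 2]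
  exact mul_le_mul h1.le (studentTPDF_le h2 x) (by positivity) (by positivity)

lemma integrable_studentTPDF : ∀ᶠ d in atTop, Integrable (studentTPDF d) := by
  obtain ⟨C, hC⟩ := eventually_studentTPDF_le
  filter_upwards [hC] with d hd
  exact (integrable_inv_one_add_sq.const_mul C).mono'
    (measurable_studentTPDF d).aestronglyMeasurable (ae_of_all _ hd)

lemma tendsto_studentT_Iic (y : ℝ) :
    Tendsto (fun d => (studentT d).real (Set.Iic y)) atTop (𝓝 (normalCDF y)) := by
  obtain ⟨C, hC⟩ := eventually_studentTPDF_le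
  have h1 : Tendsto (fun d => ∫ x in Set.Iic y, studentTPDF d x) atTop
      (𝓝 (∫ x in Set.Iic y, gaussianPDFReal 0 1 x)) := by
    refine tendsto_integral_filter_of_dominated_convergence (fun x => C * (1 + x ^ 2)⁻¹)
      (Eventually.of_forall fun d => (measurable_studentTPDF d).aestronglyMeasurable) ?_
      (integrable_inv_one_add_sq.const_mul C).integrableOn
      (ae_of_all _ fun x => tendsto_studentTPDF x)
    filter_upwards [hC] with d hd
    exact ae_of_all _ hd
  have h2 : normalCDF y = ∫ x in Set.Iic y, gaussianPDFReal 0 1 x := by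
    rw [normalCDF, measureReal_def, gaussianReal_apply_eq_integral 0 (by norm_num),
      ENNReal.toReal_ofReal (integral_nonneg fun x => gaussianPDFReal_nonneg _ _ x)]
  rw [h2]
  refine h1.congr' ?_
  filter_upwards [eventually_gt_atTop 0] with d hd
  rw [studentT, measureReal_def, withDensity_apply _ measurableSet_Iic,
    integral_eq_lintegral_of_nonneg_ae (ae_of_all _ (studentTPDF_nonneg hd))
      (measurable_studentTPDF d).aestronglyMeasurable]

/-- The quantiles of the t-distribution converge to those of the normal distribution. -/
lemma tendsto_tQuantile {γ z : ℝ} (hz : normalCDF z = γ) :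
    Tendsto (fun d => tQuantile γ d) atTop (𝓝 z) := by
  rw [Metric.tendsto_nhds]
  intro ε hε
  have h1 : normalCDF (z - ε / 2) < γ := hz ▸ strictMono_normalCDF (by linarith)
  have h2 : γ < normalCDF (z + ε / 2) := hz ▸ strictMono_normalCDF (by linarith)
  filter_upwards [(tendsto_studentT_Iic _).eventually (gt_mem_nhds h1),
    (tendsto_studentT_Iic _).eventually (lt_mem_nhds h2), integrable_studentTPDF] with d h3 h4 h5
  have : IsFiniteMeasure (studentT d) := isFiniteMeasure_withDensity_ofReal h5.2
  obtain ⟨h6, h7⟩ := quantile_mem_Icc h3 h4.le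
  rw [Real.dist_eq, tQuantile, abs_lt]
  constructor <;> linarith

/-! ### Order statistics -/

section OrderStatistics

variable {α : ℝ} {n : ℕ}

/-- The `⌈α n⌉`-th smallest entry has position `⌈α n⌉ - 1` when counted from zero; this keeps
`quantileIndex` out of its default branch. -/
lemma ceil_sub_one_lt (hα1 : α < 1) (hn : 0 < n) : ⌈α * n⌉₊ - 1 < n := by
  have hn' : (0 : ℝ) < n := by exact_mod_cast hn
  have : ⌈α * n⌉₊ ≤ n := Nat.ceil_le.2 (by nlinarith)
  omega

lemma varEst_eq (hα1 : α < 1) (hn : 0 < n) (y : ℕ → ℝ) :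
    varEst α n y = y (Tuple.sort (fun i : Fin n => y i) ⟨⌈α * n⌉₊ - 1, ceil_sub_one_lt hα1 hn⟩) := by
  rw [varEst, quantileIndex, dif_pos (ceil_sub_one_lt hα1 hn)]

lemma quantileIndex_lt (hα1 : α < 1) (hn : 0 < n) (y : ℕ → ℝ) : quantileIndex α n y < n := by
  rw [quantileIndex, dif_pos (ceil_sub_one_lt hα1 hn)]
  exact Fin.is_lt _

lemma card_filter_fin_eq (p : ℝ → Prop) [DecidablePred p] (y : ℕ → ℝ) :
    (Finset.univ.filter fun i : Fin n => p (y i)).card =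
      ((Finset.range n).filter fun i => p (y i)).card := by
  rw [Finset.card_filter, Finset.card_filter, Finset.sum_range (fun i => if p (y i) then 1 else 0)]

lemma ceil_sub_one_lt_iff (hα0 : 0 < α) (hn : 0 < n) (c : ℕ) :
    ⌈α * n⌉₊ - 1 < c ↔ α * n ≤ c := by
  have hpos : 0 < ⌈α * n⌉₊ := Nat.ceil_pos.2 (by positivity)
  rw [← Nat.ceil_le]; omega

/-- In a sorted tuple the entry at position `j` is at most `t` exactly when more than `j` entries
are. Everything later about the order statistic goes through this count. -/
lemma varEst_le_iff_card (hα0 : 0 < α) (hα1 : α < 1) (hn : 0 < n) (y : ℕ → ℝ) (t : ℝ) :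
    varEst α n y ≤ t ↔ α * n ≤ ((Finset.range n).filter fun i => y i ≤ t).card := by
  set f : Fin n → ℝ := fun i => y i with hf
  have h := Tuple.lt_card_le_iff_apply_le_of_monotone (a := t)
    (j := ⟨⌈α * n⌉₊ - 1, ceil_sub_one_lt hα1 hn⟩) (Tuple.monotone_sort f)
  have hcard : (Finset.univ.filter fun i => (f ∘ Tuple.sort f) i ≤ t).card =
      ((Finset.range n).filter fun i => y i ≤ t).card := by
    rw [← card_filter_fin_eq (fun x => x ≤ t)]
    exact Finset.card_equiv (Tuple.sort f) (by intro i; simp [f])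
  rw [hcard, ceil_sub_one_lt_iff hα0 hn] at h
  rw [varEst_eq hα1 hn]
  exact h.symm

lemma varEst_le_iff (hα0 : 0 < α) (hα1 : α < 1) (hn : 0 < n) (y : ℕ → ℝ) (t : ℝ) :
    varEst α n y ≤ t ↔ α * n ≤ ∑ i ∈ Finset.range n, if y i ≤ t then (1 : ℝ) else 0 := by
  rw [varEst_le_iff_card hα0 hα1 hn, Finset.sum_boole]

/-- If `α n` entries were strictly below the order statistic, the largest of them would already
satisfy the counting criterion. -/
lemma sum_lt_varEst_lt (hα0 : 0 < α) (hα1 : α < 1) (hn : 0 < n) (y : ℕ → ℝ) :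
    ∑ i ∈ Finset.range n, (if y i < varEst α n y then (1 : ℝ) else 0) < α * n := by
  by_contra! hcon
  set w := varEst α n y with hw
  have hn' : (0 : ℝ) < n := by exact_mod_cast hn
  set s := (Finset.range n).filter fun i => y i < w with hs
  have hne : s.Nonempty := by
    rw [Finset.nonempty_iff_ne_empty]
    intro h
    rw [Finset.sum_boole, ← hs, h] at hcon
    simp only [Finset.card_empty, Nat.cast_zero] at hcon
    nlinarith
  obtain ⟨j, hj, hmax⟩ := s.exists_max_image y hne
  have hjw : y j < w := (Finset.mem_filter.1 hj).2
  have : varEst α n y ≤ y j := by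
    rw [varEst_le_iff hα0 hα1 hn]
    refine hcon.trans (Finset.sum_le_sum fun i hi => ?_)
    by_cases h : y i < w
    · rw [if_pos h, if_pos (hmax i (Finset.mem_filter.2 ⟨hi, h⟩))]
    · rw [if_neg h]; split_ifs <;> norm_num
  linarith

/-- The order statistic is monotone by counting. With a shift `η` this yields both its translation
equivariance and its continuity. -/
lemma varEst_le_add (hα0 : 0 < α) (hα1 : α < 1) (hn : 0 < n) {y y' : ℕ → ℝ} {η : ℝ}
    (h : ∀ i < n, y i ≤ y' i + η) : varEst α n y ≤ varEst α n y' + η := by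
  rw [varEst_le_iff hα0 hα1 hn]
  refine ((varEst_le_iff hα0 hα1 hn y' _).1 le_rfl).trans (Finset.sum_le_sum fun i hi => ?_)
  have := h i (Finset.mem_range.1 hi)
  split_ifs <;> linarith

lemma varEst_add_const (hα0 : 0 < α) (hα1 : α < 1) (hn : 0 < n) (y : ℕ → ℝ) (s : ℝ) :
    varEst α n (fun i => y i + s) = varEst α n y + s := by
  apply le_antisymm
  · exact varEst_le_add hα0 hα1 hn fun i _ => le_rfl
  · have := varEst_le_add hα0 hα1 hn (y := y) (y' := fun i => y i + s) (η := -s)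
      fun i _ => by simp
    linarith

lemma continuous_varEst (hα0 : 0 < α) (hα1 : α < 1) (hn : 0 < n) : Continuous (varEst α n) := by
  rw [continuous_iff_continuousAt]
  intro y
  refine Metric.tendsto_nhds.2 fun ε hε => ?_
  have h : ∀ᶠ z in 𝓝 y, ∀ i ∈ Finset.range n, dist (z i) (y i) < ε / 2 := by
    rw [Filter.eventually_all_finset]
    intro i _
    exact Metric.tendsto_nhds.1 ((continuous_apply i).tendsto y) (ε / 2) (by positivity)
  filter_upwards [h] with z hz
  have h1 := varEst_le_add hα0 hα1 hn (y := z) (y' := y) (η := ε / 2) fun i hi => by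
    have := hz i (Finset.mem_range.2 hi)
    rw [Real.dist_eq, abs_lt] at this
    linarith
  have h2 := varEst_le_add hα0 hα1 hn (y := y) (y' := z) (η := ε / 2) fun i hi => by
    have := hz i (Finset.mem_range.2 hi)
    rw [Real.dist_eq, abs_lt] at this
    linarith
  rw [Real.dist_eq, abs_lt]
  constructor <;> linarith

/-- A given permutation is the stable sort exactly when finitely many comparisons between
coordinates hold, including the rule that ties keep the order of the indices. -/
lemma measurable_quantileIndex (α : ℝ) (n : ℕ) : Measurable (quantileIndex α n) := by
  by_cases hk : ⌈α * n⌉₊ - 1 < n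
  · have hset : ∀ σ : Equiv.Perm (Fin n),
        MeasurableSet {y : ℕ → ℝ | σ = Tuple.sort (fun i : Fin n => y i)} := by
      intro σ
      have : {y : ℕ → ℝ | σ = Tuple.sort (fun i : Fin n => y i)} =
          (⋂ i, ⋂ j, ⋂ (_ : i ≤ j), {y : ℕ → ℝ | y (σ i) ≤ y (σ j)}) ∩
          (⋂ i, ⋂ j, ⋂ (_ : i < j), ⋂ (_ : ¬ σ i < σ j), {y : ℕ → ℝ | y (σ i) = y (σ j)}ᶜ) := by
        ext y
        simp only [Tuple.eq_sort_iff, Monotone, Function.comp_apply, Set.mem_ofPred_eq,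
          Set.mem_inter_iff, Set.mem_iInter, Set.mem_compl_iff]
        exact and_congr_right fun _ => forall_congr' fun i => forall_congr' fun j =>
          forall_congr' fun _ => not_imp_not.symm
      rw [this]
      refine MeasurableSet.inter ?_ ?_
      · exact .iInter fun i => .iInter fun j => .iInter fun _ =>
          measurableSet_le (measurable_pi_apply _) (measurable_pi_apply _)
      · exact .iInter fun i => .iInter fun j => .iInter fun _ => .iInter fun _ =>
          (measurableSet_eq_fun (measurable_pi_apply (σ i : ℕ))
            (measurable_pi_apply (σ j : ℕ))).compl
    refine measurable_to_countable' fun m => ?_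
    have : quantileIndex α n ⁻¹' {m} = ⋃ σ ∈ {σ : Equiv.Perm (Fin n) | (σ ⟨_, hk⟩ : ℕ) = m},
        {y : ℕ → ℝ | σ = Tuple.sort (fun i : Fin n => y i)} := by
      ext y
      simp [quantileIndex, hk]
    rw [this]
    exact .biUnion (Set.to_countable _) fun σ _ => hset σ
  · have : quantileIndex α n = fun _ => 0 := by ext y; simp [quantileIndex, hk]
    rw [this]; exact measurable_const

lemma continuous_excess (hα0 : 0 < α) (hα1 : α < 1) (hn : 0 < n) (i : ℕ) :
    Continuous fun y => excess α n y i := by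
  have := continuous_varEst hα0 hα1 hn
  unfold excess; fun_prop

lemma continuous_cvarEst (hα0 : 0 < α) (hα1 : α < 1) (hn : 0 < n) :
    Continuous (cvarEst α n) := by
  have := continuous_varEst hα0 hα1 hn
  have := continuous_excess hα0 hα1 hn
  unfold cvarEst; fun_prop

lemma continuous_gaussianPDFReal : Continuous (gaussianPDFReal 0 1) := by
  rw [gaussianPDFReal_def]; fun_prop

lemma kde_pos {b : ℝ} (hb : 0 < b) (hn : 0 < n) (y : ℕ → ℝ) (x : ℝ) : 0 < kde b n y x := by
  unfold kde
  have : (0 : ℝ) < n := by exact_mod_cast hn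
  refine div_pos (Finset.sum_pos (fun i _ => gaussianPDFReal_pos _ _ _ (by norm_num)) ?_)
    (by positivity)
  exact Finset.nonempty_range_iff.2 hn.ne'

lemma continuous_sigmaV {b : ℝ} (hα0 : 0 < α) (hα1 : α < 1) (hb : 0 < b) (hn : 0 < n) :
    Continuous (sigmaV α b n) := by
  have h1 := continuous_varEst hα0 hα1 hn
  have h2 := continuous_gaussianPDFReal
  unfold sigmaV
  refine continuous_const.div ?_ fun y => (kde_pos hb hn _ _).ne'
  unfold kde
  fun_prop

lemma continuous_sampleVar (n : ℕ) : Continuous (sampleVar n) := by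
  unfold sampleVar sampleMean; fun_prop

lemma continuous_sigmaC (hα0 : 0 < α) (hα1 : α < 1) (hn : 0 < n) :
    Continuous (sigmaC α n) := by
  have h1 : Continuous (excess α n) := continuous_pi fun i => continuous_excess hα0 hα1 hn i
  have h2 := (continuous_sampleVar n).comp h1
  unfold sigmaC
  exact (h2.sqrt).div_const _

lemma excess_add_const (hα0 : 0 < α) (hα1 : α < 1) (hn : 0 < n) (y : ℕ → ℝ) (s : ℝ) :
    excess α n (fun i => y i + s) = excess α n y := by
  ext i; simp [excess, varEst_add_const hα0 hα1 hn]

lemma sigmaV_add_const (hα0 : 0 < α) (hα1 : α < 1) (hn : 0 < n) (b : ℝ) (y : ℕ → ℝ) (s : ℝ) :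
    sigmaV α b n (fun i => y i + s) = sigmaV α b n y := by
  simp [sigmaV, kde, varEst_add_const hα0 hα1 hn]

lemma sigmaC_add_const (hα0 : 0 < α) (hα1 : α < 1) (hn : 0 < n) (y : ℕ → ℝ) (s : ℝ) :
    sigmaC α n (fun i => y i + s) = sigmaC α n y := by
  simp [sigmaC, excess_add_const hα0 hα1 hn]

lemma cvarEst_add_const (hα0 : 0 < α) (hα1 : α < 1) (hn : 0 < n) (y : ℕ → ℝ) (s : ℝ) :
    cvarEst α n (fun i => y i + s) = cvarEst α n y + s := by
  simp [cvarEst, excess_add_const hα0 hα1 hn, varEst_add_const hα0 hα1 hn]; ring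

/-- The CVaR estimator is the value at the VaR estimate of `u ↦ u + ∑ (y i - u)⁺ / ((1 - α) n)`;
its distance from the value at `v` is of second order. -/
lemma abs_cvarEst_sub_le (hα0 : 0 < α) (hα1 : α < 1) (hn : 0 < n) (y : ℕ → ℝ) (v : ℝ) :
    |cvarEst α n y - (v + 1 / ((1 - α) * n) * ∑ i ∈ Finset.range n, max (y i - v) 0)| ≤
      |varEst α n y - v| *
        |(∑ i ∈ Finset.range n, if y i ≤ v then (1 : ℝ) else 0) / n - α| / (1 - α) := by
  have hn' : (0 : ℝ) < n := by exact_mod_cast hn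
  have hα : 0 < 1 - α := by linarith
  set w := varEst α n y with hw
  -- At least `α n` entries are at or below `w` and at most `α n` strictly below it: these are the
  -- one-sided derivative conditions for a minimum at `w`.
  have h1 : α * n ≤ ∑ i ∈ Finset.range n, if y i ≤ w then (1 : ℝ) else 0 :=
    (varEst_le_iff hα0 hα1 hn y w).1 le_rfl
  have h2 := (sum_lt_varEst_lt hα0 hα1 hn y).le
  rw [← hw] at h2
  set F : ℝ := ∑ i ∈ Finset.range n, if y i ≤ v then (1 : ℝ) else 0 with hF
  set Sw : ℝ := ∑ i ∈ Finset.range n, max (y i - w) 0 with hSw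
  set Sv : ℝ := ∑ i ∈ Finset.range n, max (y i - v) 0 with hSv
  have hc : cvarEst α n y = w + 1 / ((1 - α) * n) * Sw := rfl
  have hsum1 : ∑ i ∈ Finset.range n, (1 : ℝ) = n := by simp
  rw [hc]
  set A : ℝ := F / n - α with hA
  have hAF : F = (A + α) * n := by rw [hA]; field_simp; ring
  -- In either case each difference of positive parts is compared with `|v - w|` times an indicator.
  -- Counting the entries above `v` gives the bound containing `F`; counting at `w` gives the bound
  -- containing `α n`.
  obtain hwv | hwv := le_total w v
  · have hlow : (v - w) * (n - F) ≤ Sw - Sv := by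
      rw [← hsum1, hF, hSw, hSv, ← Finset.sum_sub_distrib, ← Finset.sum_sub_distrib,
        Finset.mul_sum]
      refine Finset.sum_le_sum fun i _ => ?_
      split_ifs with h
      · simp only [sub_self, mul_zero, sub_nonneg]
        exact max_le_max (by linarith) le_rfl
      · push Not at h
        rw [max_eq_left (by linarith), max_eq_left (by linarith)]
        linarith
    have hup : Sw - Sv ≤ (v - w) * (n - α * n) := by
      refine le_trans ?_ (mul_le_mul_of_nonneg_left (sub_le_sub_left h1 _) (by linarith))
      rw [← hsum1, hSw, hSv, ← Finset.sum_sub_distrib, ← Finset.sum_sub_distrib, Finset.mul_sum]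
      refine Finset.sum_le_sum fun i _ => ?_
      split_ifs with h
      · simp [max_eq_right (show y i - w ≤ 0 by linarith)]
      · push Not at h
        rw [max_eq_left (show 0 ≤ y i - w by linarith)]
        have := le_max_left (y i - v) 0
        linarith
    have e : w + 1 / ((1 - α) * n) * Sw - (v + 1 / ((1 - α) * n) * Sv) =
        (w - v) + (Sw - Sv) / ((1 - α) * n) := by ring
    have l1 : (v - w) * (1 - (A + α)) / (1 - α) ≤ (Sw - Sv) / ((1 - α) * n) := by
      rw [div_le_div_iff₀ hα (by positivity)]
      calc _ = ((v - w) * (n - F)) * (1 - α) := by rw [hAF]; ring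
        _ ≤ _ := by gcongr
    have l2 : (Sw - Sv) / ((1 - α) * n) ≤ v - w := by
      rw [div_le_iff₀ (by positivity)]
      linarith
    have l3 : (v - w) * (1 - (A + α)) / (1 - α) = (v - w) + (v - w) * (-A) / (1 - α) := by
      field_simp; ring
    have l4 : (v - w) * (-A) / (1 - α) ≥ -((v - w) * |A| / (1 - α)) := by
      rw [ge_iff_le, ← neg_div, ← mul_neg]
      have := le_abs_self A
      gcongr
    rw [e, abs_sub_comm w v, abs_of_nonneg (show 0 ≤ v - w by linarith), abs_le]
    have l5 : 0 ≤ (v - w) * |A| / (1 - α) :=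
      div_nonneg (mul_nonneg (by linarith) (abs_nonneg _)) hα.le
    constructor <;> linarith
  · have hup : Sv - Sw ≤ (w - v) * (n - F) := by
      rw [← hsum1, hF, hSw, hSv, ← Finset.sum_sub_distrib, ← Finset.sum_sub_distrib,
        Finset.mul_sum]
      refine Finset.sum_le_sum fun i _ => ?_
      split_ifs with h
      · simp [max_eq_right (show y i - v ≤ 0 by linarith)]
      · push Not at h
        rw [max_eq_left (show 0 ≤ y i - v by linarith)]
        have := le_max_left (y i - w) 0
        linarith
    have hlow : (w - v) * (n - α * n) ≤ Sv - Sw := by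
      refine le_trans (mul_le_mul_of_nonneg_left (sub_le_sub_left h2 _) (by linarith)) ?_
      rw [← hsum1, hSw, hSv, ← Finset.sum_sub_distrib, ← Finset.sum_sub_distrib, Finset.mul_sum]
      refine Finset.sum_le_sum fun i _ => ?_
      split_ifs with h
      · simp only [sub_self, mul_zero, sub_nonneg]
        exact max_le_max (by linarith) le_rfl
      · push Not at h
        rw [max_eq_left (by linarith), max_eq_left (by linarith)]
        linarith
    have e : w + 1 / ((1 - α) * n) * Sw - (v + 1 / ((1 - α) * n) * Sv) =
        (w - v) - (Sv - Sw) / ((1 - α) * n) := by ring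
    have l1 : (Sv - Sw) / ((1 - α) * n) ≤ (w - v) * (1 - (A + α)) / (1 - α) := by
      rw [div_le_div_iff₀ (by positivity) hα]
      calc _ ≤ ((w - v) * (n - F)) * (1 - α) := by gcongr
        _ = _ := by rw [hAF]; ring
    have l2 : w - v ≤ (Sv - Sw) / ((1 - α) * n) := by
      rw [le_div_iff₀ (by positivity)]
      linarith
    have l3 : (w - v) * (1 - (A + α)) / (1 - α) = (w - v) + (w - v) * (-A) / (1 - α) := by
      field_simp; ring
    have l4 : (w - v) * (-A) / (1 - α) ≤ ((w - v) * |A| / (1 - α)) := by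
      have := neg_le_abs A
      gcongr
    rw [e, abs_of_nonneg (show 0 ≤ w - v by linarith), abs_le]
    have l5 : 0 ≤ (w - v) * |A| / (1 - α) :=
      div_nonneg (mul_nonneg (by linarith) (abs_nonneg _)) hα.le
    constructor <;> linarith

end OrderStatistics

/-! ### The kernel density estimate at an order statistic -/

section Conditioning

variable {m : ℕ}

/-- Chebyshev's inequality for a sum of independent bounded nonnegative variables. -/
lemma measureReal_pi_sum_ge_le (ρ : Fin m → Measure ℝ) [∀ j, IsProbabilityMeasure (ρ j)]
    {K : ℝ → ℝ} (hK : Measurable K) (hK0 : ∀ x, 0 ≤ K x) {B : ℝ} (hKB : ∀ x, K x ≤ B) {t : ℝ}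
    (ht : 0 < t) :
    (Measure.pi ρ).real {z | t ≤ |∑ j, K (z j) - ∑ j, ∫ x, K x ∂(ρ j)|} ≤
      B * (∑ j, ∫ x, K x ∂(ρ j)) / t ^ 2 := by
  have hbd : ∀ (j : Fin m), MemLp (fun z : Fin m → ℝ => K (z j)) 2 (Measure.pi ρ) := fun j =>
    memLp_of_bounded (a := 0) (b := B) (ae_of_all _ fun z => ⟨hK0 _, hKB _⟩)
      (hK.comp (measurable_pi_apply j)).aestronglyMeasurable 2
  have hint : ∀ j, ∫ z, K (z j) ∂(Measure.pi ρ) = ∫ x, K x ∂(ρ j) := fun j => by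
    have := (measurePreserving_eval ρ j).map_eq
    conv_rhs => rw [← this]
    rw [integral_map (measurable_pi_apply j).aemeasurable hK.aestronglyMeasurable]
  -- Since `K² ≤ B K`, the variance is controlled by the mean rather than by `B²`. For the kernel
  -- sum this is the order `n b` instead of `n`.
  have hint2 : ∀ j, ∫ z, K (z j) ^ 2 ∂(Measure.pi ρ) ≤ B * ∫ x, K x ∂(ρ j) := fun j => by
    rw [← hint j, ← integral_const_mul]
    refine integral_mono (hbd j).integrable_sq
      (((hbd j).integrable (by norm_num)).const_mul B) fun z => ?_
    have := hK0 (z j)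
    have := hKB (z j)
    simp only
    nlinarith
  have hindep : iIndepFun (fun (j : Fin m) (z : Fin m → ℝ) => K (z j)) (Measure.pi ρ) :=
    iIndepFun_pi (X := fun _ => K) fun _ => hK.aemeasurable
  have hS : MemLp (∑ j, fun z : Fin m → ℝ => K (z j)) 2 (Measure.pi ρ) :=
    memLp_finsetSum' _ fun j _ => hbd j
  have hmean : ∫ z, (∑ j, fun z : Fin m → ℝ => K (z j)) z ∂(Measure.pi ρ) =
      ∑ j, ∫ x, K x ∂(ρ j) := by
    simp only [Finset.sum_apply]
    rw [integral_finsetSum _ fun j _ => (hbd j).integrable (by norm_num)]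
    exact Finset.sum_congr rfl fun j _ => hint j
  have hvar : Var[∑ j, fun z : Fin m → ℝ => K (z j); Measure.pi ρ] ≤
      B * ∑ j, ∫ x, K x ∂(ρ j) := by
    rw [IndepFun.variance_sum (fun j _ => hbd j) fun i _ j _ hij => hindep.indepFun hij,
      Finset.mul_sum]
    exact Finset.sum_le_sum fun j _ =>
      (variance_le_expectation_sq (hbd j).aestronglyMeasurable).trans (hint2 j)
  have h := meas_ge_le_variance_div_sq hS ht
  rw [hmean] at h
  simp only [Finset.sum_apply] at h
  refine (ENNReal.toReal_le_of_le_ofReal (div_nonneg (variance_nonneg _ _) (sq_nonneg _)) h).trans ?_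
  gcongr

/-- The restriction of a power of `ν` to a box is a multiple of the product of the conditional
measures. -/
lemma pi_box_inter_le (ν : Measure ℝ) [IsProbabilityMeasure ν] (B : Fin m → Set ℝ)
    (hB : ∀ j, ν (B j) ≠ 0) {D : Set (Fin m → ℝ)} {η : ENNReal}
    (hη : Measure.pi (fun j => ν[|B j]) D ≤ η) :
    Measure.pi (fun _ => ν) (Set.univ.pi B ∩ D) ≤
      η * Measure.pi (fun _ => ν) (Set.univ.pi B) := by
  have hprob : ∀ j, IsProbabilityMeasure (ν[|B j]) := fun j => cond_isProbabilityMeasure (hB j)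
  have h1 : Measure.pi (fun j => ν.restrict (B j)) =
      (∏ j, ν (B j)) • Measure.pi (fun j => ν[|B j]) := by
    refine Measure.pi_eq fun s hs => ?_
    rw [Measure.smul_apply, Measure.pi_pi, smul_eq_mul, ← Finset.prod_mul_distrib]
    refine Finset.prod_congr rfl fun j _ => ?_
    rw [ProbabilityTheory.cond, Measure.smul_apply, smul_eq_mul, ← mul_assoc,
      ENNReal.mul_inv_cancel (hB j) (measure_ne_top _ _), one_mul]
  calc Measure.pi (fun _ => ν) (Set.univ.pi B ∩ D)
      ≤ (Measure.pi (fun _ => ν)).restrict (Set.univ.pi B) D := by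
        rw [Set.inter_comm]; exact Measure.le_restrict_apply _ _
    _ = (∏ j, ν (B j)) * Measure.pi (fun j => ν[|B j]) D := by
        rw [Measure.restrict_pi_pi, h1, Measure.smul_apply, smul_eq_mul]
    _ ≤ (∏ j, ν (B j)) * η := by gcongr
    _ = _ := by rw [mul_comm, Measure.pi_pi]

/-- The set of the `y` for which `J` is exactly the set of the indices of the coordinates below
`y i`, and there are no ties with `y i`. -/
def rankBox (i : Fin (m + 1)) (J : Finset (Fin (m + 1))) : Set (Fin (m + 1) → ℝ) :=
  {y | (∀ l ∈ J, y l < y i) ∧ ∀ l ∉ J, l ≠ i → y i < y l}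

lemma filter_lt_eq_of_mem_rankBox {i : Fin (m + 1)} {J : Finset (Fin (m + 1))}
    {y : Fin (m + 1) → ℝ} (hy : y ∈ rankBox i J) :
    J = Finset.univ.filter fun l => y l < y i := by
  ext l
  simp only [Finset.mem_filter, Finset.mem_univ, true_and]
  refine ⟨hy.1 l, fun h => ?_⟩
  by_contra hl
  have hli : l ≠ i := by rintro rfl; exact lt_irrefl _ h
  exact lt_asymm h (hy.2 l hl hli)

/-- In a rank box no other entry ties with `y i`, so two different indices would have different
numbers of smaller entries. Boxes of a common rank are therefore disjoint. -/
lemma rankBox_unique {i i' : Fin (m + 1)} {J J' : Finset (Fin (m + 1))}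
    (hJ : J.card = J'.card) {y : Fin (m + 1) → ℝ} (hy : y ∈ rankBox i J)
    (hy' : y ∈ rankBox i' J') : i = i' ∧ J = J' := by
  have h1 := filter_lt_eq_of_mem_rankBox hy
  have h2 := filter_lt_eq_of_mem_rankBox hy'
  have key : ∀ a b : Fin (m + 1), y a < y b →
      (Finset.univ.filter fun l => y l < y a).card <
        (Finset.univ.filter fun l => y l < y b).card := by
    intro a b hab
    refine Finset.card_lt_card ⟨fun l hl => ?_, fun hsub => ?_⟩
    · simp only [Finset.mem_filter, Finset.mem_univ, true_and] at hl ⊢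
      exact hl.trans hab
    · have := hsub (show a ∈ _ by simpa using hab)
      simp at this
  have hii : i = i' := by
    by_contra hne
    have hlt : y i < y i' ∨ y i' < y i := by
      by_cases h : i' ∈ J
      · exact Or.inr (hy.1 i' h)
      · exact Or.inl (hy.2 i' h (Ne.symm hne))
    rcases hlt with h | h
    · have := key _ _ h; rw [← h1, ← h2] at this; omega
    · have := key _ _ h; rw [← h1, ← h2] at this; omega
  subst hii
  exact ⟨rfl, h1.trans h2.symm⟩

lemma measurableSet_rankBox (i : Fin (m + 1)) (J : Finset (Fin (m + 1))) :
    MeasurableSet (rankBox i J) := by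
  have : rankBox i J = (⋂ l ∈ J, {y : Fin (m + 1) → ℝ | y l < y i}) ∩
      ⋂ l ∈ {l | l ∉ J ∧ l ≠ i}, {y : Fin (m + 1) → ℝ | y i < y l} := by
    ext y; simp [rankBox]
  rw [this]
  refine (Finset.measurableSet_biInter _ fun l _ => ?_).inter
    (MeasurableSet.biInter (Set.to_countable _) fun l _ => ?_)
  · exact measurableSet_lt (measurable_pi_apply l) (measurable_pi_apply i)
  · exact measurableSet_lt (measurable_pi_apply i) (measurable_pi_apply l)

/-- The side of `x` on which the `j`-th of the other coordinates lies. -/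
def rankSide (i : Fin (m + 1)) (J : Finset (Fin (m + 1))) (x : ℝ) (j : Fin m) : Set ℝ :=
  if i.succAbove j ∈ J then Set.Iio x else Set.Ioi x

/-- Fubini in the coordinate `i`: for `y i = x` the rank box becomes a product of half-lines ending
at `x`, on which the product measure is a multiple of the product of conditional laws. A bound `η`
uniform over `x ∈ W` then integrates. -/
lemma pi_rankBox_inter_le (ν : Measure ℝ) [IsProbabilityMeasure ν] {i : Fin (m + 1)}
    {J : Finset (Fin (m + 1))} (hiJ : i ∉ J) {W : Set ℝ} (hW : MeasurableSet W)
    {D : Set (ℝ × (Fin m → ℝ))} (hD : MeasurableSet D) {η : ENNReal}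
    (hpos : ∀ x ∈ W, ν (Set.Iio x) ≠ 0 ∧ ν (Set.Ioi x) ≠ 0)
    (hη : ∀ x ∈ W, Measure.pi (fun j => ν[|rankSide i J x j]) (Prod.mk x ⁻¹' D) ≤ η) :
    Measure.pi (fun _ => ν)
      (rankBox i J ∩ {y | y i ∈ W ∧ (y i, fun j => y (i.succAbove j)) ∈ D}) ≤
      η * Measure.pi (fun _ => ν) (rankBox i J) := by
  set e := MeasurableEquiv.piFinSuccAbove (fun _ : Fin (m + 1) => ℝ) i with he
  have hmp := measurePreserving_piFinSuccAbove (fun _ : Fin (m + 1) => ν) i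
  rw [← he] at hmp
  set R : Set (ℝ × (Fin m → ℝ)) := {p | p.2 ∈ Set.univ.pi (rankSide i J p.1)} with hR
  have hRbox : e ⁻¹' R = rankBox i J := by
    ext y
    have hey : e y = (y i, fun j => y (i.succAbove j)) := rfl
    simp only [hR, Set.mem_preimage, Set.mem_ofPred_eq, hey, Set.mem_pi, Set.mem_univ,
      true_imp_iff, rankSide]
    constructor
    · intro h
      refine ⟨fun l hl => ?_, fun l hl hli => ?_⟩
      · have hli : l ≠ i := by rintro rfl; exact hiJ hl
        obtain ⟨j, rfl⟩ := Fin.exists_succAbove_eq hli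
        have := h j
        rw [if_pos hl] at this
        exact this
      · obtain ⟨j, rfl⟩ := Fin.exists_succAbove_eq hli
        have := h j
        rw [if_neg hl] at this
        exact this
    · intro h j
      split_ifs with hj
      · exact h.1 _ hj
      · exact h.2 _ hj (Fin.succAbove_ne i j)
  have hRm : MeasurableSet R := by
    have := measurableSet_rankBox i J
    rw [← hRbox] at this
    exact (e.measurableSet_preimage).1 this
  have hset : rankBox i J ∩ {y | y i ∈ W ∧ (y i, fun j => y (i.succAbove j)) ∈ D} =
      e ⁻¹' (R ∩ ((W ×ˢ Set.univ) ∩ D)) := by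
    rw [Set.preimage_inter, hRbox]
    congr 1
    ext y
    have hey : e y = (y i, fun j => y (i.succAbove j)) := rfl
    simp [hey]
  rw [hset, ← hRbox, hmp.measure_preimage
    (hRm.inter ((hW.prod MeasurableSet.univ).inter hD)).nullMeasurableSet,
    hmp.measure_preimage hRm.nullMeasurableSet,
    Measure.prod_apply (hRm.inter ((hW.prod MeasurableSet.univ).inter hD)),
    Measure.prod_apply hRm, ← lintegral_const_mul _ (measurable_measure_prodMk_left hRm)]
  refine lintegral_mono fun x => ?_
  by_cases hx : x ∈ W
  · have hB : ∀ j, ν (rankSide i J x j) ≠ 0 := fun j => by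
      unfold rankSide; split_ifs
      · exact (hpos x hx).1
      · exact (hpos x hx).2
    refine le_trans (measure_mono ?_) (pi_box_inter_le ν _ hB (hη x hx))
    intro z hz
    exact ⟨hz.1, hz.2.2⟩
  · have : Prod.mk x ⁻¹' (R ∩ ((W ×ˢ Set.univ) ∩ D)) = ∅ := by
      ext z; simp [hx]
    rw [this]; simp

end Conditioning

/-! ### Decomposition of the sample by rank configurations. -/

section KernelDensity

variable {Ω : Type*} [MeasurableSpace Ω] {P : Measure Ω} [IsProbabilityMeasure P]

lemma sum_rankBox_le_one {m : ℕ} (ν : Measure ℝ) [IsProbabilityMeasure ν] (r : ℕ) :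
    ∑ p ∈ (Finset.univ ×ˢ Finset.powersetCard r Finset.univ :
        Finset (Fin (m + 1) × Finset (Fin (m + 1)))).filter (fun p => p.1 ∉ p.2),
      Measure.pi (fun _ => ν) (rankBox p.1 p.2) ≤ 1 := by
  rw [← measure_biUnion_finset _ fun p _ => measurableSet_rankBox p.1 p.2]
  · exact prob_le_one
  · intro p hp q hq hpq
    refine Set.disjoint_left.2 fun y hy hy' => hpq ?_
    have h1 : p.2.card = r := by
      have := (Finset.mem_filter.1 hp).1
      exact (Finset.mem_powersetCard.1 (Finset.mem_product.1 this).2).2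
    have h2 : q.2.card = r := by
      have := (Finset.mem_filter.1 hq).1
      exact (Finset.mem_powersetCard.1 (Finset.mem_product.1 this).2).2
    obtain ⟨h3, h4⟩ := rankBox_unique (h1.trans h2.symm) hy hy'
    exact Prod.ext h3 h4

lemma map_fin_eq_pi {Y : ℕ → Ω → ℝ} (hm : ∀ i, Measurable (Y i)) (hind : iIndepFun Y P)
    {ν : Measure ℝ} (hlaw : ∀ i, P.map (Y i) = ν) (n : ℕ) :
    P.map (fun ω (i : Fin n) => Y i ω) = Measure.pi fun _ => ν := by
  have h := hind.precomp (g := fun i : Fin n => (i : ℕ)) Fin.val_injective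
  rw [iIndepFun_iff_map_fun_eq_pi_map (fun i : Fin n => (hm i).aemeasurable)] at h
  rw [h]
  simp [hlaw]

lemma ae_ne_of_noAtoms {Y : ℕ → Ω → ℝ} (hm : ∀ i, Measurable (Y i)) (hind : iIndepFun Y P)
    {ν : Measure ℝ} [IsProbabilityMeasure ν] (hlaw : ∀ i, P.map (Y i) = ν)
    (hatom : ∀ x, ν {x} = 0) : ∀ᵐ ω ∂P, ∀ i j, i ≠ j → Y i ω ≠ Y j ω := by
  rw [ae_all_iff]; intro i
  rw [ae_all_iff]; intro j
  by_cases hij : i = j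
  · exact ae_of_all _ fun ω h => absurd hij h
  have h := (indepFun_iff_map_prod_eq_prod_map_map (hm i).aemeasurable (hm j).aemeasurable).1
    (hind.indepFun hij)
  rw [hlaw, hlaw] at h
  have hd : MeasurableSet {p : ℝ × ℝ | p.1 = p.2} :=
    measurableSet_eq_fun measurable_fst measurable_snd
  have h0 : P.map (fun ω => (Y i ω, Y j ω)) {p : ℝ × ℝ | p.1 = p.2} = 0 := by
    rw [h, Measure.prod_apply hd, lintegral_eq_zero_iff (measurable_measure_prodMk_left hd)]
    refine ae_of_all _ fun x => ?_
    have : Prod.mk x ⁻¹' {p : ℝ × ℝ | p.1 = p.2} = {x} := by ext y; simp [eq_comm]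
    simp only [this, Pi.zero_apply]; exact hatom x
  rw [Measure.map_apply ((hm i).prodMk (hm j)) hd] at h0
  filter_upwards [compl_mem_ae_iff.2 h0] with ω hω _ heq
  exact hω heq

/-- Fewer than `α n` entries are strictly below the order statistic, and adding the statistic itself
reaches `α n`; without ties this pins the number below to `⌈α n⌉ - 1`. -/
lemma mem_rankBox_of_no_ties {α : ℝ} (hα0 : 0 < α) (hα1 : α < 1) {m : ℕ} {y : ℕ → ℝ}
    (hy : ∀ i j, i ≠ j → y i ≠ y j) :
    ∃ (i : Fin (m + 1)) (J : Finset (Fin (m + 1))), i ∉ J ∧ J.card = ⌈α * (m + 1 : ℕ)⌉₊ - 1 ∧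
      (fun l : Fin (m + 1) => y l) ∈ rankBox i J ∧ varEst α (m + 1) y = y i := by
  set n := m + 1 with hn
  have hn0 : 0 < n := by omega
  set i : Fin n := ⟨quantileIndex α n y, quantileIndex_lt hα1 hn0 y⟩ with hi
  have hw : varEst α n y = y i := rfl
  refine ⟨i, Finset.univ.filter fun l => y l < y i, by simp, ?_, ⟨by simp, ?_⟩, hw⟩
  · rw [card_filter_fin_eq (fun x => x < y i)]
    have h1 := sum_lt_varEst_lt hα0 hα1 hn0 y
    have h2 := (varEst_le_iff hα0 hα1 hn0 y _).1 (le_refl (varEst α n y))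
    rw [hw, Finset.sum_boole] at h1 h2
    have h3 : (Finset.range n).filter (fun l => y l ≤ y i) =
        insert (i : ℕ) ((Finset.range n).filter fun l => y l < y i) := by
      ext l
      simp only [Finset.mem_filter, Finset.mem_range, Finset.mem_insert]
      constructor
      · rintro ⟨hl, hle⟩
        rcases hle.lt_or_eq with h | h
        · exact Or.inr ⟨hl, h⟩
        · left
          by_contra hne
          exact hy _ _ hne h
      · rintro (rfl | ⟨hl, h⟩)
        · exact ⟨i.2, le_rfl⟩
        · exact ⟨hl, h.le⟩
    rw [h3, Finset.card_insert_of_notMem (by simp)] at h2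
    have h4 := Nat.ceil_le.2 h2
    have h5 := Nat.lt_ceil.2 h1
    change ((Finset.range n).filter fun l => y l < y i).card = ⌈α * (n : ℕ)⌉₊ - 1
    omega
  · intro l hl hli
    simp only [Finset.mem_filter, Finset.mem_univ, true_and, not_lt] at hl
    exact lt_of_le_of_ne hl (hy _ _ fun h => hli (Fin.ext h.symm))

/-- The sample space splits, up to ties, into disjoint rank boxes of the right rank. A failure bound
`η` valid conditionally on every box and value `x ∈ W` passes to the whole event without a
union-bound loss. -/
lemma measure_kde_varEst_le {Y : ℕ → Ω → ℝ} (hm : ∀ i, Measurable (Y i)) (hind : iIndepFun Y P)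
    {ν : Measure ℝ} [IsProbabilityMeasure ν] (hlaw : ∀ i, P.map (Y i) = ν)
    (hatom : ∀ x, ν {x} = 0) {α : ℝ} (hα0 : 0 < α) (hα1 : α < 1) {m : ℕ} (b c ε : ℝ)
    {W : Set ℝ} (hW : MeasurableSet W) {η : ENNReal}
    (hpos : ∀ x ∈ W, ν (Set.Iio x) ≠ 0 ∧ ν (Set.Ioi x) ≠ 0)
    (hη : ∀ x ∈ W, ∀ (i : Fin (m + 1)) (J : Finset (Fin (m + 1))), i ∉ J →
      J.card = ⌈α * (m + 1 : ℕ)⌉₊ - 1 →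
      Measure.pi (fun j => ν[|rankSide i J x j])
        {z | ε ≤ |(gaussianPDFReal 0 1 0 + ∑ j, gaussianPDFReal 0 1 ((x - z j) / b)) /
          ((m + 1 : ℕ) * b) - c|} ≤ η) :
    P {ω | varEst α (m + 1) (fun i => Y i ω) ∈ W ∧
      ε ≤ |kde b (m + 1) (fun i => Y i ω) (varEst α (m + 1) fun i => Y i ω) - c|} ≤ η := by
  set D : Set (ℝ × (Fin m → ℝ)) := {p | ε ≤ |(gaussianPDFReal 0 1 0 +
    ∑ j, gaussianPDFReal 0 1 ((p.1 - p.2 j) / b)) / ((m + 1 : ℕ) * b) - c|} with hD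
  have hDm : MeasurableSet D := by
    have := measurable_gaussianPDFReal 0 1
    refine measurableSet_le measurable_const ?_
    fun_prop
  set S := (Finset.univ ×ˢ Finset.powersetCard (⌈α * (m + 1 : ℕ)⌉₊ - 1) Finset.univ :
    Finset (Fin (m + 1) × Finset (Fin (m + 1)))).filter (fun p => p.1 ∉ p.2) with hS
  set Bx : Fin (m + 1) × Finset (Fin (m + 1)) → Set (Fin (m + 1) → ℝ) := fun p =>
    rankBox p.1 p.2 ∩ {y | y p.1 ∈ W ∧ (y p.1, fun j => y (p.1.succAbove j)) ∈ D} with hBx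
  have hBxm : ∀ p, MeasurableSet (Bx p) := fun p =>
    (measurableSet_rankBox _ _).inter ((measurable_pi_apply p.1 hW).inter
      ((show Measurable fun y : Fin (m + 1) → ℝ => (y p.1, fun j => y (p.1.succAbove j)) by
        fun_prop) hDm))
  set V : Ω → Fin (m + 1) → ℝ := fun ω i => Y i ω with hV
  have hVm : Measurable V := measurable_pi_iff.2 fun i => hm i
  have hVlaw : P.map V = Measure.pi fun _ => ν := map_fin_eq_pi hm hind hlaw (m + 1)
  have hnt := ae_ne_of_noAtoms hm hind hlaw hatom
  calc P {ω | varEst α (m + 1) (fun i => Y i ω) ∈ W ∧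
        ε ≤ |kde b (m + 1) (fun i => Y i ω) (varEst α (m + 1) fun i => Y i ω) - c|}
      ≤ P (⋃ p ∈ S, V ⁻¹' Bx p) := by
        refine measure_mono_ae ?_
        filter_upwards [hnt] with ω hω hE
        obtain ⟨i, J, hiJ, hJ, hbox, hw⟩ := mem_rankBox_of_no_ties hα0 hα1 (m := m) hω
        refine Set.mem_iUnion₂.2 ⟨(i, J), ?_, hbox, ?_⟩
        · simp [hS, hiJ, hJ]
        · obtain ⟨hE1, hE2⟩ := hE
          rw [hw] at hE1 hE2
          refine ⟨hE1, ?_⟩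
          simp only [hD, Set.mem_ofPred_eq, hV]
          -- The order statistic is itself a data point and contributes the constant
          -- `gaussianPDFReal 0 1 0`.
          rw [kde, Finset.sum_range (fun l => gaussianPDFReal 0 1 ((Y i ω - Y l ω) / b)),
            Fin.sum_univ_succAbove _ i, sub_self, zero_div] at hE2
          exact hE2
    _ ≤ ∑ p ∈ S, P (V ⁻¹' Bx p) := measure_biUnion_finset_le _ _
    _ = ∑ p ∈ S, Measure.pi (fun _ => ν) (Bx p) := by
        refine Finset.sum_congr rfl fun p _ => ?_
        rw [← hVlaw, Measure.map_apply hVm (hBxm p)]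
    _ ≤ ∑ p ∈ S, η * Measure.pi (fun _ => ν) (rankBox p.1 p.2) := by
        refine Finset.sum_le_sum fun p hp => ?_
        have hp' := Finset.mem_filter.1 hp
        have hcard := (Finset.mem_powersetCard.1 (Finset.mem_product.1 hp'.1).2).2
        exact pi_rankBox_inter_le ν hp'.2 hW hDm hpos
          fun x hx => hη x hx p.1 p.2 hp'.2 hcard
    _ = η * ∑ p ∈ S, Measure.pi (fun _ => ν) (rankBox p.1 p.2) := by rw [Finset.mul_sum]
    _ ≤ η * 1 := by gcongr; exact sum_rankBox_le_one ν _
    _ = η := mul_one η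

lemma gaussianPDFReal_le_one (x : ℝ) : gaussianPDFReal 0 1 x ≤ 1 := by
  rw [gaussianPDFReal]
  refine mul_le_one₀ ?_ (Real.exp_pos _).le ?_
  · refine inv_le_one_of_one_le₀ (Real.one_le_sqrt.2 ?_)
    have := Real.pi_gt_three
    simp; linarith
  · rw [Real.exp_le_one_iff]
    have : 0 ≤ (x - 0) ^ 2 / (2 * ((1 : NNReal) : ℝ)) := by positivity
    rw [neg_div]; linarith

/-- The mean of the kernel density estimate at `x`, given that `x` is a data point and that `r` of
the other `n - 1` data points are on its left. -/
def condKDEMean (ν : Measure ℝ) (b : ℝ) (n r : ℕ) (x : ℝ) : ℝ :=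
  (gaussianPDFReal 0 1 0 + (r * ∫ z, gaussianPDFReal 0 1 ((x - z) / b) ∂(ν[|Set.Iio x]) +
    (n - r - 1) * ∫ z, gaussianPDFReal 0 1 ((x - z) / b) ∂(ν[|Set.Ioi x]))) / (n * b)

/-- Half of `ε` is spent on the conditional mean. Chebyshev's inequality at threshold `n b ε / 2`
handles the rest: the kernel is at most one, so the variance of the sum is at most its mean, which
is at most `(c + ε) n b`. -/
lemma measure_condKDE_le {ν : Measure ℝ} [IsProbabilityMeasure ν] {m : ℕ} {b c ε x : ℝ}
    (hb : 0 < b) (hε : 0 < ε) (hpos : ν (Set.Iio x) ≠ 0 ∧ ν (Set.Ioi x) ≠ 0)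
    {i : Fin (m + 1)} {J : Finset (Fin (m + 1))} (hiJ : i ∉ J)
    (hmean : |condKDEMean ν b (m + 1) J.card x - c| ≤ ε / 2) :
    Measure.pi (fun j => ν[|rankSide i J x j])
      {z | ε ≤ |(gaussianPDFReal 0 1 0 + ∑ j, gaussianPDFReal 0 1 ((x - z j) / b)) /
        ((m + 1 : ℕ) * b) - c|} ≤
      ENNReal.ofReal (4 * (c + ε) / ε ^ 2 / ((m + 1 : ℕ) * b)) := by
  set n : ℝ := ((m + 1 : ℕ) : ℝ) with hn
  have hn0 : 0 < n := by rw [hn]; positivity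
  set K : ℝ → ℝ := fun z => gaussianPDFReal 0 1 ((x - z) / b) with hK
  have hKm : Measurable K := by
    have := measurable_gaussianPDFReal 0 1
    simp only [hK]; fun_prop
  have hB : ∀ j, ν (rankSide i J x j) ≠ 0 := fun j => by
    unfold rankSide; split_ifs
    · exact hpos.1
    · exact hpos.2
  have hprob : ∀ j, IsProbabilityMeasure (ν[|rankSide i J x j]) :=
    fun j => cond_isProbabilityMeasure (hB j)
  set AL := ∫ z, K z ∂(ν[|Set.Iio x]) with hAL
  set AR := ∫ z, K z ∂(ν[|Set.Ioi x]) with hAR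
  have hsum : ∑ j : Fin m, ∫ z, K z ∂(ν[|rankSide i J x j]) = J.card * AL + (n - J.card - 1) * AR := by
    have h1 : ∀ j : Fin m, ∫ z, K z ∂(ν[|rankSide i J x j]) =
        if i.succAbove j ∈ J then AL else AR := fun j => by
      unfold rankSide; split_ifs <;> rfl
    simp only [h1]
    -- The coordinate `i` is put back so that the sum runs over all `m + 1` indices; as `i ∉ J` it
    -- adds one `AR`, whence the `- 1` in the count on the right.
    have h2 := Fin.sum_univ_succAbove (fun l : Fin (m + 1) => if l ∈ J then AL else AR) i
    rw [if_neg hiJ] at h2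
    have h3 : ∑ l : Fin (m + 1), (if l ∈ J then AL else AR) =
        ∑ l : Fin (m + 1), (AR + if l ∈ J then AL - AR else 0) := by
      refine Finset.sum_congr rfl fun l _ => ?_
      split_ifs <;> ring
    rw [h3, Finset.sum_add_distrib, Finset.sum_const, Finset.card_univ, Fintype.card_fin,
      nsmul_eq_mul, ← hn, Finset.sum_ite_mem, Finset.univ_inter, Finset.sum_const,
      nsmul_eq_mul] at h2
    linarith
  have hg0 : 0 ≤ gaussianPDFReal 0 1 0 := gaussianPDFReal_nonneg _ _ _
  have hmean' : condKDEMean ν b (m + 1) J.card x =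
      (gaussianPDFReal 0 1 0 + ∑ j : Fin m, ∫ z, K z ∂(ν[|rankSide i J x j])) / (n * b) := by
    rw [hsum]; rfl
  rw [hmean'] at hmean
  set E := ∑ j : Fin m, ∫ z, K z ∂(ν[|rankSide i J x j]) with hE
  have hcheb := measureReal_pi_sum_ge_le (fun j => ν[|rankSide i J x j]) hKm
    (fun z => gaussianPDFReal_nonneg _ _ _) (fun z => gaussianPDFReal_le_one _)
    (t := n * b * (ε / 2)) (by positivity)
  rw [← hE] at hcheb
  rw [← ofReal_measureReal]
  refine ENNReal.ofReal_le_ofReal ((measureReal_mono ?_).trans (hcheb.trans ?_))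
  · intro z hz
    simp only [Set.mem_ofPred_eq] at hz ⊢
    have h1 : (gaussianPDFReal 0 1 0 + ∑ j, K (z j)) / (n * b) - c =
        ((gaussianPDFReal 0 1 0 + E) / (n * b) - c) + (∑ j, K (z j) - E) / (n * b) := by ring
    have h2 : ε ≤ ε / 2 + |∑ j, K (z j) - E| / (n * b) := by
      refine hz.trans ?_
      have h3 := abs_add_le ((gaussianPDFReal 0 1 0 + E) / (n * b) - c)
        ((∑ j, K (z j) - E) / (n * b))
      rw [← h1, abs_div (∑ j, K (z j) - E), abs_of_pos (show 0 < n * b by positivity)] at h3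
      linarith
    have h3 : ε / 2 ≤ |∑ j, K (z j) - E| / (n * b) := by linarith
    rw [le_div_iff₀ (by positivity)] at h3
    linarith
  · have h1 := (abs_le.1 hmean).2
    have h2 : (gaussianPDFReal 0 1 0 + E) / (n * b) ≤ c + ε := by linarith
    rw [div_le_iff₀ (by positivity)] at h2
    rw [one_mul, div_div, div_le_div_iff₀ (by positivity) (by positivity)]
    calc E * (ε ^ 2 * (n * b)) ≤ ((c + ε) * (n * b)) * (ε ^ 2 * (n * b)) := by
          gcongr; linarith
      _ = _ := by ring

end KernelDensity

/-! ### Kernel integrals against measures with an asymptotic local density. -/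

section LocalDensity

/-- The measures `ν k` have, up to an error that vanishes as `k → ∞`, the density `c` near `v`. -/
def HasLocalDensity (ν : ℕ → Measure ℝ) (v c : ℝ) : Prop :=
  ∀ ε : ℝ, 0 < ε → ∃ δ : ℝ, 0 < δ ∧ ∀ᶠ k in atTop, ∀ A : Set ℝ, MeasurableSet A →
    A ⊆ Set.Ioo (v - δ) (v + δ) → |(ν k).real A - c * volume.real A| ≤ ε * volume.real A

lemma gaussianPDFReal_div {b : ℝ} (hb : 0 < b) (x z : ℝ) :
    gaussianPDFReal 0 1 ((x - z) / b) / b = gaussianPDFReal x (b.toNNReal ^ 2) z := by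
  have h2 : √(2 * Real.pi * b ^ 2) = √(2 * Real.pi) * b := by
    rw [Real.sqrt_mul (by positivity), Real.sqrt_sq hb.le]
  simp only [gaussianPDFReal, NNReal.coe_pow, Real.coe_toNNReal _ hb.le, NNReal.coe_one, mul_one,
    sub_zero, h2]
  have : -((x - z) / b) ^ 2 / 2 = -(z - x) ^ 2 / (2 * b ^ 2) := by field_simp; ring
  rw [this, mul_inv]
  ring

lemma gaussianReal_real_Ioi (x : ℝ) {s : NNReal} (hs : s ≠ 0) :
    (gaussianReal x s).real (Set.Ioi x) = 1 / 2 ∧ (gaussianReal x s).real (Set.Iio x) = 1 / 2 := by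
  have : NullSingletonClass (gaussianReal x s) := nullSingletonClass_gaussianReal hs
  have h1 : (gaussianReal x s).map (fun y => 2 * x + -y) = gaussianReal x s := by
    have h : (fun y : ℝ => 2 * x + -y) = (fun y => 2 * x + y) ∘ (fun y => -y) := rfl
    rw [h, ← Measure.map_map (by fun_prop) (by fun_prop), gaussianReal_map_neg,
      gaussianReal_map_const_add]
    congr 1; ring
  have h2 : (gaussianReal x s).real (Set.Ioi x) = (gaussianReal x s).real (Set.Iio x) := by
    conv_lhs => rw [← h1]
    rw [map_measureReal_apply (by fun_prop) measurableSet_Ioi]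
    congr 1
    ext y; simp only [Set.mem_preimage, Set.mem_Ioi, Set.mem_Iio]
    constructor <;> intro h <;> linarith
  have h3 : (gaussianReal x s).real (Set.Iio x) = (gaussianReal x s).real (Set.Iic x) :=
    measureReal_congr Iio_ae_eq_Iic
  have h4 := probReal_compl_eq_one_sub (μ := gaussianReal x s) (measurableSet_Iic (a := x))
  rw [Set.compl_Iic] at h4
  constructor <;> linarith

lemma measureReal_gaussianReal_far_le (x : ℝ) {b r : ℝ} (hb : 0 < b) (hr : 0 < r) :
    (gaussianReal x (b.toNNReal ^ 2)).real {z | r ≤ |z - x|} ≤ b ^ 2 / r ^ 2 := by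
  have h := meas_ge_le_variance_div_sq (memLp_id_gaussianReal (μ := x) (v := b.toNNReal ^ 2) 2) hr
  simp only [id_eq, integral_id_gaussianReal, variance_id_gaussianReal, NNReal.coe_pow,
    Real.coe_toNNReal _ hb.le] at h
  exact ENNReal.toReal_le_of_le_ofReal (by positivity) h

/-- A pointwise tail bound, from `exp (-u² / 2) ≤ 2 / u²`. It is needed because nothing is known
about the measures away from `v`. -/
lemma gaussianPDFReal_div_le_of_far {b r x z : ℝ} (hb : 0 < b) (hr : 0 < r) (h : r ≤ |z - x|) :
    gaussianPDFReal 0 1 ((x - z) / b) / b ≤ 2 * b / r ^ 2 := by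
  set u := (x - z) / b with hu
  have hu2 : (r / b) ^ 2 ≤ u ^ 2 := by
    rw [hu, div_pow, div_pow]
    gcongr 1
    rw [← sq_abs (x - z), abs_sub_comm]
    gcongr
  have hpos : 0 < (r / b) ^ 2 := by positivity
  have h1 : gaussianPDFReal 0 1 u ≤ 2 / u ^ 2 := by
    rw [gaussianPDFReal]
    simp only [NNReal.coe_one, mul_one, sub_zero]
    have h2 : (√(2 * Real.pi))⁻¹ ≤ 1 :=
      inv_le_one_of_one_le₀ (Real.one_le_sqrt.2 (by have := Real.pi_gt_three; linarith))
    have h3 : Real.exp (-u ^ 2 / 2) ≤ 2 / u ^ 2 := by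
      rw [neg_div, Real.exp_neg, inv_eq_one_div,
        div_le_div_iff₀ (Real.exp_pos _) (by linarith)]
      have := Real.add_one_le_exp (u ^ 2 / 2)
      linarith
    calc _ ≤ 1 * (2 / u ^ 2) := mul_le_mul h2 h3 (Real.exp_pos _).le zero_le_one
      _ = _ := one_mul _
  calc gaussianPDFReal 0 1 u / b ≤ (2 / (r / b) ^ 2) / b := by
        gcongr
        exact h1.trans (by gcongr)
    _ = _ := by field_simp

/-- Within the window the measure lies between `c - ε` and `c + ε` times Lebesgue measure, and the
side `B` carries half of the Gaussian mass. Points outside the window are at distance at least `δ /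
2` from `x`; there the kernel is uniformly small and its Gaussian mass is small by Chebyshev's
inequality. -/
lemma abs_setIntegral_kernel_sub_le {ν : Measure ℝ} [IsProbabilityMeasure ν] {v c ε δ b x : ℝ}
    (hε : 0 < ε) (hεc : ε < c) (hδ : 0 < δ) (hb : 0 < b)
    (hν : ∀ A : Set ℝ, MeasurableSet A → A ⊆ Set.Ioo (v - δ) (v + δ) →
      |ν.real A - c * volume.real A| ≤ ε * volume.real A)
    (hx : |x - v| < δ / 2) {B : Set ℝ} (hBm : MeasurableSet B)
    (hB : ∀ s : NNReal, s ≠ 0 → (gaussianReal x s).real B = 1 / 2) :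
    |(∫ z in B, gaussianPDFReal 0 1 ((x - z) / b) ∂ν) / b - c / 2| ≤
      ε / 2 + (2 * b / (δ / 2) ^ 2 + c * (b ^ 2 / (δ / 2) ^ 2)) := by
  set I := Set.Ioo (v - δ) (v + δ) with hI
  set q : ℝ → ℝ := fun z => gaussianPDFReal 0 1 ((x - z) / b) / b with hq
  have hqe : q = gaussianPDFReal x (b.toNNReal ^ 2) := by
    ext z; exact gaussianPDFReal_div hb x z
  have hs : b.toNNReal ^ 2 ≠ 0 := by simpa using hb
  have hq0 : ∀ z, 0 ≤ q z := fun z => div_nonneg (gaussianPDFReal_nonneg _ _ _) hb.le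
  have hqm : Measurable q := by rw [hqe]; exact measurable_gaussianPDFReal _ _
  have hqvol : Integrable q := by rw [hqe]; exact integrable_gaussianPDFReal _ _
  have hqν : Integrable q ν := by
    refine Integrable.of_bound hqm.aestronglyMeasurable b⁻¹ (ae_of_all _ fun z => ?_)
    rw [Real.norm_of_nonneg (hq0 z), hq, inv_eq_one_div]
    simp only
    gcongr
    exact gaussianPDFReal_le_one _
  have hgauss : ∀ A : Set ℝ, MeasurableSet A → ∫ z in A, q z =
      (gaussianReal x (b.toNNReal ^ 2)).real A := fun A _ => by
    rw [hqe, measureReal_def, gaussianReal_apply_eq_integral x hs,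
      ENNReal.toReal_ofReal (integral_nonneg fun z => gaussianPDFReal_nonneg _ _ _)]
  have hfar : ∀ z, z ∉ I → δ / 2 ≤ |z - x| := fun z hz => by
    by_contra! h
    rw [abs_lt] at h hx
    exact hz ⟨by linarith, by linarith⟩
  have hdiv : (∫ z in B, gaussianPDFReal 0 1 ((x - z) / b) ∂ν) / b = ∫ z in B, q z ∂ν := by
    rw [← integral_div]
  have hfin : ∀ A : Set ℝ, A ⊆ I → volume A ≠ ⊤ := fun A hA =>
    (measure_mono hA).trans_lt (by rw [hI, Real.volume_Ioo]; exact ENNReal.ofReal_lt_top) |>.ne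
  have hBI : MeasurableSet (B ∩ I) := hBm.inter measurableSet_Ioo
  have hup : ν.restrict (B ∩ I) ≤ ENNReal.ofReal (c + ε) • volume.restrict (B ∩ I) := by
    refine Measure.le_iff.2 fun s hs' => ?_
    have hsub : s ∩ (B ∩ I) ⊆ I := fun z hz => hz.2.2
    rw [Measure.smul_apply, Measure.restrict_apply hs', Measure.restrict_apply hs', smul_eq_mul,
      ← ofReal_measureReal, ← ofReal_measureReal (h := hfin _ hsub),
      ← ENNReal.ofReal_mul (by linarith)]
    refine ENNReal.ofReal_le_ofReal ?_
    have := (abs_le.1 (hν _ (hs'.inter hBI) hsub)).2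
    linarith
  have hlow : ENNReal.ofReal (c - ε) • volume.restrict (B ∩ I) ≤ ν.restrict (B ∩ I) := by
    refine Measure.le_iff.2 fun s hs' => ?_
    have hsub : s ∩ (B ∩ I) ⊆ I := fun z hz => hz.2.2
    rw [Measure.smul_apply, Measure.restrict_apply hs', Measure.restrict_apply hs', smul_eq_mul,
      ← ofReal_measureReal (μ := ν), ← ofReal_measureReal (h := hfin _ hsub),
      ← ENNReal.ofReal_mul (by linarith)]
    refine ENNReal.ofReal_le_ofReal ?_
    have := (abs_le.1 (hν _ (hs'.inter hBI) hsub)).1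
    linarith
  have e1 : ∫ z in B ∩ I, q z ∂ν ≤ (c + ε) * ∫ z in B ∩ I, q z := by
    have := integral_mono_measure hup (ae_of_all _ hq0)
      (hqvol.integrableOn.smul_measure ENNReal.ofReal_ne_top)
    rwa [integral_smul_measure, ENNReal.toReal_ofReal (by linarith), smul_eq_mul] at this
  have e2 : (c - ε) * ∫ z in B ∩ I, q z ≤ ∫ z in B ∩ I, q z ∂ν := by
    have := integral_mono_measure hlow (ae_of_all _ hq0) hqν.integrableOn
    rwa [integral_smul_measure, ENNReal.toReal_ofReal (by linarith), smul_eq_mul] at this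
  have e3 : ∫ z in B, q z ∂ν = (∫ z in B ∩ I, q z ∂ν) + ∫ z in B \ I, q z ∂ν :=
    (integral_inter_add_sdiff measurableSet_Ioo hqν.integrableOn).symm
  have e4 : (1 : ℝ) / 2 = (∫ z in B ∩ I, q z) + ∫ z in B \ I, q z := by
    rw [integral_inter_add_sdiff measurableSet_Ioo hqvol.integrableOn, hgauss B hBm, hB _ hs]
  have e5 : ∫ z in B \ I, q z ≤ b ^ 2 / (δ / 2) ^ 2 := by
    rw [hgauss _ (hBm.diff measurableSet_Ioo)]
    refine (measureReal_mono fun z hz => ?_).trans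
      (measureReal_gaussianReal_far_le x hb (show 0 < δ / 2 by positivity))
    exact hfar z hz.2
  have e6 : ∫ z in B \ I, q z ∂ν ≤ 2 * b / (δ / 2) ^ 2 := by
    have h1 : ∫ z in B \ I, q z ∂ν ≤ ∫ z in B \ I, 2 * b / (δ / 2) ^ 2 ∂ν := by
      refine setIntegral_mono_on hqν.integrableOn (integrable_const _)
        (hBm.diff measurableSet_Ioo) fun z hz => ?_
      exact gaussianPDFReal_div_le_of_far hb (by positivity) (hfar z hz.2)
    refine h1.trans ?_
    rw [setIntegral_const, smul_eq_mul]
    exact mul_le_of_le_one_left (by positivity) measureReal_le_one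
  have e7 : 0 ≤ ∫ z in B \ I, q z ∂ν := integral_nonneg hq0
  have e8 : 0 ≤ ∫ z in B \ I, q z := integral_nonneg hq0
  have e9 : 0 ≤ ∫ z in B ∩ I, q z := integral_nonneg hq0
  rw [hdiv, e3, abs_le]
  have hp1 : (0 : ℝ) ≤ 2 * b / (δ / 2) ^ 2 := by positivity
  have hp2 : (0 : ℝ) ≤ c * (b ^ 2 / (δ / 2) ^ 2) := mul_nonneg (by linarith) (by positivity)
  have e10 : c * ∫ z in B \ I, q z ≤ c * (b ^ 2 / (δ / 2) ^ 2) := by gcongr; linarith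
  have e11 : ε * ∫ z in B ∩ I, q z ≤ ε * (1 / 2) := by gcongr; linarith
  have e12 : c * ∫ z in B ∩ I, q z = c / 2 - c * ∫ z in B \ I, q z := by
    have : ∫ z in B ∩ I, q z = 1 / 2 - ∫ z in B \ I, q z := by linarith
    rw [this]; ring
  have e13 : 0 ≤ c * ∫ z in B \ I, q z := mul_nonneg (by linarith) e8
  constructor <;> nlinarith

variable {ν : ℕ → Measure ℝ} [∀ k, IsProbabilityMeasure (ν k)] {v c : ℝ}

/-- The filter `atTop ×ˢ 𝓝 v` encodes uniformity in the evaluation point near `v`, which is what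
evaluation at a random point requires. -/
lemma HasLocalDensity.tendsto_setIntegral_kernel (hν : HasLocalDensity ν v c) (hc : 0 < c)
    {b : ℕ → ℝ} (hb : ∀ k, 0 < b k) (hb0 : Tendsto b atTop (𝓝 0)) {B : ℝ → Set ℝ}
    (hBm : ∀ x, MeasurableSet (B x))
    (hB : ∀ x, ∀ s : NNReal, s ≠ 0 → (gaussianReal x s).real (B x) = 1 / 2) :
    Tendsto (fun p : ℕ × ℝ =>
      (∫ z in B p.2, gaussianPDFReal 0 1 ((p.2 - z) / b p.1) ∂(ν p.1)) / b p.1)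
      (atTop ×ˢ 𝓝 v) (𝓝 (c / 2)) := by
  rw [Metric.tendsto_nhds]
  intro ε' hε'
  set ε := min (ε' / 2) (c / 2) with hεdef
  have hε : 0 < ε := by positivity
  have hεc : ε < c := (min_le_right _ _).trans_lt (by linarith)
  have hεε' : ε ≤ ε' / 2 := min_le_left _ _
  obtain ⟨δ, hδ, hev⟩ := hν ε hε
  have hlim : Tendsto (fun k => 2 * b k / (δ / 2) ^ 2 + c * (b k ^ 2 / (δ / 2) ^ 2)) atTop
      (𝓝 0) := by
    have := ((hb0.const_mul 2).div_const ((δ / 2) ^ 2)).add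
      (((hb0.pow 2).div_const ((δ / 2) ^ 2)).const_mul c)
    simpa using this
  have h1 : ∀ᶠ p in (atTop : Filter ℕ) ×ˢ 𝓝 v, |p.2 - v| < δ / 2 := by
    refine tendsto_snd.eventually (p := fun x => |x - v| < δ / 2) ?_
    filter_upwards [Metric.ball_mem_nhds v (show 0 < δ / 2 by positivity)] with x hx
    rwa [Metric.mem_ball, Real.dist_eq] at hx
  filter_upwards [tendsto_fst.eventually hev,
    tendsto_fst.eventually (hlim.eventually (gt_mem_nhds (show 0 < ε' / 4 by positivity))), h1]
    with p hp1 hp2 hp3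
  rw [Real.dist_eq]
  have := abs_setIntegral_kernel_sub_le hε hεc hδ (hb p.1) hp1 hp3 (hBm p.2) (hB p.2)
  linarith

lemma abs_measureReal_sub_le {μ : Measure ℝ} [IsFiniteMeasure μ] {S T U : Set ℝ}
    (h1 : S ⊆ T ∪ U) (h2 : T ⊆ S ∪ U) : |μ.real S - μ.real T| ≤ μ.real U := by
  have h3 := (measureReal_mono (μ := μ) h1).trans (measureReal_union_le _ _)
  have h4 := (measureReal_mono (μ := μ) h2).trans (measureReal_union_le _ _)
  rw [abs_le]; constructor <;> linarith

lemma HasLocalDensity.tendsto_uIcc (hν : HasLocalDensity ν v c) :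
    Tendsto (fun p : ℕ × ℝ => (ν p.1).real (Set.uIcc p.2 v)) (atTop ×ˢ 𝓝 v) (𝓝 0) := by
  obtain ⟨δ, hδ, hev⟩ := hν 1 one_pos
  have hlim : Tendsto (fun p : ℕ × ℝ => (c + 1) * |v - p.2|) (atTop ×ˢ 𝓝 v) (𝓝 0) := by
    have : Tendsto (fun x : ℝ => (c + 1) * |v - x|) (𝓝 v) (𝓝 ((c + 1) * |v - v|)) :=
      Continuous.tendsto (by fun_prop) v
    rw [sub_self, abs_zero, mul_zero] at this
    exact this.comp tendsto_snd
  have h1 : ∀ᶠ p in (atTop : Filter ℕ) ×ˢ 𝓝 v, |p.2 - v| < δ := by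
    refine tendsto_snd.eventually (p := fun x => |x - v| < δ) ?_
    filter_upwards [Metric.ball_mem_nhds v hδ] with x hx
    rwa [Metric.mem_ball, Real.dist_eq] at hx
  refine squeeze_zero' (Eventually.of_forall fun _ => measureReal_nonneg) ?_ hlim
  filter_upwards [tendsto_fst.eventually hev, h1] with p hp1 hp2
  rw [abs_lt] at hp2
  have h2 := hp1 (Set.uIcc p.2 v) measurableSet_uIcc (by
    intro z hz
    rw [Set.mem_uIcc] at hz
    rcases hz with hz | hz <;> exact ⟨by linarith [hz.1, hz.2], by linarith [hz.1, hz.2]⟩)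
  have h3 : volume.real (Set.uIcc p.2 v) = |v - p.2| := by
    rw [measureReal_def, Real.volume_interval, ENNReal.toReal_ofReal (abs_nonneg _)]
  rw [h3] at h2
  have := (abs_le.1 h2).2
  linarith

variable {α : ℝ}

lemma HasLocalDensity.tendsto_Iio (hν : HasLocalDensity ν v c)
    (hα : Tendsto (fun k => (ν k).real (Set.Iic v)) atTop (𝓝 α)) :
    Tendsto (fun p : ℕ × ℝ => (ν p.1).real (Set.Iio p.2)) (atTop ×ˢ 𝓝 v) (𝓝 α) ∧
    Tendsto (fun p : ℕ × ℝ => (ν p.1).real (Set.Ioi p.2)) (atTop ×ˢ 𝓝 v) (𝓝 (1 - α)) := by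
  constructor
  · have h1 : Tendsto (fun p : ℕ × ℝ => (ν p.1).real (Set.Iio p.2) - (ν p.1).real (Set.Iic v))
        (atTop ×ˢ 𝓝 v) (𝓝 0) := by
      refine squeeze_zero_norm (fun p => ?_) hν.tendsto_uIcc
      refine abs_measureReal_sub_le (fun z hz => ?_) fun z hz => ?_
      · rcases le_or_gt z v with h | h
        · exact Or.inl h
        · exact Or.inr (Set.mem_uIcc.2 (Or.inr ⟨h.le, le_of_lt hz⟩))
      · rcases lt_or_ge z p.2 with h | h
        · exact Or.inl h
        · exact Or.inr (Set.mem_uIcc.2 (Or.inl ⟨h, hz⟩))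
    simpa using h1.add (hα.comp tendsto_fst)
  · have h1 : Tendsto (fun p : ℕ × ℝ => (ν p.1).real (Set.Ioi p.2) - (ν p.1).real (Set.Ioi v))
        (atTop ×ˢ 𝓝 v) (𝓝 0) := by
      refine squeeze_zero_norm (fun p => ?_) hν.tendsto_uIcc
      refine abs_measureReal_sub_le (fun z hz => ?_) fun z hz => ?_
      · rcases lt_or_ge v z with h | h
        · exact Or.inl h
        · exact Or.inr (Set.mem_uIcc.2 (Or.inl ⟨le_of_lt hz, h⟩))
      · rcases lt_or_ge p.2 z with h | h
        · exact Or.inl h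
        · exact Or.inr (Set.mem_uIcc.2 (Or.inr ⟨le_of_lt hz, h⟩))
    have h2 : Tendsto (fun k => (ν k).real (Set.Ioi v)) atTop (𝓝 (1 - α)) := by
      refine (hα.const_sub 1).congr fun k => ?_
      rw [← probReal_compl_eq_one_sub measurableSet_Iic, Set.compl_Iic]
    simpa using h1.add (h2.comp tendsto_fst)

/-- Conditioning on a side divides by `α` or `1 - α` in the limit, and the proportions of points on
the two sides, with the same limits, cancel these factors. Each half of the kernel then contributes
`c / 2`. -/
lemma HasLocalDensity.tendsto_condKDEMean (hν : HasLocalDensity ν v c) (hc : 0 < c)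
    (hα0 : 0 < α) (hα1 : α < 1) (hα : Tendsto (fun k => (ν k).real (Set.Iic v)) atTop (𝓝 α))
    {b : ℕ → ℝ} (hb : ∀ k, 0 < b k) (hb0 : Tendsto b atTop (𝓝 0)) {n r : ℕ → ℕ}
    (hn : Tendsto n atTop atTop) (hnb : Tendsto (fun k => (n k : ℝ) * b k) atTop atTop)
    (hr : Tendsto (fun k => (r k : ℝ) / n k) atTop (𝓝 α)) :
    Tendsto (fun p : ℕ × ℝ => condKDEMean (ν p.1) (b p.1) (n p.1) (r p.1) p.2)
      (atTop ×ˢ 𝓝 v) (𝓝 c) := by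
  obtain ⟨hL, hR⟩ := hν.tendsto_Iio hα
  have hIL := hν.tendsto_setIntegral_kernel hc hb hb0 (B := Set.Iio)
    (fun _ => measurableSet_Iio) (fun x s hs => (gaussianReal_real_Ioi x hs).2)
  have hIR := hν.tendsto_setIntegral_kernel hc hb hb0 (B := Set.Ioi)
    (fun _ => measurableSet_Ioi) (fun x s hs => (gaussianReal_real_Ioi x hs).1)
  have h0 : Tendsto (fun k => gaussianPDFReal 0 1 0 / ((n k : ℝ) * b k)) atTop (𝓝 0) :=
    tendsto_const_nhds.div_atTop hnb
  have hn1 : Tendsto (fun k => (1 : ℝ) / n k) atTop (𝓝 0) :=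
    tendsto_const_nhds.div_atTop (tendsto_natCast_atTop_atTop.comp hn)
  have hr' : Tendsto (fun k => 1 - (r k : ℝ) / n k - 1 / n k) atTop (𝓝 (1 - α - 0)) :=
    (hr.const_sub 1).sub hn1
  have hα' : 0 < 1 - α := by linarith
  have hmain := ((h0.comp (tendsto_fst (g := 𝓝 v))).add
    (((hr.comp (tendsto_fst (g := 𝓝 v))).mul (hL.inv₀ hα0.ne')).mul hIL)).add
    (((hr'.comp (tendsto_fst (g := 𝓝 v))).mul (hR.inv₀ hα'.ne')).mul hIR)
  have hval : 0 + α * α⁻¹ * (c / 2) + (1 - α - 0) * (1 - α)⁻¹ * (c / 2) = c := by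
    rw [sub_zero, mul_inv_cancel₀ hα0.ne', mul_inv_cancel₀ hα'.ne']; ring
  rw [hval] at hmain
  refine hmain.congr' ?_
  filter_upwards [tendsto_fst.eventually (hn.eventually (eventually_gt_atTop 0))] with p hp
  have hn0 : (0 : ℝ) < n p.1 := by exact_mod_cast hp
  have hbp := hb p.1
  have hcond : ∀ s : Set ℝ, ∫ z, gaussianPDFReal 0 1 ((p.2 - z) / b p.1) ∂((ν p.1)[|s]) =
      ((ν p.1).real s)⁻¹ * ∫ z in s, gaussianPDFReal 0 1 ((p.2 - z) / b p.1) ∂(ν p.1) := by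
    intro s
    rw [ProbabilityTheory.cond, integral_smul_measure, ENNReal.toReal_inv, smul_eq_mul]
    rfl
  simp only [Function.comp_apply, condKDEMean, hcond]
  field_simp
  ring

end LocalDensity

/-! ### Consistency of the kernel density estimate. -/

section KernelDensity

variable {Ω : Type*} [MeasurableSpace Ω] {P : Measure Ω} [IsProbabilityMeasure P]

lemma tendsto_ceil_sub_one_div {α : ℝ} (hα0 : 0 < α) {n : ℕ → ℕ} (hn : Tendsto n atTop atTop) :
    Tendsto (fun k => ((⌈α * (n k)⌉₊ - 1 : ℕ) : ℝ) / n k) atTop (𝓝 α) := by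
  have hn1 : Tendsto (fun k => (1 : ℝ) / n k) atTop (𝓝 0) :=
    tendsto_const_nhds.div_atTop (tendsto_natCast_atTop_atTop.comp hn)
  refine tendsto_of_tendsto_of_tendsto_of_le_of_le' (by simpa using hn1.const_sub α)
    tendsto_const_nhds ?_ ?_
  all_goals
    filter_upwards [hn.eventually (eventually_gt_atTop 0)] with k hk
    have hn0 : (0 : ℝ) < n k := by exact_mod_cast hk
    have hpos : 0 < ⌈α * (n k)⌉₊ := Nat.ceil_pos.2 (by positivity)
    have h1 := Nat.le_ceil (α * (n k))
    have h2 := Nat.ceil_lt_add_one (show 0 ≤ α * (n k) by positivity)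
    rw [Nat.cast_sub hpos, Nat.cast_one]
  · rw [le_div_iff₀ hn0, sub_mul, inv_mul_cancel₀ hn0.ne']
    linarith
  · rw [div_le_iff₀ hn0]
    linarith

/-- The kernel density estimate at the VaR estimate is consistent. -/
lemma tendstoInProb_kde {Y : ℕ → ℕ → Ω → ℝ} (hm : ∀ k i, Measurable (Y k i))
    (hind : ∀ k, iIndepFun (Y k) P) {ν : ℕ → Measure ℝ} (hprob : ∀ k, IsProbabilityMeasure (ν k))
    (hlaw : ∀ k i, P.map (Y k i) = ν k) (hatom : ∀ᶠ k in atTop, ∀ x, ν k {x} = 0)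
    {v c α : ℝ} (hν : HasLocalDensity ν v c) (hc : 0 < c)
    (hα0 : 0 < α) (hα1 : α < 1) (hα : Tendsto (fun k => (ν k).real (Set.Iic v)) atTop (𝓝 α))
    {b : ℕ → ℝ} (hb : ∀ k, 0 < b k) (hb0 : Tendsto b atTop (𝓝 0)) {n : ℕ → ℕ}
    (hn : Tendsto n atTop atTop) (hnb : Tendsto (fun k => (n k : ℝ) * b k) atTop atTop)
    (hvar : TendstoInProb P (fun k ω => varEst α (n k) (fun i => Y k i ω)) v) :
    TendstoInProb P (fun k ω => kde (b k) (n k) (fun i => Y k i ω)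
      (varEst α (n k) fun i => Y k i ω)) c := by
  intro ε hε
  obtain ⟨hL, hR⟩ := hν.tendsto_Iio hα
  have hM := hν.tendsto_condKDEMean hc hα0 hα1 hα hb hb0 hn hnb (tendsto_ceil_sub_one_div hα0 hn)
  have hev := ((hL.eventually (lt_mem_nhds hα0)).and
    (hR.eventually (lt_mem_nhds (show 0 < 1 - α by linarith)))).and
    (Metric.tendsto_nhds.1 hM (ε / 2) (by positivity))
  -- This yields one neighbourhood of `v` on which all bounds hold for every large `k`
  -- simultaneously.
  rw [eventually_prod_iff] at hev
  obtain ⟨p, hp, q, hq, hpq⟩ := hev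
  obtain ⟨δ, hδ, hδq⟩ := Metric.eventually_nhds_iff.1 hq
  have hη : Tendsto (fun k => 4 * (c + ε) / ε ^ 2 / ((n k : ℝ) * b k)) atTop (𝓝 0) :=
    tendsto_const_nhds.div_atTop hnb
  have hsum := (hvar δ hδ).add hη
  rw [add_zero] at hsum
  refine squeeze_zero' (Eventually.of_forall fun _ => measureReal_nonneg) ?_ hsum
  filter_upwards [hp, hatom, hn.eventually (eventually_gt_atTop 0)] with k hpk hak hnk
  obtain ⟨m, hm'⟩ : ∃ m, n k = m + 1 := ⟨n k - 1, by omega⟩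
  have hprobk := hprob k
  have hW : ∀ x ∈ Metric.ball v δ, _ := fun x hx => @hpq k hpk x (hδq hx)
  have hpos : ∀ x ∈ Metric.ball v δ, ν k (Set.Iio x) ≠ 0 ∧ ν k (Set.Ioi x) ≠ 0 := by
    intro x hx
    obtain ⟨⟨h1, h2⟩, -⟩ := hW x hx
    constructor
    · intro h0; simp [measureReal_def, h0] at h1
    · intro h0; simp [measureReal_def, h0] at h2
  have hbad := measure_kde_varEst_le (hm k) (hind k) (hlaw k) hak hα0 hα1 (m := m) (b k) c ε
    (W := Metric.ball v δ) Metric.isOpen_ball.measurableSet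
    (η := ENNReal.ofReal (4 * (c + ε) / ε ^ 2 / ((m + 1 : ℕ) * b k))) hpos
    (fun x hx i J hiJ hJ => by
      refine measure_condKDE_le (hb k) hε (hpos x hx) hiJ ?_
      have h3 := (hW x hx).2
      rw [Real.dist_eq] at h3
      simp only [hm'] at h3
      rw [hJ]
      exact h3.le)
  rw [← hm'] at hbad
  have hbad' := ENNReal.toReal_le_of_le_ofReal (by have := hb k; positivity) hbad
  refine (measureReal_mono (?_ : _ ⊆ ({ω | δ ≤ |varEst α (n k) (fun i => Y k i ω) - v|} ∪
    {ω | varEst α (n k) (fun i => Y k i ω) ∈ Metric.ball v δ ∧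
      ε ≤ |kde (b k) (n k) (fun i => Y k i ω) (varEst α (n k) fun i => Y k i ω) - c|} :
      Set Ω))).trans ((measureReal_union_le _ _).trans (add_le_add le_rfl hbad'))
  intro ω hω
  rcases le_or_gt δ |varEst α (n k) (fun i => Y k i ω) - v| with h | h
  · exact Or.inl h
  · exact Or.inr ⟨by rwa [Metric.mem_ball, Real.dist_eq], hω⟩

end KernelDensity

/-! ### Coupled arrays and laws of large numbers. -/

section Array

variable {Ω : Type*} [MeasurableSpace Ω] {P : Measure Ω}

/-- The rows `Y k` of the array, and the sequence `X`, are i.i.d. and square integrable; the pairs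
`(Y k i, X i)` are i.i.d. for each `k`, and `Y k i` tends to `X i` in mean square. -/
structure IsCoupledArray (P : Measure Ω) (Y : ℕ → ℕ → Ω → ℝ) (X : ℕ → Ω → ℝ) : Prop where
  meas_fst : ∀ k i, Measurable (Y k i)
  meas_snd : ∀ i, Measurable (X i)
  indep : ∀ k, iIndepFun (fun i ω => (Y k i ω, X i ω)) P
  ident : ∀ k i, IdentDistrib (fun ω => (Y k i ω, X i ω)) (fun ω => (Y k 0 ω, X 0 ω)) P P
  memLp_fst : ∀ k, MemLp (Y k 0) 2 P
  memLp_snd : MemLp (X 0) 2 P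
  tendsto_sq : Tendsto (fun k => ∫ ω, (Y k 0 ω - X 0 ω) ^ 2 ∂P) atTop (𝓝 0)

namespace IsCoupledArray

variable {Y : ℕ → ℕ → Ω → ℝ} {X : ℕ → Ω → ℝ}

lemma iIndepFun_comp (h : IsCoupledArray P Y X) (k : ℕ) {φ : ℝ × ℝ → ℝ} (hφ : Measurable φ) :
    iIndepFun (fun i ω => φ (Y k i ω, X i ω)) P :=
  (h.indep k).comp (fun _ => φ) fun _ => hφ

lemma identDistrib_comp (h : IsCoupledArray P Y X) (k i : ℕ) {φ : ℝ × ℝ → ℝ}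
    (hφ : Measurable φ) :
    IdentDistrib (fun ω => φ (Y k i ω, X i ω)) (fun ω => φ (Y k 0 ω, X 0 ω)) P P :=
  (h.ident k i).comp hφ

lemma memLp_sub (h : IsCoupledArray P Y X) (k : ℕ) :
    MemLp (fun ω => Y k 0 ω - X 0 ω) 2 P := (h.memLp_fst k).sub h.memLp_snd

lemma iIndepFun_snd (h : IsCoupledArray P Y X) : iIndepFun X P :=
  h.iIndepFun_comp 0 measurable_snd

lemma identDistrib_snd (h : IsCoupledArray P Y X) (i : ℕ) : IdentDistrib (X i) (X 0) P P :=
  h.identDistrib_comp 0 i measurable_snd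

lemma iIndepFun_fst (h : IsCoupledArray P Y X) (k : ℕ) : iIndepFun (Y k) P :=
  h.iIndepFun_comp k measurable_fst

lemma map_fst (h : IsCoupledArray P Y X) (k i : ℕ) : P.map (Y k i) = P.map (Y k 0) :=
  (h.identDistrib_comp k i measurable_fst).map_eq

variable [IsProbabilityMeasure P]

lemma tendstoInProb_sub (h : IsCoupledArray P Y X) :
    TendstoInProb P (fun k ω => Y k 0 ω - X 0 ω) 0 :=
  .of_integral_sq h.memLp_sub h.tendsto_sq

/-- The weak law of large numbers for a function of the pairs. -/
lemma tendstoInProb_sum (h : IsCoupledArray P Y X) {φ : ℕ → ℝ × ℝ → ℝ}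
    (hφ : ∀ k, Measurable (φ k)) (hL : ∀ k, MemLp (fun ω => φ k (Y k 0 ω, X 0 ω)) 2 P)
    {n : ℕ → ℕ} {a : ℕ → ℝ}
    (hlim : Tendsto (fun k => a k ^ 2 * (n k * ∫ ω, φ k (Y k 0 ω, X 0 ω) ^ 2 ∂P)) atTop (𝓝 0)) :
    TendstoInProb P (fun k ω => a k * (∑ i ∈ Finset.range (n k), φ k (Y k i ω, X i ω) -
      n k * ∫ ω, φ k (Y k 0 ω, X 0 ω) ∂P)) 0 := by
  have hv := fun k => variance_sum_range (hL k) (h.iIndepFun_comp k (hφ k))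
    (fun i => h.identDistrib_comp k i (hφ k)) (n k)
  refine .of_integral_sq (fun k => (hv k).1.const_mul (a k)) ?_
  refine squeeze_zero (fun k => integral_nonneg fun ω => sq_nonneg _) (fun k => ?_) hlim
  simp only [mul_pow]
  rw [integral_const_mul]
  exact mul_le_mul_of_nonneg_left (hv k).2 (sq_nonneg _)

/-- The strong law of large numbers for a function of the limit variables. -/
lemma tendstoInProb_mean (h : IsCoupledArray P Y X) {φ : ℝ → ℝ} (hφ : Measurable φ)
    (hint : Integrable (fun ω => φ (X 0 ω)) P) {n : ℕ → ℕ} (hn : Tendsto n atTop atTop) :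
    TendstoInProb P (fun k ω => (∑ i ∈ Finset.range (n k), φ (X i ω)) / n k)
      (∫ ω, φ (X 0 ω) ∂P) := by
  have hs := strong_law_ae_real (fun i ω => φ (X i ω)) hint
    (fun i j hij => (h.iIndepFun_snd.comp (fun _ => φ) fun _ => hφ).indepFun hij)
    (fun i => (h.identDistrib_snd i).comp hφ)
  refine TendstoInProb.comp_tendsto (X := fun n ω => (∑ i ∈ Finset.range n, φ (X i ω)) / n)
    (.of_ae (fun k => ?_) hs) hn
  refine Measurable.aestronglyMeasurable ?_
  have := h.meas_snd
  fun_prop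

/-- The indicators of `{Y k ≤ s k}` tend to the indicator of `{X ≤ v}` in mean square. -/
lemma tendsto_integral_indicator_sub_sq (h : IsCoupledArray P Y X)
    (hatom : ∀ x, P.map (X 0) {x} = 0) {v : ℝ} {s : ℕ → ℝ} (hs : Tendsto s atTop (𝓝 v)) :
    Tendsto (fun k => ∫ ω, ((if Y k 0 ω ≤ s k then (1 : ℝ) else 0) -
      (if X 0 ω ≤ v then 1 else 0)) ^ 2 ∂P) atTop (𝓝 0) := by
  have := Measure.isProbabilityMeasure_map (μ := P) (h.meas_snd 0).aemeasurable
  have hF := continuous_measureReal_Iic (P.map (X 0)) hatom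
  rw [tendsto_order]
  refine ⟨fun a ha => Eventually.of_forall fun _ =>
    ha.trans_le (integral_nonneg fun _ => sq_nonneg _), fun ρ hρ => ?_⟩
  have hF2 : Tendsto (fun η : ℝ => (P.map (X 0)).real (Set.Iic (v + 2 * η)) -
      (P.map (X 0)).real (Set.Iic (v - 2 * η))) (𝓝[>] 0) (𝓝 0) := by
    have : Continuous fun η : ℝ => (P.map (X 0)).real (Set.Iic (v + 2 * η)) -
      (P.map (X 0)).real (Set.Iic (v - 2 * η)) :=
      (hF.comp (by fun_prop : Continuous fun η : ℝ => v + 2 * η)).sub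
        (hF.comp (by fun_prop : Continuous fun η : ℝ => v - 2 * η))
    have h0 := this.tendsto 0
    simp only [mul_zero, add_zero, sub_zero, sub_self] at h0
    exact h0.mono_left nhdsWithin_le_nhds
  obtain ⟨η, hη1, hη⟩ := ((hF2.eventually (gt_mem_nhds (show 0 < ρ / 2 by positivity))).and
    self_mem_nhdsWithin).exists
  have hη : 0 < η := hη
  have hs' : ∀ᶠ k in atTop, |s k - v| < η := by
    filter_upwards [Metric.tendsto_nhds.1 hs η hη] with k hk
    rwa [Real.dist_eq] at hk
  filter_upwards [hs', (h.tendstoInProb_sub η hη).eventually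
    (gt_mem_nhds (show 0 < ρ / 2 by positivity))] with k hk1 hk2
  -- Off `E` the two indicators agree: `Y` is within `η` of `X`, `s k` within `η` of `v`, and `X` is
  -- not in the band of half-width `2 η` around `v`. The band has small mass because `X` has no
  -- atoms.
  set E : Set Ω := {ω | η ≤ |Y k 0 ω - X 0 ω - 0|} ∪ X 0 ⁻¹' Set.Ioc (v - 2 * η) (v + 2 * η)
  have hE : MeasurableSet E := by
    refine MeasurableSet.union (measurableSet_le measurable_const ?_)
      (h.meas_snd 0 measurableSet_Ioc)
    exact (((h.meas_fst k 0).sub (h.meas_snd 0)).sub_const 0).abs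
  have hint1 : Integrable (E.indicator fun _ => (1 : ℝ)) P :=
    (integrable_const _).indicator hE
  have hle : ∫ ω, ((if Y k 0 ω ≤ s k then (1 : ℝ) else 0) -
      (if X 0 ω ≤ v then 1 else 0)) ^ 2 ∂P ≤ ∫ ω, E.indicator (fun _ => (1 : ℝ)) ω ∂P := by
    refine integral_mono_of_nonneg (ae_of_all _ fun _ => sq_nonneg _) hint1
      (ae_of_all _ fun ω => ?_)
    by_cases hω : ω ∈ E
    · simp only [Set.indicator_of_mem hω]
      split_ifs <;> norm_num
    · simp only [Set.indicator_of_notMem hω]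
      simp only [E, Set.mem_union, Set.mem_ofPred_eq, sub_zero, not_or, not_le, Set.mem_preimage,
        Set.mem_Ioc, not_and] at hω
      obtain ⟨h1, h2⟩ := hω
      rw [abs_lt] at h1 hk1
      have h3 : Y k 0 ω ≤ s k ↔ X 0 ω ≤ v := by
        constructor
        · intro h4
          by_contra! h5
          linarith [h2 (by linarith)]
        · intro h4
          by_contra! h5
          linarith [h2 (by linarith)]
      simp [h3]
  rw [integral_indicator_const _ hE, smul_eq_mul, mul_one] at hle
  refine hle.trans_lt ((measureReal_union_le _ _).trans_lt ?_)
  have h6 : P.real (X 0 ⁻¹' Set.Ioc (v - 2 * η) (v + 2 * η)) =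
      (P.map (X 0)).real (Set.Iic (v + 2 * η)) - (P.map (X 0)).real (Set.Iic (v - 2 * η)) := by
    rw [← map_measureReal_apply (h.meas_snd 0) measurableSet_Ioc, ← Set.Iic_sdiff_Iic,
      measureReal_sdiff (Set.Iic_subset_Iic.2 (by linarith)) measurableSet_Iic]
  rw [h6]
  linarith

end IsCoupledArray

/-- The derivative of the distribution functions at `v` on the scale `1 / √n`. The error in
`HasLocalDensity` is relative to the length of the interval, so it survives the multiplication by
`√n`. -/
lemma HasLocalDensity.tendsto_sqrt_mul_sub {ν : ℕ → Measure ℝ} [∀ k, IsProbabilityMeasure (ν k)]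
    {v c : ℝ} (hν : HasLocalDensity ν v c) {n : ℕ → ℕ} (hn : Tendsto n atTop atTop) (t : ℝ) :
    Tendsto (fun k => √(n k) * ((ν k).real (Set.Iic (v + t / √(n k))) - (ν k).real (Set.Iic v)))
      atTop (𝓝 (c * t)) := by
  have hsq : Tendsto (fun k => √(n k : ℝ)) atTop atTop :=
    Real.tendsto_sqrt_atTop.comp (tendsto_natCast_atTop_atTop.comp hn)
  have ht : Tendsto (fun k => |t / √(n k : ℝ)|) atTop (𝓝 0) := by
    simpa using (tendsto_const_nhds (x := t).div_atTop hsq).abs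
  rw [Metric.tendsto_nhds]
  intro ε hε
  -- The tolerance is chosen so that its product with `|t|`, the rescaled interval length, stays
  -- below `ε`.
  obtain ⟨δ, hδ, hev⟩ := hν (ε / (2 * (|t| + 1))) (by positivity)
  filter_upwards [hev, ht.eventually (gt_mem_nhds hδ), hsq.eventually (eventually_gt_atTop 0)]
    with k hk1 hk2 hk3
  set u := t / √(n k : ℝ) with hu
  have hut : √(n k : ℝ) * u = t := by rw [hu]; field_simp
  have key : |(ν k).real (Set.Iic (v + u)) - (ν k).real (Set.Iic v) - c * u| ≤
      ε / (2 * (|t| + 1)) * |u| := by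
    rw [abs_lt] at hk2
    rcases le_total 0 u with h0 | h0
    · have h1 := hk1 (Set.Ioc v (v + u)) measurableSet_Ioc
        fun z hz => ⟨by linarith [hz.1], by linarith [hz.2]⟩
      rw [Real.volume_real_Ioc_of_le (by linarith), ← Set.Iic_sdiff_Iic,
        measureReal_sdiff (Set.Iic_subset_Iic.2 (by linarith)) measurableSet_Iic,
        add_sub_cancel_left] at h1
      rwa [abs_of_nonneg h0]
    · have h1 := hk1 (Set.Ioc (v + u) v) measurableSet_Ioc
        fun z hz => ⟨by linarith [hz.1], by linarith [hz.2]⟩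
      rw [Real.volume_real_Ioc_of_le (by linarith), ← Set.Iic_sdiff_Iic,
        measureReal_sdiff (Set.Iic_subset_Iic.2 (by linarith)) measurableSet_Iic,
        show v - (v + u) = -u by ring, ← abs_neg] at h1
      rw [abs_of_nonpos h0]
      refine le_of_eq_of_le ?_ h1
      congr 1; ring
  rw [Real.dist_eq]
  have e : √(n k : ℝ) * ((ν k).real (Set.Iic (v + u)) - (ν k).real (Set.Iic v)) - c * t =
      √(n k : ℝ) * ((ν k).real (Set.Iic (v + u)) - (ν k).real (Set.Iic v) - c * u) := by
    rw [← hut]; ring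
  rw [e, abs_mul, abs_of_pos hk3]
  calc _ ≤ √(n k : ℝ) * (ε / (2 * (|t| + 1)) * |u|) := by gcongr
    _ = ε / (2 * (|t| + 1)) * |√(n k : ℝ) * u| := by rw [abs_mul, abs_of_pos hk3]; ring
    _ = ε * (|t| / (2 * (|t| + 1))) := by rw [hut]; ring
    _ < ε * 1 := by
        gcongr
        rw [div_lt_one (by positivity)]
        linarith [abs_nonneg t]
    _ = ε := mul_one ε

end Array

/-! ### Coverage of t-intervals. -/

section Coverage

variable {Ω : Type*} [MeasurableSpace Ω] {P : Measure Ω} [IsProbabilityMeasure P]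

/-- Asymptotic coverage of a t-interval around an asymptotically normal estimator. -/
lemma tendsto_coverage {est sig : ℕ → Ω → ℝ} (hest : ∀ k, Measurable (est k))
    (hsig : ∀ k, Measurable (sig k)) (hsig0 : ∀ᶠ k in atTop, ∀ ω, 0 ≤ sig k ω) {v σ : ℝ}
    (hσ : 0 < σ) {n : ℕ → ℕ} (hn : Tendsto n atTop atTop)
    (hT : ∀ x, Tendsto (fun k => P.real {ω | √(n k) * (est k ω - v) ≤ x}) atTop
      (𝓝 (normalCDF (x / σ))))
    (hs : TendstoInProb P sig σ) {β : ℝ} (hβ0 : 0 < β) (hβ1 : β < 1) :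
    Tendsto (fun k => P.real {ω | v ∈ Set.Icc
      (est k ω + tQuantile (β / 2) (n k - 1) * sig k ω / √(n k : ℝ))
      (est k ω + tQuantile (1 - β / 2) (n k - 1) * sig k ω / √(n k : ℝ))}) atTop (𝓝 (1 - β)) := by
  obtain ⟨z₁, hz₁⟩ := exists_normalCDF_eq (γ := β / 2) (by linarith) (by linarith)
  obtain ⟨z₂, hz₂⟩ := exists_normalCDF_eq (γ := 1 - β / 2) (by linarith) (by linarith)
  have hz : z₁ < z₂ := strictMono_normalCDF.lt_iff_lt.1 (by rw [hz₁, hz₂]; linarith)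
  have hd : Tendsto (fun k => (n k : ℝ) - 1) atTop atTop :=
    tendsto_atTop_add_const_right _ _ (tendsto_natCast_atTop_atTop.comp hn)
  have ht₁ := (tendsto_tQuantile hz₁).comp hd
  have ht₂ := (tendsto_tQuantile hz₂).comp hd
  have hcont : Continuous fun x => normalCDF (x / σ) :=
    continuous_normalCDF.comp (by fun_prop)
  have hzero : TendstoInProb P (fun k ω => √(n k) * (est k ω - v) - √(n k) * (est k ω - v)) 0 := by
    simpa using TendstoInProb.of_tendsto (P := P) (tendsto_const_nhds (x := (0 : ℝ)))
  have hpos : ∀ᶠ k in atTop, 0 < √(n k : ℝ) := by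
    filter_upwards [hn.eventually (eventually_gt_atTop 0)] with k hk
    exact Real.sqrt_pos.2 (by exact_mod_cast hk)
  have hiff : ∀ k, 0 < √(n k : ℝ) → ∀ ω t, (est k ω + t * sig k ω / √(n k : ℝ) ≤ v ↔
      √(n k) * (est k ω - v) ≤ -t * sig k ω) := by
    intro k hk ω t
    rw [← sub_nonneg, ← sub_nonneg (b := √(n k : ℝ) * _)]
    have : -t * sig k ω - √(n k : ℝ) * (est k ω - v) =
        √(n k : ℝ) * (v - (est k ω + t * sig k ω / √(n k : ℝ))) := by field_simp; ring
    rw [this, mul_nonneg_iff_of_pos_left hk]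
  have hiff' : ∀ k, 0 < √(n k : ℝ) → ∀ ω t, (est k ω + t * sig k ω / √(n k : ℝ) < v ↔
      √(n k) * (est k ω - v) < -t * sig k ω) := by
    intro k hk ω t
    rw [← sub_pos, ← sub_pos (b := √(n k : ℝ) * _)]
    have : -t * sig k ω - √(n k : ℝ) * (est k ω - v) =
        √(n k : ℝ) * (v - (est k ω + t * sig k ω / √(n k : ℝ))) := by field_simp; ring
    rw [this, mul_pos_iff_of_pos_left hk]
  -- The interval covers `v` on `A \ B`. Since `B ⊆ A` eventually, coverage is a difference of two
  -- probabilities, each given by Slutsky's theorem.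
  set A : ℕ → Set Ω := fun k =>
    {ω | est k ω + tQuantile (β / 2) (n k - 1) * sig k ω / √(n k : ℝ) ≤ v}
  set B : ℕ → Set Ω := fun k =>
    {ω | est k ω + tQuantile (1 - β / 2) (n k - 1) * sig k ω / √(n k : ℝ) < v}
  have hA : Tendsto (fun k => P.real (A k)) atTop (𝓝 (normalCDF (-z₁ * σ / σ))) := by
    refine tendsto_measureReal_of_slutsky hT hcont.continuousAt hzero
      ((TendstoInProb.of_tendsto ht₁.neg).mul hs) ?_ ?_
    · filter_upwards [hpos] with k hk ω hω
      exact (hiff k hk ω _).2 (le_of_lt hω)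
    · filter_upwards [hpos] with k hk ω hω
      exact (hiff k hk ω _).1 hω
  have hB : Tendsto (fun k => P.real (B k)) atTop (𝓝 (normalCDF (-z₂ * σ / σ))) := by
    refine tendsto_measureReal_of_slutsky hT hcont.continuousAt hzero
      ((TendstoInProb.of_tendsto ht₂.neg).mul hs) ?_ ?_
    · filter_upwards [hpos] with k hk ω hω
      exact (hiff' k hk ω _).2 hω
    · filter_upwards [hpos] with k hk ω hω
      exact ((hiff' k hk ω _).1 hω).le
  have hval : normalCDF (-z₁ * σ / σ) - normalCDF (-z₂ * σ / σ) = 1 - β := by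
    rw [mul_div_cancel_right₀ _ hσ.ne', mul_div_cancel_right₀ _ hσ.ne', normalCDF_neg,
      normalCDF_neg, hz₁, hz₂]; ring
  rw [← hval]
  refine (hA.sub hB).congr' ?_
  filter_upwards [hsig0, ht₁.eventually_lt ht₂ hz] with k hk1 hk2
  have hBA : B k ⊆ A k := fun ω hω => by
    have hω' : est k ω + tQuantile (1 - β / 2) (n k - 1) * sig k ω / √(n k : ℝ) < v := hω
    refine le_trans ?_ hω'.le
    have := hk1 ω
    have hk2' : tQuantile (β / 2) (n k - 1) ≤ tQuantile (1 - β / 2) (n k - 1) := hk2.le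
    gcongr
  have hBm : MeasurableSet (B k) := by
    have := hest k
    have := hsig k
    exact measurableSet_lt (by fun_prop) measurable_const
  rw [← measureReal_sdiff hBA hBm]
  congr 1
  ext ω
  simp [A, B]

end Coverage

/-! ### Regular arrays and asymptotic normality of the VaR estimator. -/

section RegularArray

variable {Ω : Type*} [MeasurableSpace Ω] {P : Measure Ω}

/-- The conditions on a coupled array of sample sizes `n k` under which the order statistics and
the tail means of its rows are asymptotically normal around `v = VaR` and CVaR of the limit. -/
structure IsRegularArray (P : Measure Ω) (Y : ℕ → ℕ → Ω → ℝ) (X : ℕ → Ω → ℝ) (n : ℕ → ℕ)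
    (α v c : ℝ) : Prop extends IsCoupledArray P Y X where
  level_pos : 0 < α
  level_lt_one : α < 1
  tendsto_size : Tendsto n atTop atTop
  size_pos : ∀ k, 0 < n k
  noAtoms_snd : ∀ x, P.map (X 0) {x} = 0
  cdf_snd : P.real {ω | X 0 ω ≤ v} = α
  noAtoms_fst : ∀ᶠ k in atTop, ∀ x, P.map (Y k 0) {x} = 0
  density_pos : 0 < c
  density : HasLocalDensity (fun k => P.map (Y k 0)) v c
  bias_cdf : Tendsto (fun k => √(n k) * (P.real {ω | Y k 0 ω ≤ v} - α)) atTop (𝓝 0)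
  bias_excess : Tendsto (fun k => √(n k) * (∫ ω, max (Y k 0 ω - v) 0 ∂P -
    ∫ ω, max (X 0 ω - v) 0 ∂P)) atTop (𝓝 0)

namespace IsRegularArray

variable {Y : ℕ → ℕ → Ω → ℝ} {X : ℕ → Ω → ℝ} {n : ℕ → ℕ} {α v c : ℝ}

lemma tendsto_sqrt_size (h : IsRegularArray P Y X n α v c) :
    Tendsto (fun k => √(n k : ℝ)) atTop atTop :=
  Real.tendsto_sqrt_atTop.comp (tendsto_natCast_atTop_atTop.comp h.tendsto_size)

lemma sqrt_size_pos (h : IsRegularArray P Y X n α v c) (k : ℕ) : 0 < √(n k : ℝ) :=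
  Real.sqrt_pos.2 (by exact_mod_cast h.size_pos k)

lemma measurable_varEst (h : IsRegularArray P Y X n α v c) (k : ℕ) :
    Measurable fun ω => varEst α (n k) fun i => Y k i ω :=
  (continuous_varEst h.level_pos h.level_lt_one (h.size_pos k)).measurable.comp
    (measurable_pi_iff.2 (h.meas_fst k))

lemma tendsto_cdf_fst (h : IsRegularArray P Y X n α v c) :
    Tendsto (fun k => P.real {ω | Y k 0 ω ≤ v}) atTop (𝓝 α) := by
  have h1 := h.bias_cdf.mul (tendsto_inv_atTop_zero.comp h.tendsto_sqrt_size)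
  have h2 := h1.add_const α
  simp only [zero_mul, zero_add] at h2
  refine h2.congr fun k => ?_
  have := h.sqrt_size_pos k
  simp only [Function.comp_apply]
  field_simp
  ring

variable [IsProbabilityMeasure P]

/-- The VaR estimator is asymptotically normal. -/
lemma tendsto_cdf_varEst (h : IsRegularArray P Y X n α v c) (t : ℝ) :
    Tendsto (fun k => P.real {ω | √(n k) * (varEst α (n k) (fun i => Y k i ω) - v) ≤ t}) atTop
      (𝓝 (normalCDF (t / (√(α * (1 - α)) / c)))) := by
  have hα0 := h.level_pos
  have hα1 := h.level_lt_one
  have hind : Measurable fun x : ℝ => if x ≤ v then (-1 : ℝ) else 0 :=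
    Measurable.ite measurableSet_Iic measurable_const measurable_const
  -- The negative sign turns the lower bound on the count into an upper bound on a sum, the form of
  -- the central limit theorem in use.
  set u : ℕ → Ω → ℝ := fun i ω => if X i ω ≤ v then (-1 : ℝ) else 0 with hu
  have hum : ∀ i, Measurable (u i) := fun i => hind.comp (h.meas_snd i)
  have huL : MemLp (u 0) 2 P := by
    refine MemLp.of_bound (hum 0).aestronglyMeasurable 1 (ae_of_all _ fun ω => ?_)
    simp only [hu]; split_ifs <;> norm_num
  have hset : MeasurableSet {ω | X 0 ω ≤ v} := h.meas_snd 0 measurableSet_Iic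
  have hu1 : ∫ ω, u 0 ω ∂P = -α := by
    have : u 0 = fun ω => -({ω | X 0 ω ≤ v}.indicator (fun _ => (1 : ℝ)) ω) := by
      ext ω; simp only [hu, Set.indicator, Set.mem_ofPred_eq]; split_ifs <;> norm_num
    rw [this, integral_neg, integral_indicator_const _ hset, h.cdf_snd]; simp
  have hu2 : ∫ ω, u 0 ω ^ 2 ∂P = α := by
    have : (fun ω => u 0 ω ^ 2) = {ω | X 0 ω ≤ v}.indicator (fun _ => (1 : ℝ)) := by
      ext ω; simp only [hu, Set.indicator, Set.mem_ofPred_eq]; split_ifs <;> norm_num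
    rw [this, integral_indicator_const _ hset, h.cdf_snd]; simp
  have huvar : Var[u 0; P] = α * (1 - α) := by
    rw [variance_eq_sub huL]
    simp only [Pi.pow_apply]
    rw [hu1, hu2]; ring
  have hvpos : 0 < α * (1 - α) := mul_pos hα0 (by linarith)
  have hclt := fun x => (tendsto_cdf_of_iIndepFun (P := P) (X := u) huL
    (h.iIndepFun_snd.comp (fun _ x => if x ≤ v then (-1 : ℝ) else 0) fun _ => hind)
    (fun i => (h.identDistrib_snd i).comp hind) (huvar ▸ hvpos) x).comp h.tendsto_size
  rw [huvar, hu1] at hclt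
  set s : ℕ → ℝ := fun k => v + t / √(n k : ℝ) with hs
  have hsv : Tendsto s atTop (𝓝 v) := by
    simpa using tendsto_const_nhds.add ((tendsto_const_nhds (x := t)).div_atTop h.tendsto_sqrt_size)
  set φ : ℕ → ℝ × ℝ → ℝ := fun k p =>
    (if p.1 ≤ s k then (1 : ℝ) else 0) - (if p.2 ≤ v then 1 else 0) with hφ
  have hφm : ∀ k, Measurable (φ k) := fun k =>
    (Measurable.ite (measurableSet_le measurable_fst measurable_const) measurable_const
      measurable_const).sub
    (Measurable.ite (measurableSet_le measurable_snd measurable_const) measurable_const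
      measurable_const)
  have hφL : ∀ k, MemLp (fun ω => φ k (Y k 0 ω, X 0 ω)) 2 P := fun k => by
    refine MemLp.of_bound ((hφm k).comp ((h.meas_fst k 0).prodMk
      (h.meas_snd 0))).aestronglyMeasurable 1 (ae_of_all _ fun ω => ?_)
    simp only [hφ]; split_ifs <;> norm_num
  have hφ2 := h.tendsto_integral_indicator_sub_sq h.noAtoms_snd hsv
  have hZ := h.tendstoInProb_sum hφm hφL (n := n) (a := fun k => (√(n k : ℝ))⁻¹) (by
    refine hφ2.congr fun k => ?_
    have hk : (0 : ℝ) < n k := by exact_mod_cast h.size_pos k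
    rw [inv_pow, Real.sq_sqrt hk.le, ← mul_assoc, inv_mul_cancel₀ hk.ne', one_mul])
  have hφmean : ∀ k, ∫ ω, φ k (Y k 0 ω, X 0 ω) ∂P =
      (P.map (Y k 0)).real (Set.Iic (s k)) - α := fun k => by
    have hY : MeasurableSet {ω | Y k 0 ω ≤ s k} := h.meas_fst k 0 measurableSet_Iic
    have : (fun ω => φ k (Y k 0 ω, X 0 ω)) = fun ω =>
        {ω | Y k 0 ω ≤ s k}.indicator (fun _ => (1 : ℝ)) ω -
        {ω | X 0 ω ≤ v}.indicator (fun _ => (1 : ℝ)) ω := by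
      ext ω; simp only [hφ, Set.indicator, Set.mem_ofPred_eq]
    rw [this, integral_sub ((integrable_const _).indicator hY)
      ((integrable_const _).indicator hset), integral_indicator_const _ hset, h.cdf_snd,
      integral_indicator_const _ hY, map_measureReal_apply (h.meas_fst k 0) measurableSet_Iic]
    simp only [smul_eq_mul, mul_one]
    rfl
  have hprob : ∀ k, IsProbabilityMeasure (P.map (Y k 0)) :=
    fun k => Measure.isProbabilityMeasure_map (h.meas_fst k 0).aemeasurable
  -- The mean of `φ` is the increment of the row distribution function from `v` to `s k` plus its
  -- bias at `v`; the first gives `c t` and the second vanishes by `bias_cdf`.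
  have hbias : Tendsto (fun k => √(n k : ℝ) * ∫ ω, φ k (Y k 0 ω, X 0 ω) ∂P) atTop
      (𝓝 (c * t)) := by
    have h1 := (h.density.tendsto_sqrt_mul_sub h.tendsto_size t).add h.bias_cdf
    rw [add_zero] at h1
    refine h1.congr fun k => ?_
    have h2 : (P.map (Y k 0)).real (Set.Iic v) = P.real {ω | Y k 0 ω ≤ v} := by
      rw [map_measureReal_apply (h.meas_fst k 0) measurableSet_Iic]; rfl
    rw [hφmean, ← mul_add, h2, sub_add_sub_cancel]
  have hC := hZ.add (TendstoInProb.of_tendsto (P := P) hbias)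
  rw [zero_add] at hC
  have hzero : TendstoInProb P (fun k ω =>
      (√(n k : ℝ))⁻¹ * (∑ i ∈ Finset.range (n k), u i ω - n k * -α) -
      (√(n k : ℝ))⁻¹ * (∑ i ∈ Finset.range (n k), u i ω - n k * -α)) 0 := by
    simpa using TendstoInProb.of_tendsto (P := P) (tendsto_const_nhds (x := (0 : ℝ)))
  have hcont : Continuous fun x => normalCDF (x / √(α * (1 - α))) :=
    continuous_normalCDF.comp (by fun_prop)
  -- By the counting criterion the event compares the normalised sum of the `u i` with a random
  -- threshold that tends to `c t` in probability.
  have hiff : ∀ k ω, √(n k) * (varEst α (n k) (fun i => Y k i ω) - v) ≤ t ↔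
      (√(n k : ℝ))⁻¹ * (∑ i ∈ Finset.range (n k), u i ω - n k * -α) ≤
        (√(n k : ℝ))⁻¹ * (∑ i ∈ Finset.range (n k), φ k (Y k i ω, X i ω) -
          n k * ∫ ω, φ k (Y k 0 ω, X 0 ω) ∂P) +
          √(n k : ℝ) * ∫ ω, φ k (Y k 0 ω, X 0 ω) ∂P := by
    intro k ω
    have hk := h.sqrt_size_pos k
    have hk' : (n k : ℝ) = √(n k : ℝ) * √(n k : ℝ) :=
      (Real.mul_self_sqrt (Nat.cast_nonneg _)).symm
    have e1 : √(n k) * (varEst α (n k) (fun i => Y k i ω) - v) ≤ t ↔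
        varEst α (n k) (fun i => Y k i ω) ≤ s k := by
      rw [hs, ← sub_le_iff_le_add', le_div_iff₀ hk, mul_comm]
    have e2 : ∑ i ∈ Finset.range (n k), φ k (Y k i ω, X i ω) =
        (∑ i ∈ Finset.range (n k), if Y k i ω ≤ s k then (1 : ℝ) else 0) +
          ∑ i ∈ Finset.range (n k), u i ω := by
      rw [← Finset.sum_add_distrib]
      refine Finset.sum_congr rfl fun i _ => ?_
      simp only [hφ, hu]
      split_ifs <;> norm_num
    rw [e1, varEst_le_iff hα0 hα1 (h.size_pos k), e2]
    set S := ∑ i ∈ Finset.range (n k), if Y k i ω ≤ s k then (1 : ℝ) else 0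
    set U := ∑ i ∈ Finset.range (n k), u i ω
    set I := ∫ ω, φ k (Y k 0 ω, X 0 ω) ∂P
    rw [← sub_nonneg, ← sub_nonneg (b := (√(n k : ℝ))⁻¹ * _)]
    have e3 : (√(n k : ℝ))⁻¹ * (S + U - n k * I) + √(n k : ℝ) * I -
        (√(n k : ℝ))⁻¹ * (U - n k * -α) = (√(n k : ℝ))⁻¹ * (S - α * n k) := by
      have : √(n k : ℝ) * I = (√(n k : ℝ))⁻¹ * (n k * I) := by
        rw [inv_mul_eq_div, eq_div_iff hk.ne', mul_right_comm, ← hk']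
      rw [this]; ring
    rw [e3, mul_nonneg_iff_of_pos_left (inv_pos.2 hk)]
  have hfin := tendsto_measureReal_of_slutsky (P := P) hclt hcont.continuousAt hzero hC
    (E := fun k => {ω | √(n k) * (varEst α (n k) (fun i => Y k i ω) - v) ≤ t})
    (Eventually.of_forall fun k ω hω => (hiff k ω).2 (le_of_lt hω))
    (Eventually.of_forall fun k ω hω => (hiff k ω).1 hω)
  have : c * t / √(α * (1 - α)) = t / (√(α * (1 - α)) / c) := by
    have := h.density_pos.ne'
    have := (Real.sqrt_pos.2 hvpos).ne'
    field_simp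
  rwa [this] at hfin

/-- The normal limit makes the scaled VaR error tight, and a tight sequence times a vanishing one
vanishes. -/
lemma tendstoInProb_sqrt_varEst_mul (h : IsRegularArray P Y X n α v c) {Z : ℕ → Ω → ℝ}
    (hZ : TendstoInProb P Z 0) :
    TendstoInProb P (fun k ω => √(n k) * (varEst α (n k) (fun i => Y k i ω) - v) * Z k ω) 0 := by
  have hα0 := h.level_pos
  have hα1 := h.level_lt_one
  have hσ : 0 < √(α * (1 - α)) / c :=
    div_pos (Real.sqrt_pos.2 (mul_pos hα0 (by linarith))) h.density_pos
  refine hZ.mul_of_tendsto_cdf (S := fun k ω => √(n k) * (varEst α (n k) (fun i => Y k i ω) - v))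
    (fun k => ?_) h.tendsto_cdf_varEst ?_ ?_
  · have := h.measurable_varEst k
    fun_prop
  · exact tendsto_normalCDF_atBot.comp (tendsto_id.atBot_div_const hσ)
  · exact tendsto_normalCDF_atTop.comp (tendsto_id.atTop_div_const hσ)

lemma tendstoInProb_varEst (h : IsRegularArray P Y X n α v c) :
    TendstoInProb P (fun k ω => varEst α (n k) fun i => Y k i ω) v := by
  have h1 := (h.tendstoInProb_sqrt_varEst_mul (Z := fun k _ => (√(n k : ℝ))⁻¹)
    (.of_tendsto (tendsto_inv_atTop_zero.comp h.tendsto_sqrt_size))).add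
    (TendstoInProb.of_tendsto (P := P) (tendsto_const_nhds (x := v)))
  rw [zero_add] at h1
  refine h1.congr (Eventually.of_forall fun k ω => ?_)
  have := h.sqrt_size_pos k
  field_simp
  ring

end IsRegularArray

end RegularArray

lemma sampleVar_eq {n : ℕ} (hn : 0 < n) (y : ℕ → ℝ) :
    sampleVar n y = ((∑ i ∈ Finset.range n, y i ^ 2) / n - ((∑ i ∈ Finset.range n, y i) / n) ^ 2) *
      ((n : ℝ) / ((n : ℝ) - 1)) := by
  have hn' : (n : ℝ) ≠ 0 := by exact_mod_cast hn.ne'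
  have h : ∑ i ∈ Finset.range n, (y i - sampleMean n y) ^ 2 =
      (∑ i ∈ Finset.range n, y i ^ 2) - (∑ i ∈ Finset.range n, y i) ^ 2 / n := by
    simp only [sub_sq, sampleMean, Finset.sum_add_distrib, Finset.sum_sub_distrib,
      ← Finset.sum_mul, ← Finset.mul_sum, Finset.sum_const, Finset.card_range, nsmul_eq_mul]
    field_simp
    ring
  rw [sampleVar, h]
  field_simp

lemma sampleVar_nonneg {n : ℕ} (hn : 0 < n) (y : ℕ → ℝ) : 0 ≤ sampleVar n y := by
  have : (1 : ℝ) ≤ n := by exact_mod_cast hn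
  exact div_nonneg (Finset.sum_nonneg fun i _ => sq_nonneg _) (by linarith)

lemma abs_mean_mul_le (n : ℕ) (d x : ℕ → ℝ) :
    |(∑ i ∈ Finset.range n, d i * x i) / n| ≤
      √((∑ i ∈ Finset.range n, d i ^ 2) / n) * √((∑ i ∈ Finset.range n, x i ^ 2) / n) := by
  rw [← Real.sqrt_mul (by positivity), ← Real.sqrt_sq_eq_abs, div_pow, div_mul_div_comm, ← sq]
  gcongr
  exact Finset.sum_mul_sq_le_sq_mul_sq _ _ _

/-! ### The CVaR estimator and its variance estimate. -/

section RegularArray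

variable {Ω : Type*} [MeasurableSpace Ω] {P : Measure Ω} {Y : ℕ → ℕ → Ω → ℝ} {X : ℕ → Ω → ℝ}
  {n : ℕ → ℕ} {α v c : ℝ} [IsProbabilityMeasure P]

namespace IsRegularArray

/-- The variance of the excess of the limit variable. -/
lemma excess_variance_pos (h : IsRegularArray P Y X n α v c) :
    0 < Var[fun ω => max (X 0 ω - v) 0; P] := by
  have hm : Measurable fun ω => max (X 0 ω - v) 0 :=
    ((h.meas_snd 0).sub_const v).max measurable_const
  have hL : MemLp (fun ω => max (X 0 ω - v) 0) 2 P :=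
    (h.memLp_snd.sub (memLp_const v)).pos_part
  refine lt_of_le_of_ne (variance_nonneg _ _) fun h0 => ?_
  have hae := ae_eq_integral_of_variance_eq_zero hL h0.symm
  set μ := ∫ ω, max (X 0 ω - v) 0 ∂P
  have hset : MeasurableSet {ω | X 0 ω ≤ v} := h.meas_snd 0 measurableSet_Iic
  have hα0 := h.level_pos
  have hα1 := h.level_lt_one
  -- A constant excess must be zero, because `X ≤ v` has probability `α > 0`. Then `X ≤ v` almost
  -- surely, which contradicts `α < 1`.
  have hμ : μ = 0 := by
    by_contra hne
    have h1 : P {ω | X 0 ω ≤ v} = 0 := by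
      have : ∀ᵐ ω ∂P, ω ∉ {ω | X 0 ω ≤ v} := by
        filter_upwards [hae] with ω hω hle
        have hle' : X 0 ω ≤ v := hle
        rw [max_eq_right (by linarith)] at hω
        exact hne hω.symm
      simpa [ae_iff] using this
    have := h.cdf_snd
    rw [measureReal_def, h1] at this
    simp at this
    linarith
  have h1 : ∀ᵐ ω ∂P, ω ∈ {ω | X 0 ω ≤ v} := by
    filter_upwards [hae] with ω hω
    rw [hμ] at hω
    have := le_max_left (X 0 ω - v) 0
    change X 0 ω ≤ v
    linarith
  have h2 := (mem_ae_iff_prob_eq_one hset).1 h1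
  have := h.cdf_snd
  rw [measureReal_def, h2] at this
  simp at this
  linarith

lemma memLp_excess_fst (h : IsRegularArray P Y X n α v c) (k : ℕ) :
    MemLp (fun ω => max (Y k 0 ω - v) 0) 2 P :=
  ((h.memLp_fst k).sub (memLp_const v)).pos_part

lemma memLp_excess_snd (h : IsRegularArray P Y X n α v c) :
    MemLp (fun ω => max (X 0 ω - v) 0) 2 P :=
  (h.memLp_snd.sub (memLp_const v)).pos_part

/-- The empirical distribution function at `v` is consistent. -/
lemma tendstoInProb_empirical (h : IsRegularArray P Y X n α v c) :
    TendstoInProb P (fun k ω =>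
      (∑ i ∈ Finset.range (n k), if Y k i ω ≤ v then (1 : ℝ) else 0) / n k - α) 0 := by
  have hφm : Measurable fun p : ℝ × ℝ => if p.1 ≤ v then (1 : ℝ) else 0 :=
    Measurable.ite (measurableSet_le measurable_fst measurable_const) measurable_const
      measurable_const
  have hφL : ∀ k, MemLp (fun ω => if Y k 0 ω ≤ v then (1 : ℝ) else 0) 2 P := fun k => by
    refine MemLp.of_bound (hφm.comp ((h.meas_fst k 0).prodMk
      (h.meas_snd 0))).aestronglyMeasurable 1 (ae_of_all _ fun ω => ?_)
    split_ifs <;> norm_num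
  have hinv : Tendsto (fun k => (n k : ℝ)⁻¹) atTop (𝓝 0) :=
    tendsto_inv_atTop_zero.comp (tendsto_natCast_atTop_atTop.comp h.tendsto_size)
  have h1 := h.tendstoInProb_sum (φ := fun _ p => if p.1 ≤ v then (1 : ℝ) else 0)
    (fun _ => hφm) hφL (n := n) (a := fun k => (n k : ℝ)⁻¹) (by
    refine squeeze_zero (fun k => ?_) (fun k => ?_) hinv
    · exact mul_nonneg (sq_nonneg _) (mul_nonneg (Nat.cast_nonneg _)
        (integral_nonneg fun _ => sq_nonneg _))
    · have hk : (0 : ℝ) < n k := by exact_mod_cast h.size_pos k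
      have hle : ∫ ω, (if Y k 0 ω ≤ v then (1 : ℝ) else 0) ^ 2 ∂P ≤ 1 := by
        have := integral_mono_of_nonneg (μ := P) (ae_of_all _ fun ω => sq_nonneg
          (if Y k 0 ω ≤ v then (1 : ℝ) else 0)) (integrable_const (1 : ℝ))
          (ae_of_all _ fun ω => by simp only; split_ifs <;> norm_num)
        simpa using this
      calc _ ≤ ((n k : ℝ)⁻¹) ^ 2 * (n k * 1) := by gcongr
        _ = (n k : ℝ)⁻¹ := by field_simp)
  have h2 := h1.add (TendstoInProb.of_tendsto (P := P) (h.tendsto_cdf_fst.sub_const α))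
  rw [sub_self, zero_add] at h2
  refine h2.congr (Eventually.of_forall fun k ω => ?_)
  have hk : (0 : ℝ) < n k := by exact_mod_cast h.size_pos k
  have hY : MeasurableSet {ω | Y k 0 ω ≤ v} := h.meas_fst k 0 measurableSet_Iic
  have : ∫ ω, (if Y k 0 ω ≤ v then (1 : ℝ) else 0) ∂P = P.real {ω | Y k 0 ω ≤ v} := by
    have e : (fun ω => if Y k 0 ω ≤ v then (1 : ℝ) else 0) =
        {ω | Y k 0 ω ≤ v}.indicator (fun _ => (1 : ℝ)) := by
      ext ω; simp only [Set.indicator, Set.mem_ofPred_eq]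
    rw [e, integral_indicator_const _ hY]; simp
  simp only [this]
  field_simp
  ring

/-- The CVaR estimator is asymptotically normal. -/
lemma tendsto_cdf_cvarEst (h : IsRegularArray P Y X n α v c) (t : ℝ) :
    Tendsto (fun k => P.real {ω | √(n k) * (cvarEst α (n k) (fun i => Y k i ω) -
        (v + 1 / (1 - α) * ∫ ω, max (X 0 ω - v) 0 ∂P)) ≤ t}) atTop
      (𝓝 (normalCDF (t / (√Var[fun ω => max (X 0 ω - v) 0; P] / (1 - α))))) := by
  have hα : 0 < 1 - α := by linarith [h.level_lt_one]
  have hem : Measurable fun x : ℝ => max (x - v) 0 := by fun_prop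
  set V := Var[fun ω => max (X 0 ω - v) 0; P] with hV
  set E := ∫ ω, max (X 0 ω - v) 0 ∂P with hE
  have hclt : ∀ x : ℝ, Tendsto (fun k => P.real {ω | (√(n k : ℝ))⁻¹ *
      (∑ i ∈ Finset.range (n k), max (X i ω - v) 0 - n k * E) ≤ x}) atTop
      (𝓝 (normalCDF (x / √V))) := fun x =>
    (tendsto_cdf_of_iIndepFun (P := P) (X := fun i ω => max (X i ω - v) 0) h.memLp_excess_snd
      (h.iIndepFun_snd.comp (fun _ x => max (x - v) 0) fun _ => hem)
      (fun i => (h.identDistrib_snd i).comp hem) h.excess_variance_pos x).comp h.tendsto_size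
  have hφm : Measurable fun p : ℝ × ℝ => max (p.1 - v) 0 - max (p.2 - v) 0 := by fun_prop
  have hφL : ∀ k, MemLp (fun ω => max (Y k 0 ω - v) 0 - max (X 0 ω - v) 0) 2 P :=
    fun k => (h.memLp_excess_fst k).sub h.memLp_excess_snd
  have hφ2 : Tendsto (fun k => ∫ ω, (max (Y k 0 ω - v) 0 - max (X 0 ω - v) 0) ^ 2 ∂P) atTop
      (𝓝 0) := by
    refine squeeze_zero (fun k => integral_nonneg fun _ => sq_nonneg _) (fun k => ?_) h.tendsto_sq
    refine integral_mono (hφL k).integrable_sq (h.memLp_sub k).integrable_sq fun ω => ?_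
    have := abs_max_sub_max_le_abs (Y k 0 ω - v) (X 0 ω - v) 0
    rw [sub_sub_sub_cancel_right] at this
    exact sq_le_sq.2 this
  have hZ := h.tendstoInProb_sum (φ := fun _ p => max (p.1 - v) 0 - max (p.2 - v) 0)
    (fun _ => hφm) hφL (n := n) (a := fun k => (√(n k : ℝ))⁻¹) (by
    refine hφ2.congr fun k => ?_
    have hk : (0 : ℝ) < n k := by exact_mod_cast h.size_pos k
    rw [inv_pow, Real.sq_sqrt hk.le, ← mul_assoc, inv_mul_cancel₀ hk.ne', one_mul])
  have hB := TendstoInProb.of_tendsto (P := P) h.bias_excess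
  -- The second order remainder is at most the tight VaR error times the vanishing error of the
  -- empirical distribution function at `v`.
  have hR : TendstoInProb P (fun k ω => √(n k) * (1 - α) * (cvarEst α (n k) (fun i => Y k i ω) -
      (v + 1 / ((1 - α) * n k) * ∑ i ∈ Finset.range (n k), max (Y k i ω - v) 0))) 0 := by
    have h1 := (h.tendstoInProb_sqrt_varEst_mul h.tendstoInProb_empirical).map
      (f := fun x => |x|) continuous_abs.continuousAt
    rw [abs_zero] at h1
    refine h1.squeeze (Eventually.of_forall fun k ω => ?_)
    have hk := h.sqrt_size_pos k
    have h2 := abs_cvarEst_sub_le h.level_pos h.level_lt_one (h.size_pos k)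
      (fun i => Y k i ω) v
    rw [sub_zero, abs_mul, abs_of_pos (show 0 < √(n k : ℝ) * (1 - α) by positivity), abs_mul,
      abs_mul, abs_of_pos hk, mul_assoc, mul_assoc]
    refine mul_le_mul_of_nonneg_left ?_ hk.le
    refine (mul_le_mul_of_nonneg_left h2 hα.le).trans (le_of_eq ?_)
    field_simp
  have hsum := (hR.add hZ).add hB
  rw [add_zero, add_zero] at hsum
  have hcont : Continuous fun x => normalCDF (x / √V) :=
    continuous_normalCDF.comp (by fun_prop)
  set T : ℕ → Ω → ℝ := fun k ω => √(n k) * (1 - α) * (cvarEst α (n k) (fun i => Y k i ω) -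
    (v + 1 / (1 - α) * E)) with hT
  have hTS : TendstoInProb P (fun k ω => T k ω - (√(n k : ℝ))⁻¹ *
      (∑ i ∈ Finset.range (n k), max (X i ω - v) 0 - n k * E)) 0 := by
    refine hsum.congr (Eventually.of_forall fun k ω => ?_)
    have hk := h.sqrt_size_pos k
    have hk' : (n k : ℝ) = √(n k : ℝ) ^ 2 := (Real.sq_sqrt (Nat.cast_nonneg _)).symm
    have e1 : ∫ ω, (max (Y k 0 ω - v) 0 - max (X 0 ω - v) 0) ∂P =
        ∫ ω, max (Y k 0 ω - v) 0 ∂P - E :=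
      integral_sub ((h.memLp_excess_fst k).integrable (by norm_num))
        (h.memLp_excess_snd.integrable (by norm_num))
    simp only [hT]
    rw [e1, Finset.sum_sub_distrib]
    generalize ∑ i ∈ Finset.range (n k), max (Y k i ω - v) 0 = S₁
    generalize ∑ i ∈ Finset.range (n k), max (X i ω - v) 0 = S₂
    generalize ∫ ω, max (Y k 0 ω - v) 0 ∂P = E₁
    generalize cvarEst α (n k) (fun i => Y k i ω) = C
    rw [hk']
    rw [Real.sqrt_sq hk.le]
    generalize √(n k : ℝ) = r at *
    field_simp
    ring
  have hfin := tendsto_measureReal_of_slutsky (P := P) hclt hcont.continuousAt hTS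
    (TendstoInProb.of_tendsto (tendsto_const_nhds (x := t * (1 - α))))
    (E := fun k => {ω | T k ω ≤ t * (1 - α)})
    (Eventually.of_forall fun k ω hω => le_of_lt (show T k ω < t * (1 - α) from hω))
    (Eventually.of_forall fun k ω hω => hω)
  have e : t * (1 - α) / √V = t / (√V / (1 - α)) := by
    have := (Real.sqrt_pos.2 h.excess_variance_pos).ne'
    field_simp
  rw [e] at hfin
  refine hfin.congr fun k => ?_
  congr 1
  ext ω
  simp only [hT, Set.mem_ofPred_eq]
  rw [mul_right_comm, mul_le_mul_iff_left₀ hα]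

/-- The sample variance of the excesses is consistent. -/
lemma tendstoInProb_sampleVar (h : IsRegularArray P Y X n α v c) :
    TendstoInProb P (fun k ω => sampleVar (n k) (excess α (n k) fun i => Y k i ω))
      (Var[fun ω => max (X 0 ω - v) 0; P]) := by
  have hem : Measurable fun x : ℝ => max (x - v) 0 := by fun_prop
  have hm1 := h.tendstoInProb_mean hem (h.memLp_excess_snd.integrable (by norm_num))
    h.tendsto_size
  have hm2 := h.tendstoInProb_mean (hem.pow_const 2) h.memLp_excess_snd.integrable_sq
    h.tendsto_size
  set d : ℕ → Ω → ℕ → ℝ := fun k ω i =>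
    excess α (n k) (fun i => Y k i ω) i - max (X i ω - v) 0 with hd
  -- Both the observation and the threshold of the excess have changed, hence `d² ≤ 2 (Y - X)² + 2
  -- (w - v)²`. The first average has vanishing mean and the second term vanishes by consistency of
  -- the VaR estimate.
  have hA : TendstoInProb P (fun k ω => (∑ i ∈ Finset.range (n k), d k ω i ^ 2) / n k) 0 := by
    have hsq : ∀ k i, Integrable (fun ω => (Y k i ω - X i ω) ^ 2) P := fun k i =>
      ((h.identDistrib_comp k i (φ := fun p => (p.1 - p.2) ^ 2) (by fun_prop)).integrable_iff).2
        (h.memLp_sub k).integrable_sq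
    have h1 : TendstoInProb P (fun k ω =>
        (∑ i ∈ Finset.range (n k), (Y k i ω - X i ω) ^ 2) / n k) 0 := by
      refine .of_integral_abs (fun k => (integrable_finsetSum _ fun i _ => hsq k i).div_const _) ?_
      refine h.tendsto_sq.congr fun k => ?_
      have hk : (0 : ℝ) < n k := by exact_mod_cast h.size_pos k
      have e1 : ∀ ω, |(∑ i ∈ Finset.range (n k), (Y k i ω - X i ω) ^ 2) / n k| =
          (∑ i ∈ Finset.range (n k), (Y k i ω - X i ω) ^ 2) / n k := fun ω =>
        abs_of_nonneg (div_nonneg (Finset.sum_nonneg fun _ _ => sq_nonneg _) hk.le)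
      simp only [e1]
      rw [integral_div, integral_finsetSum _ fun i _ => hsq k i]
      have e2 : ∀ i, ∫ ω, (Y k i ω - X i ω) ^ 2 ∂P = ∫ ω, (Y k 0 ω - X 0 ω) ^ 2 ∂P := fun i =>
        (h.identDistrib_comp k i (φ := fun p => (p.1 - p.2) ^ 2) (by fun_prop)).integral_eq
      simp only [e2, Finset.sum_const, Finset.card_range, nsmul_eq_mul]
      field_simp
    have h2 := h1.map₂ h.tendstoInProb_varEst (f := fun a w => 2 * a + 2 * (w - v) ^ 2)
      (Continuous.continuousAt (by unfold Function.uncurry; fun_prop))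
    simp only [mul_zero, sub_self, ne_eq, OfNat.ofNat_ne_zero, not_false_eq_true, zero_pow,
      add_zero] at h2
    refine h2.squeeze (Eventually.of_forall fun k ω => ?_)
    have hk : (0 : ℝ) < n k := by exact_mod_cast h.size_pos k
    rw [sub_zero, abs_of_nonneg (div_nonneg (Finset.sum_nonneg fun _ _ => sq_nonneg _) hk.le),
      div_le_iff₀ hk, add_mul, mul_assoc 2 (_ / _), div_mul_cancel₀ _ hk.ne']
    have e3 : 2 * (varEst α (n k) (fun i => Y k i ω) - v) ^ 2 * n k =
        ∑ i ∈ Finset.range (n k), 2 * (varEst α (n k) (fun i => Y k i ω) - v) ^ 2 := by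
      rw [Finset.sum_const, Finset.card_range, nsmul_eq_mul, mul_comm]
    rw [e3, Finset.mul_sum, ← Finset.sum_add_distrib]
    refine Finset.sum_le_sum fun i _ => ?_
    simp only [hd, excess]
    set w := varEst α (n k) fun i => Y k i ω
    have h3 := abs_max_sub_max_le_abs (Y k i ω - w) (X i ω - v) 0
    have h4 := sq_le_sq.2 h3
    nlinarith [sq_nonneg ((Y k i ω - X i ω) + (w - v))]
  have hsqrt := hA.map (f := fun x => √x) Real.continuous_sqrt.continuousAt
  rw [Real.sqrt_zero] at hsqrt
  set E₁ := ∫ ω, max (X 0 ω - v) 0 ∂P with hE₁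
  set E₂ := ∫ ω, max (X 0 ω - v) 0 ^ 2 ∂P with hE₂
  have hX1 : TendstoInProb P (fun k ω =>
      (∑ i ∈ Finset.range (n k), excess α (n k) (fun i => Y k i ω) i) / n k) E₁ := by
    have h1 : TendstoInProb P (fun k ω => (∑ i ∈ Finset.range (n k), d k ω i) / n k) 0 := by
      refine hsqrt.squeeze (Eventually.of_forall fun k ω => ?_)
      have h2 := abs_mean_mul_le (n k) (d k ω) fun _ => 1
      have hk : (0 : ℝ) < n k := by exact_mod_cast h.size_pos k
      simp only [mul_one, one_pow, Finset.sum_const, Finset.card_range, nsmul_eq_mul,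
        div_self hk.ne', Real.sqrt_one] at h2
      rwa [sub_zero]
    have h2 := hm1.add h1
    rw [add_zero] at h2
    refine h2.congr (Eventually.of_forall fun k ω => ?_)
    rw [← add_div, ← Finset.sum_add_distrib]
    simp [hd]
  have hX2 : TendstoInProb P (fun k ω =>
      (∑ i ∈ Finset.range (n k), excess α (n k) (fun i => Y k i ω) i ^ 2) / n k) E₂ := by
    -- The cross term in the expansion of the squared excess, controlled by the Cauchy–Schwarz
    -- inequality.
    have h1 : TendstoInProb P (fun k ω =>
        (∑ i ∈ Finset.range (n k), d k ω i * max (X i ω - v) 0) / n k) 0 := by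
      have h2 := hsqrt.map₂ hm2 (f := fun a b => a * √b)
        (Continuous.continuousAt (by unfold Function.uncurry; fun_prop))
      rw [zero_mul] at h2
      refine h2.squeeze (Eventually.of_forall fun k ω => ?_)
      rw [sub_zero]
      exact abs_mean_mul_le _ _ _
    have h2 := (hm2.add hA).add (h1.map (f := fun x => 2 * x) (by fun_prop))
    rw [mul_zero, add_zero, add_zero] at h2
    refine h2.congr (Eventually.of_forall fun k ω => ?_)
    rw [← add_div, mul_div_assoc', ← add_div, Finset.mul_sum, ← Finset.sum_add_distrib,
      ← Finset.sum_add_distrib]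
    congr 1
    refine Finset.sum_congr rfl fun i _ => ?_
    simp only [hd]; ring
  have hratio : Tendsto (fun k => (n k : ℝ) / ((n k : ℝ) - 1)) atTop (𝓝 1) := by
    have h1 : Tendsto (fun x : ℝ => x / (x - 1)) atTop (𝓝 1) := by
      have h2 : Tendsto (fun x : ℝ => (1 - x⁻¹)⁻¹) atTop (𝓝 (1 - 0)⁻¹) :=
        (tendsto_inv_atTop_zero.const_sub 1).inv₀ (by norm_num)
      rw [sub_zero, inv_one] at h2
      refine h2.congr' ?_
      filter_upwards [eventually_gt_atTop 1] with x hx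
      have : x - 1 ≠ 0 := by linarith
      field_simp
    exact h1.comp (tendsto_natCast_atTop_atTop.comp h.tendsto_size)
  have hfin := (hX2.map₂ hX1 (f := fun a b => a - b ^ 2)
    (Continuous.continuousAt (by unfold Function.uncurry; fun_prop))).mul
    (TendstoInProb.of_tendsto (P := P) hratio)
  have hvar : (E₂ - E₁ ^ 2) * 1 = Var[fun ω => max (X 0 ω - v) 0; P] := by
    rw [variance_eq_sub h.memLp_excess_snd, mul_one]; rfl
  rw [hvar] at hfin
  exact hfin.congr (Eventually.of_forall fun k ω => sampleVar_eq (h.size_pos k) _)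

end IsRegularArray

end RegularArray

/-! ### Single-level intervals of one sample -/

/-- The single-level interval for VaR of a sample of size `N`. -/
def sampleCIV (α β b : ℝ) (N : ℕ) (y : ℕ → ℝ) : Set ℝ :=
  Set.Icc (varEst α N y + tQuantile (β / 2) (N - 1) * sigmaV α b N y / √(N : ℝ))
    (varEst α N y + tQuantile (1 - β / 2) (N - 1) * sigmaV α b N y / √(N : ℝ))

/-- The single-level interval for CVaR of a sample of size `N`. -/
def sampleCIC (α β : ℝ) (N : ℕ) (y : ℕ → ℝ) : Set ℝ :=
  Set.Icc (cvarEst α N y + tQuantile (β / 2) (N - 1) * sigmaC α N y / √(N : ℝ))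
    (cvarEst α N y + tQuantile (1 - β / 2) (N - 1) * sigmaC α N y / √(N : ℝ))

namespace IsRegularArray

variable {Ω : Type*} [MeasurableSpace Ω] {P : Measure Ω} {Y : ℕ → ℕ → Ω → ℝ} {X : ℕ → Ω → ℝ}
  {n : ℕ → ℕ} {α v c : ℝ} [IsProbabilityMeasure P]

theorem tendsto_sampleCIV (h : IsRegularArray P Y X n α v c) {b : ℕ → ℝ} (hb : ∀ k, 0 < b k)
    (hb0 : Tendsto b atTop (𝓝 0)) (hnb : Tendsto (fun k => (n k : ℝ) * b k) atTop atTop)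
    {β : ℝ} (hβ0 : 0 < β) (hβ1 : β < 1) :
    Tendsto (fun k => P.real {ω | v ∈ sampleCIV α β (b k) (n k) fun i => Y k i ω}) atTop
      (𝓝 (1 - β)) := by
  have hα0 := h.level_pos
  have hα1 := h.level_lt_one
  have hs : 0 < √(α * (1 - α)) := Real.sqrt_pos.2 (mul_pos hα0 (by linarith))
  have hkde := tendstoInProb_kde h.meas_fst h.iIndepFun_fst
    (ν := fun k => P.map (Y k 0))
    (fun k => Measure.isProbabilityMeasure_map (h.meas_fst k 0).aemeasurable) h.map_fst
    h.noAtoms_fst h.density h.density_pos hα0 hα1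
    (h.tendsto_cdf_fst.congr fun k => by
      rw [map_measureReal_apply (h.meas_fst k 0) measurableSet_Iic]; rfl)
    hb hb0 h.tendsto_size hnb h.tendstoInProb_varEst
  have hsig := hkde.map (f := fun x => √(α * (1 - α)) / x)
    (continuousAt_const.div continuousAt_id h.density_pos.ne')
  exact tendsto_coverage (est := fun k ω => varEst α (n k) fun i => Y k i ω)
    (sig := fun k ω => sigmaV α (b k) (n k) fun i => Y k i ω) h.measurable_varEst
    (fun k => (continuous_sigmaV hα0 hα1 (hb k) (h.size_pos k)).measurable.comp
      (measurable_pi_iff.2 (h.meas_fst k)))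
    (Eventually.of_forall fun k ω => div_nonneg hs.le (kde_pos (hb k) (h.size_pos k) _ _).le)
    (div_pos hs h.density_pos) h.tendsto_size h.tendsto_cdf_varEst hsig hβ0 hβ1

theorem tendsto_sampleCIC (h : IsRegularArray P Y X n α v c) {β : ℝ} (hβ0 : 0 < β) (hβ1 : β < 1) :
    Tendsto (fun k => P.real {ω | v + 1 / (1 - α) * ∫ ω, max (X 0 ω - v) 0 ∂P ∈
      sampleCIC α β (n k) fun i => Y k i ω}) atTop (𝓝 (1 - β)) := by
  have hα0 := h.level_pos
  have hα1 := h.level_lt_one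
  have hα : 0 < 1 - α := by linarith
  have hs := Real.sqrt_pos.2 h.excess_variance_pos
  have hsig := h.tendstoInProb_sampleVar.map (f := fun x => √x / (1 - α))
    (Continuous.continuousAt (by fun_prop))
  exact tendsto_coverage (est := fun k ω => cvarEst α (n k) fun i => Y k i ω)
    (sig := fun k ω => sigmaC α (n k) fun i => Y k i ω)
    (fun k => (continuous_cvarEst hα0 hα1 (h.size_pos k)).measurable.comp
      (measurable_pi_iff.2 (h.meas_fst k)))
    (fun k => (continuous_sigmaC hα0 hα1 (h.size_pos k)).measurable.comp
      (measurable_pi_iff.2 (h.meas_fst k)))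
    (Eventually.of_forall fun k ω => div_nonneg (Real.sqrt_nonneg _) hα.le)
    (div_pos hs hα) h.tendsto_size h.tendsto_cdf_cvarEst hsig hβ0 hβ1

end IsRegularArray

/-! ### Laws and moments of the nested sample. -/

section Nested

variable {Θ Ξ Ω : Type*} [MeasurableSpace Θ] [MeasurableSpace Ξ] [MeasurableSpace Ω]
  {belief : Measure Θ} {κ : Kernel Θ Ξ} {h : Θ → Ξ → ℝ} {P : Measure Ω} {θ : ℕ → Ω → Θ}
  {ξ : ℕ → ℕ → Ω → Ξ}

lemma measurable_meanResponse [IsSFiniteKernel κ] (hh : Measurable (Function.uncurry h)) :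
    Measurable (meanResponse κ h) :=
  (StronglyMeasurable.integral_kernel_prod_right hh.stronglyMeasurable).measurable

namespace IsNestedSample

/-- The joint law of a scenario and finitely many of its noises. -/
lemma law_finset [IsMarkovKernel κ] (hs : IsNestedSample belief κ P θ ξ) (i : ℕ) (s : Finset ℕ)
    {A : Set Θ} (hA : MeasurableSet A) {B : ℕ → Set Ξ} (hB : ∀ j, MeasurableSet (B j)) :
    P (θ i ⁻¹' A ∩ ⋂ j ∈ s, ξ i j ⁻¹' B j) = ∫⁻ t in A, ∏ j ∈ s, κ t (B j) ∂belief := by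
  classical
  -- Padding with the whole space reduces an arbitrary finite index set to an initial segment; the
  -- added factors are one because the kernel is Markov.
  set B' : ℕ → Set Ξ := fun j => if j ∈ s then B j else Set.univ with hB'
  have hBm : ∀ j, MeasurableSet (B' j) := fun j => by
    simp only [hB']; split_ifs; exacts [hB j, .univ]
  have hsub : s ⊆ Finset.range (s.sup id + 1) := fun j hj =>
    Finset.mem_range.2 (Nat.lt_succ_of_le (Finset.le_sup (f := id) hj))
  have h1 := hs.law i (s.sup id + 1) A B' hA hBm
  have e1 : ⋂ j ∈ Finset.range (s.sup id + 1), ξ i j ⁻¹' B' j = ⋂ j ∈ s, ξ i j ⁻¹' B j := by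
    ext ω
    simp only [Set.mem_iInter, Set.mem_preimage, hB']
    constructor
    · intro hω j hj
      have := hω j (hsub hj)
      rwa [if_pos hj] at this
    · intro hω j _
      split_ifs with hj
      exacts [hω j hj, trivial]
  have e2 : ∀ t, ∏ j ∈ Finset.range (s.sup id + 1), κ t (B' j) = ∏ j ∈ s, κ t (B j) := by
    intro t
    rw [← Finset.prod_subset hsub (f := fun j => κ t (B' j)) fun j _ hj => by
      simp only [hB', if_neg hj, measure_univ]]
    exact Finset.prod_congr rfl fun j hj => by simp only [hB', if_pos hj]
  rw [e1] at h1
  simpa only [e2] using h1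

lemma measurable_pair (hs : IsNestedSample belief κ P θ ξ) (i : ℕ) :
    Measurable fun ω => (θ i ω, fun j => ξ i j ω) :=
  (hs.measurable_scenario i).prodMk (measurable_pi_iff.2 (hs.measurable_noise i))

/-- The scenarios, with their noises, are identically distributed. -/
lemma map_pair [IsMarkovKernel κ] [IsProbabilityMeasure P] (hs : IsNestedSample belief κ P θ ξ)
    (i : ℕ) : P.map (fun ω => (θ i ω, fun j => ξ i j ω)) =
      P.map (fun ω => (θ 0 ω, fun j => ξ 0 j ω)) := by
  have hfin := Measure.isProbabilityMeasure_map (μ := P) (hs.measurable_pair i).aemeasurable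
  have hfin0 := Measure.isProbabilityMeasure_map (μ := P) (hs.measurable_pair 0).aemeasurable
  have hgen : MeasurableSpace.generateFrom (squareCylinders fun _ : ℕ =>
      {s : Set Ξ | MeasurableSet s}) = MeasurableSpace.pi :=
    generateFrom_squareCylinders
  -- Rectangles of a measurable set and a finite-dimensional cylinder form a generating π-system,
  -- and `law_finset` gives them a mass independent of `i`.
  refine ext_of_generate_finite _ (generateFrom_eq_prod
    (MeasurableSpace.generateFrom_measurableSet (α := Θ)) hgen
    isCountablySpanning_measurableSet ⟨fun _ => Set.univ, fun _ => ?_, Set.iUnion_const _⟩).symm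
    (MeasurableSpace.isPiSystem_measurableSet.prod (isPiSystem_squareCylinders
      (fun _ => MeasurableSpace.isPiSystem_measurableSet) fun _ => MeasurableSet.univ)) ?_
    (by simp only [measure_univ])
  · exact ⟨∅, fun _ => Set.univ, by simp, by simp⟩
  · rintro _ ⟨A, hA, _, ⟨s, B, hB, rfl⟩, rfl⟩
    have hB' : ∀ j, MeasurableSet (B j) := fun j => hB j trivial
    have key : ∀ i, P.map (fun ω => (θ i ω, fun j => ξ i j ω)) (A ×ˢ (s : Set ℕ).pi B) =
        ∫⁻ t in A, ∏ j ∈ s, κ t (B j) ∂belief := by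
      intro i
      rw [Measure.map_apply (hs.measurable_pair i)
        (MeasurableSet.prod hA (.pi (Set.to_countable _) fun j _ => hB' j)),
        ← hs.law_finset i s hA hB']
      congr 1
      ext ω
      simp [Set.mem_pi]
    rw [key, key]

lemma identDistrib_comp [IsMarkovKernel κ] [IsProbabilityMeasure P]
    (hs : IsNestedSample belief κ P θ ξ) {β : Type*} [MeasurableSpace β] {Ψ : Θ × (ℕ → Ξ) → β}
    (hΨ : Measurable Ψ) (i : ℕ) : IdentDistrib (fun ω => Ψ (θ i ω, fun j => ξ i j ω))
      (fun ω => Ψ (θ 0 ω, fun j => ξ 0 j ω)) P P :=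
  (IdentDistrib.mk (hs.measurable_pair i).aemeasurable (hs.measurable_pair 0).aemeasurable
    (hs.map_pair i)).comp hΨ

lemma map_scenario [IsMarkovKernel κ] [IsFiniteMeasure belief]
    (hs : IsNestedSample belief κ P θ ξ) (i : ℕ) : P.map (θ i) = belief := by
  ext A hA
  rw [Measure.map_apply (hs.measurable_scenario i) hA]
  simpa using hs.law_finset i ∅ hA (B := fun _ => Set.univ) fun _ => .univ

/-- The joint law of a scenario and one of its noises. -/
lemma map_scenario_noise [IsMarkovKernel κ] [IsFiniteMeasure belief] [IsProbabilityMeasure P]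
    (hs : IsNestedSample belief κ P θ ξ) (i j : ℕ) :
    P.map (fun ω => (θ i ω, ξ i j ω)) = belief ⊗ₘ κ := by
  have hm := (hs.measurable_scenario i).prodMk (hs.measurable_noise i j)
  have hfin := Measure.isProbabilityMeasure_map (μ := P) hm.aemeasurable
  refine Measure.ext_prod fun {A B} hA hB => ?_
  rw [Measure.map_apply hm (hA.prod hB), Measure.compProd_apply_prod hA hB]
  simpa [Set.mk_preimage_prod] using hs.law_finset i {j} hA (B := fun _ => B) fun _ => hB

/-- The joint law of a scenario and two of its noises. -/
lemma map_scenario_noise₂ [IsMarkovKernel κ] [IsFiniteMeasure belief] [IsProbabilityMeasure P]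
    (hs : IsNestedSample belief κ P θ ξ) (i : ℕ) {j k : ℕ} (hjk : j ≠ k) :
    P.map (fun ω => (θ i ω, ξ i j ω, ξ i k ω)) = belief ⊗ₘ (κ ×ₖ κ) := by
  have hm := (hs.measurable_scenario i).prodMk
    ((hs.measurable_noise i j).prodMk (hs.measurable_noise i k))
  have hfin := Measure.isProbabilityMeasure_map (μ := P) hm.aemeasurable
  refine Measure.ext_prod₃ fun {A B C} hA hB hC => ?_
  rw [Measure.map_apply hm (hA.prod (hB.prod hC)), Measure.compProd_apply_prod hA (hB.prod hC)]
  have h1 := hs.law_finset i {j, k} hA (B := fun l => if l = j then B else C) fun l => by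
    split_ifs; exacts [hB, hC]
  simpa [Set.mk_preimage_prod, Finset.prod_pair hjk, hjk.symm, Kernel.prod_apply_prod] using h1

end IsNestedSample

/-! ### Moments -/

section Moments

lemma FiniteSecondMoment.ae_memLp (hh : Measurable (Function.uncurry h))
    (hm : FiniteSecondMoment belief κ h) : ∀ᵐ t ∂belief, MemLp (h t) 2 (κ t) := by
  filter_upwards [hm.1] with t ht
  exact (memLp_two_iff_integrable_sq (hh.comp measurable_prodMk_left).aestronglyMeasurable).2 ht

variable [IsProbabilityMeasure belief] [IsMarkovKernel κ]

lemma FiniteSecondMoment.memLp (hh : Measurable (Function.uncurry h))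
    (hm : FiniteSecondMoment belief κ h) : MemLp (Function.uncurry h) 2 (belief ⊗ₘ κ) := by
  rw [memLp_two_iff_integrable_sq hh.aestronglyMeasurable,
    Measure.integrable_compProd_iff (hh.pow_const 2).aestronglyMeasurable]
  refine ⟨hm.1, hm.2.congr (ae_of_all _ fun t => ?_)⟩
  simp [Function.uncurry]

/-- Conditional Jensen inequality, read off from the nonnegativity of the conditional variance. -/
lemma FiniteSecondMoment.memLp_meanResponse (hh : Measurable (Function.uncurry h))
    (hm : FiniteSecondMoment belief κ h) : MemLp (meanResponse κ h) 2 belief := by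
  have hH := measurable_meanResponse (κ := κ) hh
  rw [memLp_two_iff_integrable_sq hH.aestronglyMeasurable]
  refine hm.2.mono' (hH.pow_const 2).aestronglyMeasurable ?_
  filter_upwards [hm.ae_memLp hh] with t ht
  rw [Real.norm_of_nonneg (sq_nonneg _)]
  have h1 := variance_eq_sub ht
  have h2 := variance_nonneg (h t) (κ t)
  rw [h1] at h2
  change 0 ≤ (∫ x, h t x ^ 2 ∂κ t) - meanResponse κ h t ^ 2 at h2
  linarith

/-- The deviation of the response from its conditional mean. -/
def deviation (κ : Kernel Θ Ξ) (h : Θ → Ξ → ℝ) (t : Θ) (x : Ξ) : ℝ := h t x - meanResponse κ h t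

lemma measurable_deviation (hh : Measurable (Function.uncurry h)) :
    Measurable (Function.uncurry (deviation κ h)) :=
  hh.sub ((measurable_meanResponse hh).comp measurable_fst)

lemma FiniteSecondMoment.memLp_deviation (hh : Measurable (Function.uncurry h))
    (hm : FiniteSecondMoment belief κ h) :
    MemLp (Function.uncurry (deviation κ h)) 2 (belief ⊗ₘ κ) := by
  have h1 : MemLp (fun z : Θ × Ξ => meanResponse κ h z.1) 2 (belief ⊗ₘ κ) := by
    have := hm.memLp_meanResponse hh
    rw [← Measure.fst_compProd belief κ] at this
    exact this.comp_measurePreserving (measurable_fst.measurePreserving _)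
  exact (hm.memLp hh).sub h1

lemma FiniteSecondMoment.integral_deviation (hh : Measurable (Function.uncurry h))
    (hm : FiniteSecondMoment belief κ h) : ∀ᵐ t ∂belief, ∫ x, deviation κ h t x ∂κ t = 0 := by
  filter_upwards [hm.ae_memLp hh] with t ht
  simp only [deviation]
  rw [integral_sub (ht.integrable (by norm_num)) (integrable_const _)]
  simp [meanResponse]

variable [IsProbabilityMeasure P]

namespace IsNestedSample

lemma memLp_deviation (hs : IsNestedSample belief κ P θ ξ) (hh : Measurable (Function.uncurry h))
    (hm : FiniteSecondMoment belief κ h) (i j : ℕ) :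
    MemLp (fun ω => deviation κ h (θ i ω) (ξ i j ω)) 2 P := by
  have hmap : MeasurePreserving (fun ω => (θ i ω, ξ i j ω)) P (belief ⊗ₘ κ) :=
    ⟨(hs.measurable_scenario i).prodMk (hs.measurable_noise i j), hs.map_scenario_noise i j⟩
  exact (hm.memLp_deviation hh).comp_measurePreserving hmap

lemma integral_deviation_sq (hs : IsNestedSample belief κ P θ ξ)
    (hh : Measurable (Function.uncurry h)) (i j : ℕ) :
    ∫ ω, deviation κ h (θ i ω) (ξ i j ω) ^ 2 ∂P =
      ∫ z, deviation κ h z.1 z.2 ^ 2 ∂(belief ⊗ₘ κ) := by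
  rw [← hs.map_scenario_noise i j, integral_map
    ((hs.measurable_scenario i).prodMk (hs.measurable_noise i j)).aemeasurable]
  exact ((measurable_deviation hh).pow_const 2).aestronglyMeasurable

/-- The deviation is uncorrelated with the scenario. -/
lemma integral_deviation_mul (hs : IsNestedSample belief κ P θ ξ)
    (hh : Measurable (Function.uncurry h)) (hm : FiniteSecondMoment belief κ h) (i j : ℕ)
    {g : Θ → ℝ} (hg : Measurable g) {C : ℝ} (hC : ∀ t, |g t| ≤ C) :
    ∫ ω, g (θ i ω) * deviation κ h (θ i ω) (ξ i j ω) ∂P = 0 := by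
  have hf : Measurable fun z : Θ × Ξ => g z.1 * deviation κ h z.1 z.2 :=
    (hg.comp measurable_fst).mul (measurable_deviation hh)
  have hint : Integrable (fun z : Θ × Ξ => g z.1 * deviation κ h z.1 z.2) (belief ⊗ₘ κ) :=
    ((hm.memLp_deviation hh).integrable (by norm_num)).bdd_mul (c := C)
      (hg.comp measurable_fst).aestronglyMeasurable (ae_of_all _ fun z => hC z.1)
  have e := integral_map (μ := P) (φ := fun ω => (θ i ω, ξ i j ω))
    ((hs.measurable_scenario i).prodMk (hs.measurable_noise i j)).aemeasurable
    (f := fun z : Θ × Ξ => g z.1 * deviation κ h z.1 z.2) hf.aestronglyMeasurable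
  rw [← e, hs.map_scenario_noise i j, Measure.integral_compProd hint]
  refine integral_eq_zero_of_ae ?_
  filter_upwards [hm.integral_deviation hh] with t ht
  simp only [integral_const_mul, ht, mul_zero, Pi.zero_apply]

/-- The deviations of one scenario are uncorrelated. -/
lemma integral_deviation_mul_deviation (hs : IsNestedSample belief κ P θ ξ)
    (hh : Measurable (Function.uncurry h)) (hm : FiniteSecondMoment belief κ h) (i : ℕ) {j k : ℕ}
    (hjk : j ≠ k) :
    ∫ ω, deviation κ h (θ i ω) (ξ i j ω) * deviation κ h (θ i ω) (ξ i k ω) ∂P = 0 := by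
  have hφ := (hs.measurable_scenario i).prodMk
    ((hs.measurable_noise i j).prodMk (hs.measurable_noise i k))
  have hd := measurable_deviation (κ := κ) hh
  have hf : Measurable fun z : Θ × Ξ × Ξ => deviation κ h z.1 z.2.1 * deviation κ h z.1 z.2.2 :=
    (hd.comp (measurable_fst.prodMk (measurable_fst.comp measurable_snd))).mul
      (hd.comp (measurable_fst.prodMk (measurable_snd.comp measurable_snd)))
  have hint := (hs.memLp_deviation hh hm i j).integrable_mul (hs.memLp_deviation hh hm i k)
  have hint' : Integrable (fun z : Θ × Ξ × Ξ => deviation κ h z.1 z.2.1 * deviation κ h z.1 z.2.2)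
      (belief ⊗ₘ (κ ×ₖ κ)) := by
    rw [← hs.map_scenario_noise₂ i hjk]
    exact (integrable_map_measure hf.aestronglyMeasurable hφ.aemeasurable).2 hint
  have e := integral_map (μ := P) hφ.aemeasurable (f := fun z : Θ × Ξ × Ξ =>
    deviation κ h z.1 z.2.1 * deviation κ h z.1 z.2.2) hf.aestronglyMeasurable
  rw [← e, hs.map_scenario_noise₂ i hjk, Measure.integral_compProd hint']
  refine integral_eq_zero_of_ae ?_
  filter_upwards [hm.integral_deviation hh] with t ht
  simp only [Kernel.prod_apply]
  rw [integral_prod_mul (fun x => deviation κ h t x) (fun x => deviation κ h t x), ht, zero_mul,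
    Pi.zero_apply]

/-- The second moment of the sum of the deviations of one scenario. -/
lemma integral_sum_deviation_sq (hs : IsNestedSample belief κ P θ ξ)
    (hh : Measurable (Function.uncurry h)) (hm : FiniteSecondMoment belief κ h) (i M : ℕ) :
    ∫ ω, (∑ j ∈ Finset.range M, deviation κ h (θ i ω) (ξ i j ω)) ^ 2 ∂P =
      M * ∫ z, deviation κ h z.1 z.2 ^ 2 ∂(belief ⊗ₘ κ) := by
  have hint : ∀ j k, Integrable (fun ω => deviation κ h (θ i ω) (ξ i j ω) *
      deviation κ h (θ i ω) (ξ i k ω)) P := fun j k =>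
    (hs.memLp_deviation hh hm i j).integrable_mul (hs.memLp_deviation hh hm i k)
  simp only [sq (∑ j ∈ Finset.range M, _), Finset.sum_mul_sum]
  rw [integral_finsetSum _ fun j _ => integrable_finsetSum _ fun k _ => hint j k]
  have : ∀ j ∈ Finset.range M, ∫ ω, ∑ k ∈ Finset.range M, deviation κ h (θ i ω) (ξ i j ω) *
      deviation κ h (θ i ω) (ξ i k ω) ∂P = ∫ z, deviation κ h z.1 z.2 ^ 2 ∂(belief ⊗ₘ κ) := by
    intro j hj
    rw [integral_finsetSum _ fun k _ => hint j k, Finset.sum_eq_single_of_mem j hj fun k _ hk =>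
      hs.integral_deviation_mul_deviation hh hm i hk.symm, ← hs.integral_deviation_sq hh i j]
    simp only [sq]
  rw [Finset.sum_congr rfl this]
  simp

end IsNestedSample

end Moments

end Nested

/-! ### Inner averages and inner sample variances. -/

section Inner

variable {Θ Ξ Ω : Type*} [MeasurableSpace Θ] [MeasurableSpace Ξ] [MeasurableSpace Ω]
  {belief : Measure Θ} {κ : Kernel Θ Ξ} {h : Θ → Ξ → ℝ} {P : Measure Ω} {θ : ℕ → Ω → Θ}
  {ξ : ℕ → ℕ → Ω → Ξ}

lemma innerMean_response_sub {M : ℕ} (hM : 0 < M) (i : ℕ) (ω : Ω) :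
    innerMean M (response h θ ξ ω) i - meanResponse κ h (θ i ω) =
      (∑ j ∈ Finset.range M, deviation κ h (θ i ω) (ξ i j ω)) / M := by
  have : (M : ℝ) ≠ 0 := by exact_mod_cast hM.ne'
  simp only [innerMean, sampleMean, response, deviation, Finset.sum_sub_distrib, Finset.sum_const,
    Finset.card_range, nsmul_eq_mul]
  field_simp

/-- The sample variance is at most the mean square deviation from any point. -/
lemma sampleVar_le {M : ℕ} (hM : 0 < M) (y : ℕ → ℝ) (c : ℝ) :
    sampleVar M y ≤ (∑ j ∈ Finset.range M, (y j - c) ^ 2) / ((M : ℝ) - 1) := by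
  have hM' : (1 : ℝ) ≤ M := by exact_mod_cast hM
  have h0 : (M : ℝ) ≠ 0 := by linarith
  refine div_le_div_of_nonneg_right ?_ (by linarith)
  have h1 : ∑ j ∈ Finset.range M, (y j - sampleMean M y) = 0 := by
    simp only [Finset.sum_sub_distrib, Finset.sum_const, Finset.card_range, nsmul_eq_mul,
      sampleMean]
    field_simp
    ring
  have h2 : ∑ j ∈ Finset.range M, (y j - c) ^ 2 = (∑ j ∈ Finset.range M,
      (y j - sampleMean M y) ^ 2) + 2 * (sampleMean M y - c) *
        (∑ j ∈ Finset.range M, (y j - sampleMean M y)) +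
        M * (sampleMean M y - c) ^ 2 := by
    have : ∀ j, (y j - c) ^ 2 = (y j - sampleMean M y) ^ 2 +
        2 * (sampleMean M y - c) * (y j - sampleMean M y) + (sampleMean M y - c) ^ 2 := by
      intro j; ring
    simp only [this, Finset.sum_add_distrib, ← Finset.mul_sum, Finset.sum_const,
      Finset.card_range, nsmul_eq_mul]
  rw [h2, h1, mul_zero, add_zero]
  linarith [mul_nonneg (Nat.cast_nonneg M : (0 : ℝ) ≤ M) (sq_nonneg (sampleMean M y - c))]

namespace IsNestedSample

lemma measurable_response (hs : IsNestedSample belief κ P θ ξ)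
    (hh : Measurable (Function.uncurry h)) (i j : ℕ) :
    Measurable fun ω => response h θ ξ ω i j :=
  hh.comp ((hs.measurable_scenario i).prodMk (hs.measurable_noise i j))

lemma measurable_innerMean (hs : IsNestedSample belief κ P θ ξ)
    (hh : Measurable (Function.uncurry h)) (M i : ℕ) :
    Measurable fun ω => innerMean M (response h θ ξ ω) i := by
  have := hs.measurable_response hh i
  unfold innerMean sampleMean
  fun_prop

lemma measurable_sampleVar (hs : IsNestedSample belief κ P θ ξ)
    (hh : Measurable (Function.uncurry h)) (M i : ℕ) :
    Measurable fun ω => sampleVar M (response h θ ξ ω i) :=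
  (continuous_sampleVar M).measurable.comp (measurable_pi_iff.2 (hs.measurable_response hh i))

variable [IsProbabilityMeasure belief] [IsMarkovKernel κ] [IsProbabilityMeasure P]

lemma integral_innerMean_sub_sq (hs : IsNestedSample belief κ P θ ξ)
    (hh : Measurable (Function.uncurry h)) (hm : FiniteSecondMoment belief κ h) (i : ℕ) {M : ℕ}
    (hM : 0 < M) :
    ∫ ω, (innerMean M (response h θ ξ ω) i - meanResponse κ h (θ i ω)) ^ 2 ∂P =
      (∫ z, deviation κ h z.1 z.2 ^ 2 ∂(belief ⊗ₘ κ)) / M := by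
  have : (M : ℝ) ≠ 0 := by exact_mod_cast hM.ne'
  simp only [innerMean_response_sub hM, div_pow]
  rw [integral_div, hs.integral_sum_deviation_sq hh hm]
  field_simp

lemma memLp_meanResponse (hs : IsNestedSample belief κ P θ ξ)
    (hh : Measurable (Function.uncurry h)) (hm : FiniteSecondMoment belief κ h) (i : ℕ) :
    MemLp (fun ω => meanResponse κ h (θ i ω)) 2 P :=
  (hm.memLp_meanResponse hh).comp_measurePreserving
    ⟨hs.measurable_scenario i, hs.map_scenario i⟩

lemma memLp_innerMean (hs : IsNestedSample belief κ P θ ξ)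
    (hh : Measurable (Function.uncurry h)) (hm : FiniteSecondMoment belief κ h) (M i : ℕ) :
    MemLp (fun ω => innerMean M (response h θ ξ ω) i) 2 P := by
  have h1 : ∀ j, MemLp (fun ω => response h θ ξ ω i j) 2 P := fun j =>
    (hm.memLp hh).comp_measurePreserving (f := fun ω => (θ i ω, ξ i j ω))
      ⟨(hs.measurable_scenario i).prodMk (hs.measurable_noise i j), hs.map_scenario_noise i j⟩
  have h2 := (memLp_finsetSum (Finset.range M) fun j _ => h1 j).const_mul ((M : ℝ)⁻¹)
  refine h2.congr_norm (hs.measurable_innerMean hh M i).aestronglyMeasurable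
    (ae_of_all _ fun ω => ?_)
  simp only [innerMean, sampleMean, div_eq_inv_mul]

/-- The sample variance is bounded by the square deviations from the true conditional mean; the
factor `2` bounds `M / (M - 1)`. -/
lemma integral_sampleVar_le (hs : IsNestedSample belief κ P θ ξ)
    (hh : Measurable (Function.uncurry h)) (hm : FiniteSecondMoment belief κ h) (i : ℕ) {M : ℕ}
    (hM : 2 ≤ M) :
    Integrable (fun ω => sampleVar M (response h θ ξ ω i)) P ∧
      ∫ ω, sampleVar M (response h θ ξ ω i) ∂P ≤
        2 * ∫ z, deviation κ h z.1 z.2 ^ 2 ∂(belief ⊗ₘ κ) := by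
  have hM' : (2 : ℝ) ≤ M := by exact_mod_cast hM
  have hle : ∀ ω, sampleVar M (response h θ ξ ω i) ≤
      (∑ j ∈ Finset.range M, deviation κ h (θ i ω) (ξ i j ω) ^ 2) / ((M : ℝ) - 1) := fun ω =>
    sampleVar_le (by lia) _ _
  have hint : Integrable (fun ω => (∑ j ∈ Finset.range M, deviation κ h (θ i ω) (ξ i j ω) ^ 2) /
      ((M : ℝ) - 1)) P :=
    (integrable_finsetSum _ fun j _ => (hs.memLp_deviation hh hm i j).integrable_sq).div_const _
  have h1 : Integrable (fun ω => sampleVar M (response h θ ξ ω i)) P := by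
    refine hint.mono' (hs.measurable_sampleVar hh M i).aestronglyMeasurable
      (ae_of_all _ fun ω => ?_)
    rw [Real.norm_of_nonneg (sampleVar_nonneg (by lia) _)]
    exact hle ω
  refine ⟨h1, (integral_mono h1 hint hle).trans ?_⟩
  rw [integral_div, integral_finsetSum _ fun j _ => (hs.memLp_deviation hh hm i j).integrable_sq]
  simp only [hs.integral_deviation_sq hh, Finset.sum_const, Finset.card_range, nsmul_eq_mul]
  have h0 : 0 ≤ ∫ z, deviation κ h z.1 z.2 ^ 2 ∂(belief ⊗ₘ κ) :=
    integral_nonneg fun _ => sq_nonneg _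
  rw [div_le_iff₀ (by linarith)]
  nlinarith

/-- The inner averages and the mean responses form a coupled array. -/
lemma isCoupledArray (hs : IsNestedSample belief κ P θ ξ)
    (hh : Measurable (Function.uncurry h)) (hm : FiniteSecondMoment belief κ h) {M : ℕ → ℕ}
    (hM : Tendsto M atTop atTop) :
    IsCoupledArray P (fun k i ω => innerMean (M k) (response h θ ξ ω) i)
      (fun i ω => meanResponse κ h (θ i ω)) := by
  have hH := measurable_meanResponse (κ := κ) hh
  have hΨ : ∀ k, Measurable fun z : Θ × (ℕ → Ξ) =>
      (sampleMean (M k) (fun j => h z.1 (z.2 j)), meanResponse κ h z.1) := by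
    intro k
    refine Measurable.prodMk ?_ (hH.comp measurable_fst)
    unfold sampleMean
    refine (Finset.measurable_sum _ fun j _ => ?_).div_const _
    exact hh.comp (measurable_fst.prodMk ((measurable_pi_apply j).comp measurable_snd))
  refine ⟨fun k i => hs.measurable_innerMean hh _ i, fun i => hH.comp (hs.measurable_scenario i),
    fun k => hs.indep.comp (fun _ => _) fun _ => hΨ k, fun k i => hs.identDistrib_comp (hΨ k) i,
    fun k => hs.memLp_innerMean hh hm _ 0, hs.memLp_meanResponse hh hm 0, ?_⟩
  have h1 : Tendsto (fun k => (∫ z, deviation κ h z.1 z.2 ^ 2 ∂(belief ⊗ₘ κ)) / (M k : ℝ)) atTop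
      (𝓝 0) := tendsto_const_nhds.div_atTop (tendsto_natCast_atTop_atTop.comp hM)
  refine h1.congr' ?_
  filter_upwards [hM.eventually (eventually_gt_atTop 0)] with k hk
  exact (hs.integral_innerMean_sub_sq hh hm 0 hk).symm

/-- The ideal sample, coupled to itself. It describes the situation after the inner limit. -/
lemma isCoupledArray_limit (hs : IsNestedSample belief κ P θ ξ)
    (hh : Measurable (Function.uncurry h)) (hm : FiniteSecondMoment belief κ h) :
    IsCoupledArray P (fun _ i ω => meanResponse κ h (θ i ω))
      (fun i ω => meanResponse κ h (θ i ω)) := by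
  have hH := measurable_meanResponse (κ := κ) hh
  have hΨ : Measurable fun z : Θ × (ℕ → Ξ) => (meanResponse κ h z.1, meanResponse κ h z.1) :=
    (hH.comp measurable_fst).prodMk (hH.comp measurable_fst)
  exact ⟨fun k i => hH.comp (hs.measurable_scenario i),
    fun i => hH.comp (hs.measurable_scenario i), fun k => hs.indep.comp (fun _ => _) fun _ => hΨ,
    fun k i => hs.identDistrib_comp hΨ i, fun k => hs.memLp_meanResponse hh hm 0,
    hs.memLp_meanResponse hh hm 0, by simp⟩

lemma map_meanResponse (hs : IsNestedSample belief κ P θ ξ)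
    (hh : Measurable (Function.uncurry h)) (i : ℕ) :
    P.map (fun ω => meanResponse κ h (θ i ω)) = belief.map (meanResponse κ h) := by
  rw [← hs.map_scenario i, Measure.map_map (measurable_meanResponse hh)
    (hs.measurable_scenario i)]
  rfl

end IsNestedSample

end Inner

/-! ### Translation equivariant statistics -/

lemma absolutelyContinuous_pi_fin {ν μ : Measure ℝ} [SigmaFinite ν] [SigmaFinite μ] (h : ν ≪ μ)
    (n : ℕ) : Measure.pi (fun _ : Fin n => ν) ≪ Measure.pi fun _ : Fin n => μ := by
  induction n with
  | zero =>
    rw [Measure.pi_of_empty (fun _ : Fin 0 => ν), Measure.pi_of_empty (fun _ : Fin 0 => μ)]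
  | succ n ih =>
    rw [← (measurePreserving_piFinSuccAbove (fun _ : Fin (n + 1) => ν) 0).symm.map_eq,
      ← (measurePreserving_piFinSuccAbove (fun _ : Fin (n + 1) => μ) 0).symm.map_eq]
    exact (h.prod ih).map (MeasurableEquiv.measurable _)

/-- A continuous translation equivariant statistic of the first `N` entries. -/
structure IsLocationStatistic (N : ℕ) (T : (ℕ → ℝ) → ℝ) : Prop where
  continuous : Continuous T
  congr : ∀ y y' : ℕ → ℝ, (∀ i < N, y i = y' i) → T y = T y'
  add_const : ∀ (y : ℕ → ℝ) (s : ℝ), T (fun i => y i + s) = T y + s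

section Statistics

variable {α : ℝ} {N : ℕ} {y y' : ℕ → ℝ}

lemma quantileIndex_congr (h : ∀ i < N, y i = y' i) :
    quantileIndex α N y = quantileIndex α N y' := by
  have : (fun i : Fin N => y i) = fun i : Fin N => y' i := funext fun i => h i i.2
  rw [quantileIndex, quantileIndex, this]

lemma varEst_congr (hα1 : α < 1) (hN : 0 < N) (h : ∀ i < N, y i = y' i) :
    varEst α N y = varEst α N y' := by
  rw [varEst, varEst, ← quantileIndex_congr h]
  exact h _ (quantileIndex_lt hα1 hN y)

lemma excess_congr (hα1 : α < 1) (hN : 0 < N) (h : ∀ i < N, y i = y' i) :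
    ∀ i < N, excess α N y i = excess α N y' i := fun i hi => by
  rw [excess, excess, varEst_congr hα1 hN h, h i hi]

lemma cvarEst_congr (hα1 : α < 1) (hN : 0 < N) (h : ∀ i < N, y i = y' i) :
    cvarEst α N y = cvarEst α N y' := by
  rw [cvarEst, cvarEst, varEst_congr hα1 hN h,
    Finset.sum_congr rfl fun i hi => excess_congr hα1 hN h i (Finset.mem_range.1 hi)]

lemma sigmaV_congr (hα1 : α < 1) (hN : 0 < N) (h : ∀ i < N, y i = y' i) (b : ℝ) :
    sigmaV α b N y = sigmaV α b N y' := by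
  have : ∀ x, kde b N y x = kde b N y' x := fun x => by
    rw [kde, kde, Finset.sum_congr rfl fun i hi => by rw [h i (Finset.mem_range.1 hi)]]
  rw [sigmaV, sigmaV, varEst_congr hα1 hN h, this]

lemma sampleVar_congr (h : ∀ i < N, y i = y' i) : sampleVar N y = sampleVar N y' := by
  have : sampleMean N y = sampleMean N y' := by
    rw [sampleMean, sampleMean, Finset.sum_congr rfl fun i hi => h i (Finset.mem_range.1 hi)]
  rw [sampleVar, sampleVar, this,
    Finset.sum_congr rfl fun i hi => by rw [h i (Finset.mem_range.1 hi)]]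

lemma sigmaC_congr (hα1 : α < 1) (hN : 0 < N) (h : ∀ i < N, y i = y' i) :
    sigmaC α N y = sigmaC α N y' := by
  rw [sigmaC, sigmaC, sampleVar_congr (excess_congr hα1 hN h)]

lemma isLocationStatistic_endpointV (hα0 : 0 < α) (hα1 : α < 1) (hN : 0 < N) {b : ℝ} (hb : 0 < b)
    (t : ℝ) : IsLocationStatistic N fun y => varEst α N y + t * sigmaV α b N y / √(N : ℝ) where
  continuous := by
    have := continuous_varEst hα0 hα1 hN
    have := continuous_sigmaV hα0 hα1 hb hN
    fun_prop
  congr y y' h := by simp only [varEst_congr hα1 hN h, sigmaV_congr hα1 hN h b]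
  add_const y s := by
    simp only [varEst_add_const hα0 hα1 hN, sigmaV_add_const hα0 hα1 hN]; ring

lemma isLocationStatistic_endpointC (hα0 : 0 < α) (hα1 : α < 1) (hN : 0 < N) (t : ℝ) :
    IsLocationStatistic N fun y => cvarEst α N y + t * sigmaC α N y / √(N : ℝ) where
  continuous := by
    have := continuous_cvarEst hα0 hα1 hN
    have := continuous_sigmaC hα0 hα1 hN
    fun_prop
  congr y y' h := by simp only [cvarEst_congr hα1 hN h, sigmaC_congr hα1 hN h]
  add_const y s := by
    simp only [cvarEst_add_const hα0 hα1 hN, sigmaC_add_const hα0 hα1 hN]; ring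

end Statistics

/-- A translation equivariant statistic of an absolutely continuous sample has no atoms. -/
lemma IsLocationStatistic.ae_ne {Ω : Type*} [MeasurableSpace Ω] {P : Measure Ω}
    [IsProbabilityMeasure P] {N : ℕ} (hN : 0 < N) {T : (ℕ → ℝ) → ℝ} (hT : IsLocationStatistic N T)
    {X : ℕ → Ω → ℝ} (hm : ∀ i, Measurable (X i)) (hind : iIndepFun X P) {ν : Measure ℝ}
    (hlaw : ∀ i, P.map (X i) = ν) (hν : ν ≪ volume) (v : ℝ) :
    ∀ᵐ ω ∂P, T (fun i => X i ω) ≠ v := by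
  have : IsProbabilityMeasure ν :=
    hlaw 0 ▸ Measure.isProbabilityMeasure_map (hm 0).aemeasurable
  obtain ⟨m, rfl⟩ : ∃ m, N = m + 1 := ⟨N - 1, by lia⟩
  -- Repeating the last coordinate extends a finite vector to a sequence; the extension commutes
  -- with adding constants, and `T` ignores the added entries.
  set ext : (Fin (m + 1) → ℝ) → ℕ → ℝ := fun x i => x ⟨min i m, by lia⟩ with hext
  have hextc : Continuous ext := by
    refine continuous_pi fun i => ?_
    exact continuous_apply _
  set S : Set (Fin (m + 1) → ℝ) := {x | T (ext x) ≠ v}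
  have hS : MeasurableSet S :=
    ((hT.continuous.comp hextc).measurable (measurableSet_singleton v)).compl
  have h1 : ∀ᵐ x ∂(volume : Measure (Fin (m + 1) → ℝ)), x ∈ S := by
    -- It suffices to test each line parallel to the diagonal, along which `T` moves at unit speed
    -- and takes the value `v` once.
    refine ae_mem_of_ae_add_linearMap_mem
      (LinearMap.pi fun _ => LinearMap.id : ℝ →ₗ[ℝ] Fin (m + 1) → ℝ) volume volume hS fun y => ?_
    have h2 : ∀ᵐ s : ℝ, s ≠ v - T (ext y) := by
      simp [ae_iff]
    filter_upwards [h2] with s hs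
    have e : ext (y + (LinearMap.pi fun _ => LinearMap.id : ℝ →ₗ[ℝ] Fin (m + 1) → ℝ) s) =
        fun i => ext y i + s := by
      ext i; simp [hext]
    change T (ext _) ≠ v
    rw [e, hT.add_const]
    contrapose! hs
    linarith
  have h3 : ∀ᵐ x ∂P.map (fun ω (i : Fin (m + 1)) => X i ω), x ∈ S := by
    rw [map_fin_eq_pi hm hind hlaw]
    exact (absolutelyContinuous_pi_fin hν (m + 1)).ae_le h1
  filter_upwards [ae_of_ae_map (measurable_pi_iff.2 fun i : Fin (m + 1) => hm i).aemeasurable h3]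
    with ω hω
  rwa [hT.congr (fun i => X i ω) (ext fun i => X i ω) fun i hi => by
    simp only [hext, min_eq_left (Nat.lt_succ_iff.1 hi)]]

/-- Convergence of coverage probabilities when the endpoints converge along every sequence along
which the sample paths of `D` vanish. -/
lemma tendsto_measureReal_mem_Icc {Ω : Type*} [MeasurableSpace Ω] {P : Measure Ω}
    [IsProbabilityMeasure P] {D lo hi : ℕ → Ω → ℝ} {lo' hi' : Ω → ℝ} (hD : TendstoInProb P D 0)
    (hlom : ∀ M, Measurable (lo M)) (hhim : ∀ M, Measurable (hi M)) (hlom' : Measurable lo')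
    (hhim' : Measurable hi')
    (hlo : ∀ ω (m : ℕ → ℕ), Tendsto m atTop atTop → Tendsto (fun k => D (m k) ω) atTop (𝓝 0) →
      Tendsto (fun k => lo (m k) ω) atTop (𝓝 (lo' ω)))
    (hhi : ∀ ω (m : ℕ → ℕ), Tendsto m atTop atTop → Tendsto (fun k => D (m k) ω) atTop (𝓝 0) →
      Tendsto (fun k => hi (m k) ω) atTop (𝓝 (hi' ω)))
    {v : ℝ} (h1 : ∀ᵐ ω ∂P, lo' ω ≠ v) (h2 : ∀ᵐ ω ∂P, hi' ω ≠ v) :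
    Tendsto (fun M => P.real {ω | v ∈ Set.Icc (lo M ω) (hi M ω)}) atTop
      (𝓝 (P.real {ω | v ∈ Set.Icc (lo' ω) (hi' ω)})) := by
  have hset : ∀ {f g : Ω → ℝ}, Measurable f → Measurable g →
      MeasurableSet {ω | v ∈ Set.Icc (f ω) (g ω)} := fun hf hg =>
    (measurableSet_le hf measurable_const).inter (measurableSet_le measurable_const hg)
  -- Every subsequence has a further one along which `D` vanishes almost surely, so pathwise
  -- convergence of the endpoints applies.
  refine tendsto_of_subseq_tendsto fun ns hns => ?_
  have hmeas : TendstoInMeasure P (fun k => D (ns k)) atTop 0 := by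
    rw [tendstoInMeasure_iff_measureReal_norm]
    intro ε hε
    exact (hD ε hε).comp hns
  obtain ⟨ms, hms, hae⟩ := hmeas.exists_seq_tendsto_ae
  refine ⟨ms, ?_⟩
  have hm : Tendsto (fun k => ns (ms k)) atTop atTop := hns.comp hms.tendsto_atTop
  refine (ENNReal.tendsto_toReal (measure_ne_top _ _)).comp ?_
  refine tendsto_measure_of_ae_tendsto_indicator_of_isFiniteMeasure (μ := P) atTop
    (hset hlom' hhim') (fun k => hset (hlom _) (hhim _)) ?_
  filter_upwards [hae, h1, h2] with ω hω hω1 hω2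
  have hl := hlo ω _ hm hω
  have hh := hhi ω _ hm hω
  -- The limiting endpoint differs from `v`, so the comparison with `v` is eventually constant.
  have e1 : ∀ᶠ k in atTop, (lo (ns (ms k)) ω ≤ v ↔ lo' ω ≤ v) := by
    rcases lt_or_gt_of_ne hω1 with h | h
    · filter_upwards [hl.eventually (gt_mem_nhds h)] with k hk
      exact ⟨fun _ => h.le, fun _ => hk.le⟩
    · filter_upwards [hl.eventually (lt_mem_nhds h)] with k hk
      exact ⟨fun h' => absurd h' (not_le.2 hk), fun h' => absurd h' (not_le.2 h)⟩
  have e2 : ∀ᶠ k in atTop, (v ≤ hi (ns (ms k)) ω ↔ v ≤ hi' ω) := by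
    rcases lt_or_gt_of_ne hω2 with h | h
    · filter_upwards [hh.eventually (gt_mem_nhds h)] with k hk
      exact ⟨fun h' => absurd h' (not_le.2 hk), fun h' => absurd h' (not_le.2 h)⟩
    · filter_upwards [hh.eventually (lt_mem_nhds h)] with k hk
      exact ⟨fun _ => h.le, fun _ => hk.le⟩
  filter_upwards [e1, e2] with k hk1 hk2
  exact and_congr hk1 hk2

/-! ### The inner limit `M → ∞` for fixed `N`. -/

section Inner

variable {Θ Ξ Ω : Type*} [MeasurableSpace Θ] [MeasurableSpace Ξ] [MeasurableSpace Ω]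
  {belief : Measure Θ} {κ : Kernel Θ Ξ} {h : Θ → Ξ → ℝ} {P : Measure Ω} {θ : ℕ → Ω → Θ}
  {ξ : ℕ → ℕ → Ω → Ξ} [IsProbabilityMeasure belief] [IsMarkovKernel κ] [IsProbabilityMeasure P]

/-- The total inner error of the first `N` scenarios. -/
def innerError (κ : Kernel Θ Ξ) (h : Θ → Ξ → ℝ) (θ : ℕ → Ω → Θ) (ξ : ℕ → ℕ → Ω → Ξ) (N M : ℕ)
    (ω : Ω) : ℝ :=
  ∑ i ∈ Finset.range N, ((innerMean M (response h θ ξ ω) i - meanResponse κ h (θ i ω)) ^ 2 +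
    sampleVar M (response h θ ξ ω i) / M)

/-- The mean is at most `3 N V / M`: for each scenario `V / M` comes from the inner average and `2 V
/ M` from the sample variance. The shift by two secures `M ≥ 2`. -/
lemma IsNestedSample.tendstoInProb_innerError (hs : IsNestedSample belief κ P θ ξ)
    (hh : Measurable (Function.uncurry h)) (hm : FiniteSecondMoment belief κ h) (N : ℕ) :
    TendstoInProb P (innerError κ h θ ξ N) 0 := by
  set V := ∫ z, deviation κ h z.1 z.2 ^ 2 ∂(belief ⊗ₘ κ)
  have hint : ∀ M, 2 ≤ M → ∀ i, Integrable (fun ω => (innerMean M (response h θ ξ ω) i -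
      meanResponse κ h (θ i ω)) ^ 2 + sampleVar M (response h θ ξ ω i) / M) P := fun M hM i =>
    (((hs.memLp_innerMean hh hm M i).sub (hs.memLp_meanResponse hh hm i)).integrable_sq).add
      ((hs.integral_sampleVar_le hh hm i hM).1.div_const _)
  have h2 : TendstoInProb P (fun k => innerError κ h θ ξ N (k + 2)) 0 := by
    refine .of_integral_abs (fun k => integrable_finsetSum _ fun i _ => hint _ (by lia) i) ?_
    have hlim : Tendsto (fun k : ℕ => N * (3 * V) / ((k + 2 : ℕ) : ℝ)) atTop (𝓝 0) :=
      tendsto_const_nhds.div_atTop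
        (tendsto_natCast_atTop_atTop.comp (tendsto_add_atTop_nat 2))
    refine squeeze_zero (fun k => integral_nonneg fun _ => abs_nonneg _) (fun k => ?_) hlim
    have hk : 2 ≤ k + 2 := by lia
    have habs : ∀ ω, |innerError κ h θ ξ N (k + 2) ω| = innerError κ h θ ξ N (k + 2) ω := fun ω =>
      abs_of_nonneg (Finset.sum_nonneg fun i _ => add_nonneg (sq_nonneg _)
        (div_nonneg (sampleVar_nonneg (by lia) _) (Nat.cast_nonneg _)))
    rw [integral_congr_ae (ae_of_all _ habs)]
    simp only [innerError]
    rw [integral_finsetSum _ fun i _ => hint _ hk i]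
    have : ∀ i ∈ Finset.range N, ∫ ω, ((innerMean (k + 2) (response h θ ξ ω) i -
        meanResponse κ h (θ i ω)) ^ 2 + sampleVar (k + 2) (response h θ ξ ω i) /
        ((k + 2 : ℕ) : ℝ)) ∂P ≤ 3 * V / ((k + 2 : ℕ) : ℝ) := by
      intro i _
      have hsv := hs.integral_sampleVar_le hh hm i hk
      have hsq : Integrable (fun ω => (innerMean (k + 2) (response h θ ξ ω) i -
          meanResponse κ h (θ i ω)) ^ 2) P :=
        ((hs.memLp_innerMean hh hm _ i).sub (hs.memLp_meanResponse hh hm i)).integrable_sq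
      rw [integral_add hsq (hsv.1.div_const _), integral_div,
        hs.integral_innerMean_sub_sq hh hm i (by lia), ← add_div]
      gcongr
      linarith [hsv.2]
    refine (Finset.sum_le_sum this).trans (le_of_eq ?_)
    simp [mul_div_assoc]
  intro ε hε
  exact (tendsto_add_atTop_iff_nat 2).1 (h2 ε hε)

/-- For fixed `N` the inner level disappears. The correction `q R` vanishes since `q` converges and
`R` is dominated by the inner error, so no consistency of the inner variance estimates is required.
-/
lemma IsNestedSample.tendsto_measureReal_twoLevel (hs : IsNestedSample belief κ P θ ξ)
    (hh : Measurable (Function.uncurry h)) (hm : FiniteSecondMoment belief κ h)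
    (hν : belief.map (meanResponse κ h) ≪ volume) {N : ℕ} (hN : 0 < N) {T₁ T₂ : (ℕ → ℝ) → ℝ}
    (hT₁ : IsLocationStatistic N T₁) (hT₂ : IsLocationStatistic N T₂) {q₁ q₂ : ℕ → ℝ} {z₁ z₂ : ℝ}
    (hq₁ : Tendsto q₁ atTop (𝓝 z₁)) (hq₂ : Tendsto q₂ atTop (𝓝 z₂)) {R : ℕ → Ω → ℝ}
    (hRm : ∀ M, Measurable (R M)) {C : ℝ}
    (hR : ∀ M, 0 < M → ∀ ω, |R M ω| ≤ C * √(innerError κ h θ ξ N M ω)) (v : ℝ) :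
    Tendsto (fun M => P.real {ω | v ∈ Set.Icc
      (T₁ (innerMean M (response h θ ξ ω)) + q₁ M * R M ω)
      (T₂ (innerMean M (response h θ ξ ω)) + q₂ M * R M ω)}) atTop
      (𝓝 (P.real {ω | v ∈ Set.Icc (T₁ fun i => meanResponse κ h (θ i ω))
        (T₂ fun i => meanResponse κ h (θ i ω))})) := by
  have hc := hs.isCoupledArray_limit hh hm
  have hYm : ∀ M, Measurable fun ω => innerMean M (response h θ ξ ω) := fun M =>
    measurable_pi_iff.2 (hs.measurable_innerMean hh M)
  have hXm : Measurable fun ω i => meanResponse κ h (θ i ω) := measurable_pi_iff.2 hc.meas_snd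
  have hlim : ∀ {T : (ℕ → ℝ) → ℝ} {q : ℕ → ℝ} {z : ℝ}, IsLocationStatistic N T →
      Tendsto q atTop (𝓝 z) → ∀ ω (m : ℕ → ℕ), Tendsto m atTop atTop →
      Tendsto (fun k => innerError κ h θ ξ N (m k) ω) atTop (𝓝 0) →
      Tendsto (fun k => T (innerMean (m k) (response h θ ξ ω)) + q (m k) * R (m k) ω) atTop
        (𝓝 (T fun i => meanResponse κ h (θ i ω))) := by
    intro T q z hT hq ω m hm hD
    have hmpos : ∀ᶠ k in atTop, 0 < m k := hm.eventually (eventually_gt_atTop 0)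
    have hDsq : Tendsto (fun k => √(innerError κ h θ ξ N (m k) ω)) atTop (𝓝 0) := by
      simpa using hD.sqrt
    have hR0 : Tendsto (fun k => R (m k) ω) atTop (𝓝 0) := by
      have := hDsq.const_mul C
      rw [mul_zero] at this
      refine squeeze_zero_norm' ?_ this
      filter_upwards [hmpos] with k hk
      exact hR _ hk ω
    -- The inner error controls only the first `N` coordinates. The others are replaced by their
    -- limits, which `T` does not notice.
    have h1 : Tendsto (fun k i => if i < N then innerMean (m k) (response h θ ξ ω) i else
        meanResponse κ h (θ i ω)) atTop (𝓝 fun i => meanResponse κ h (θ i ω)) := by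
      refine tendsto_pi_nhds.2 fun i => ?_
      by_cases hi : i < N
      · simp only [hi, if_true]
        rw [tendsto_iff_norm_sub_tendsto_zero]
        refine squeeze_zero' (Eventually.of_forall fun k => norm_nonneg _) ?_ hDsq
        filter_upwards [hmpos] with k hk
        rw [Real.norm_eq_abs, ← Real.sqrt_sq_eq_abs]
        refine Real.sqrt_le_sqrt ?_
        have hnn : ∀ j ∈ Finset.range N, 0 ≤ (innerMean (m k) (response h θ ξ ω) j -
            meanResponse κ h (θ j ω)) ^ 2 + sampleVar (m k) (response h θ ξ ω j) / m k :=
          fun j _ => add_nonneg (sq_nonneg _)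
            (div_nonneg (sampleVar_nonneg hk _) (Nat.cast_nonneg _))
        refine le_trans ?_ (Finset.single_le_sum hnn (Finset.mem_range.2 hi))
        exact le_add_of_nonneg_right (div_nonneg (sampleVar_nonneg hk _) (Nat.cast_nonneg _))
      · simp only [hi, if_false]
        exact tendsto_const_nhds
    have h2 := ((hT.continuous.tendsto _).comp h1).add ((hq.comp hm).mul hR0)
    rw [mul_zero, add_zero] at h2
    refine h2.congr fun k => ?_
    simp only [Function.comp_apply]
    congr 1
    exact hT.congr _ _ fun i hi => by simp [hi]
  exact tendsto_measureReal_mem_Icc (hs.tendstoInProb_innerError hh hm N)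
    (fun M => (hT₁.continuous.measurable.comp (hYm M)).add ((hRm M).const_mul _))
    (fun M => (hT₂.continuous.measurable.comp (hYm M)).add ((hRm M).const_mul _))
    (hT₁.continuous.measurable.comp hXm) (hT₂.continuous.measurable.comp hXm)
    (hlim hT₁ hq₁) (hlim hT₂ hq₂)
    (hT₁.ae_ne hN hc.meas_snd hc.iIndepFun_snd (hs.map_meanResponse hh) hν v)
    (hT₂.ae_ne hN hc.meas_snd hc.iIndepFun_snd (hs.map_meanResponse hh) hν v)

end Inner

lemma measureReal_withDensity_ofReal {f : ℝ → ℝ} (hf : Measurable f) (h0 : ∀ y, 0 ≤ f y)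
    {A : Set ℝ} (hA : MeasurableSet A) :
    (volume.withDensity fun y => ENNReal.ofReal (f y)).real A = ∫ y in A, f y := by
  rw [measureReal_def, withDensity_apply _ hA, integral_eq_lintegral_of_nonneg_ae (ae_of_all _ h0)
    hf.aestronglyMeasurable]

/-- A distribution with a density that is continuous at `v`. -/
lemma hasLocalDensity_withDensity {f : ℝ → ℝ} (hf : Measurable f) (h0 : ∀ y, 0 ≤ f y)
    [IsFiniteMeasure (volume.withDensity fun y => ENNReal.ofReal (f y))] {v : ℝ}
    (hc : ContinuousAt f v) :
    HasLocalDensity (fun _ => volume.withDensity fun y => ENNReal.ofReal (f y)) v (f v) := by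
  have hint : Integrable f := by
    refine ⟨hf.aestronglyMeasurable, ?_⟩
    rw [hasFiniteIntegral_iff_ofReal (ae_of_all _ h0), ← setLIntegral_univ,
      ← withDensity_apply _ .univ]
    exact measure_lt_top _ _
  intro ε hε
  obtain ⟨δ, hδ, hd⟩ := Metric.continuousAt_iff.1 hc ε hε
  refine ⟨δ, hδ, Eventually.of_forall fun _ A hA hsub => ?_⟩
  have hvol : volume A < ⊤ := (measure_mono hsub).trans_lt measure_Ioo_lt_top
  rw [measureReal_withDensity_ofReal hf h0 hA]
  have h1 := norm_setIntegral_le_of_norm_le_const (f := fun y => f y - f v) (C := ε) hvol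
    fun y hy => by
      have := hsub hy
      refine (hd ?_).le
      rw [Real.dist_eq, abs_lt]
      constructor <;> linarith [this.1, this.2]
  rw [integral_sub hint.integrableOn (integrableOn_const hvol.ne), setIntegral_const, smul_eq_mul,
    mul_comm (volume.real A)] at h1
  exact h1

/-! ### The two-level intervals under the Weak Assumption. -/

section Weak

variable {Θ Ξ Ω : Type*} [MeasurableSpace Θ] [MeasurableSpace Ξ] [MeasurableSpace Ω]
  {belief : Measure Θ} {κ : Kernel Θ Ξ} {h : Θ → Ξ → ℝ} {P : Measure Ω} {θ : ℕ → Ω → Θ}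
  {ξ : ℕ → ℕ → Ω → Ξ} {α : ℝ}

lemma WeakAssumption.absolutelyContinuous (hw : WeakAssumption belief κ h α) :
    belief.map (meanResponse κ h) ≪ volume := by
  obtain ⟨f, -, -, hf, -⟩ := hw.density
  rw [hf]
  exact withDensity_absolutelyContinuous _ _

lemma WeakAssumption.noAtoms (hw : WeakAssumption belief κ h α) (x : ℝ) :
    belief.map (meanResponse κ h) {x} = 0 :=
  hw.absolutelyContinuous (measure_singleton x)

variable [IsProbabilityMeasure belief] [IsMarkovKernel κ]

lemma WeakAssumption.exists_hasLocalDensity (hh : Measurable (Function.uncurry h))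
    (hw : WeakAssumption belief κ h α) : ∃ c, 0 < c ∧
      HasLocalDensity (fun _ => belief.map (meanResponse κ h)) (VaR belief κ h α) c := by
  obtain ⟨f, hfm, hf0, hf, hpos, hcont⟩ := hw.density
  have hp := Measure.isProbabilityMeasure_map (μ := belief)
    (measurable_meanResponse (κ := κ) hh).aemeasurable
  rw [hf] at hp ⊢
  exact ⟨_, hpos.self_of_nhds, hasLocalDensity_withDensity hfm hf0 hcont.continuousAt⟩

lemma WeakAssumption.measureReal_Iic_VaR (hh : Measurable (Function.uncurry h))
    (hw : WeakAssumption belief κ h α) (hα0 : 0 < α) (hα1 : α < 1) :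
    (belief.map (meanResponse κ h)).real (Set.Iic (VaR belief κ h α)) = α := by
  have hp := Measure.isProbabilityMeasure_map (μ := belief)
    (measurable_meanResponse (κ := κ) hh).aemeasurable
  exact measureReal_Iic_quantile _ hw.noAtoms hα0 hα1

variable [IsProbabilityMeasure P]

lemma IsNestedSample.CVaR_eq (hs : IsNestedSample belief κ P θ ξ)
    (hh : Measurable (Function.uncurry h)) : CVaR belief κ h α = VaR belief κ h α + 1 / (1 - α) *
      ∫ ω, max (meanResponse κ h (θ 0 ω) - VaR belief κ h α) 0 ∂P := by
  have hH := measurable_meanResponse (κ := κ) hh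
  rw [CVaR]
  generalize VaR belief κ h α = v
  rw [← hs.map_scenario 0, integral_map (hs.measurable_scenario 0).aemeasurable]
  exact ((hH.sub_const _).max measurable_const).aestronglyMeasurable

lemma IsNestedSample.cdf_meanResponse (hs : IsNestedSample belief κ P θ ξ)
    (hh : Measurable (Function.uncurry h)) (hw : WeakAssumption belief κ h α) (hα0 : 0 < α)
    (hα1 : α < 1) : P.real {ω | meanResponse κ h (θ 0 ω) ≤ VaR belief κ h α} = α := by
  have h1 := hw.measureReal_Iic_VaR hh hα0 hα1
  rw [← hs.map_meanResponse hh 0, map_measureReal_apply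
    ((hs.isCoupledArray_limit hh hw.secondMoment).meas_snd 0) measurableSet_Iic] at h1
  exact h1

/-- The exact mean responses have no bias at all. The size `k + 1` keeps every row nonempty. -/
lemma IsNestedSample.exists_isRegularArray_limit (hs : IsNestedSample belief κ P θ ξ)
    (hh : Measurable (Function.uncurry h)) (hw : WeakAssumption belief κ h α) (hα0 : 0 < α)
    (hα1 : α < 1) : ∃ c, IsRegularArray P (fun _ i ω => meanResponse κ h (θ i ω))
      (fun i ω => meanResponse κ h (θ i ω)) (fun k => k + 1) α (VaR belief κ h α) c := by
  obtain ⟨c, hc, hd⟩ := hw.exists_hasLocalDensity hh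
  have hmap := hs.map_meanResponse hh 0
  have hcdf := hs.cdf_meanResponse hh hw hα0 hα1
  exact ⟨c, { hs.isCoupledArray_limit hh hw.secondMoment with
    level_pos := hα0
    level_lt_one := hα1
    tendsto_size := tendsto_add_atTop_nat 1
    size_pos := fun k => k.succ_pos
    noAtoms_snd := fun x => by rw [hmap]; exact hw.noAtoms x
    cdf_snd := hcdf
    noAtoms_fst := Eventually.of_forall fun k x => by rw [hmap]; exact hw.noAtoms x
    density_pos := hc
    density := by simpa only [hmap] using hd
    bias_cdf := by simp [hcdf]
    bias_excess := by simp }⟩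

/-- The index at which the sample variance is taken is random; since it ranges over a countable set,
joint measurability in index and sample point is available. -/
lemma measurable_tauV (hs : IsNestedSample belief κ P θ ξ) (hh : Measurable (Function.uncurry h))
    (N M : ℕ) : Measurable fun ω => tauV α N M (response h θ ξ ω) := by
  have h1 : Measurable fun p : ℕ × Ω => sampleVar M (response h θ ξ p.2 p.1) :=
    measurable_from_prod_countable_right fun i => hs.measurable_sampleVar hh M i
  have h2 : Measurable fun ω => quantileIndex α N (innerMean M (response h θ ξ ω)) :=
    (measurable_quantileIndex α N).comp (measurable_pi_iff.2 (hs.measurable_innerMean hh M))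
  exact (h1.comp (h2.prodMk measurable_id)).sqrt

lemma measurable_tauC (hs : IsNestedSample belief κ P θ ξ) (hh : Measurable (Function.uncurry h))
    (hα0 : 0 < α) (hα1 : α < 1) {N : ℕ} (hN : 0 < N) (M : ℕ) :
    Measurable fun ω => tauC α N M (response h θ ξ ω) := by
  have hY : Measurable fun ω => innerMean M (response h θ ξ ω) :=
    measurable_pi_iff.2 (hs.measurable_innerMean hh M)
  have h1 := (continuous_varEst hα0 hα1 hN).measurable.comp hY
  unfold tauC
  simp only [Finset.sum_filter]
  refine ((Finset.measurable_sum _ fun i _ => Measurable.ite (measurableSet_le h1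
    (hs.measurable_innerMean hh M i)) (hs.measurable_sampleVar hh M i)
    measurable_const).div_const _).sqrt

lemma sum_sampleVar_div_le_innerError (N M : ℕ) (ω : Ω) :
    (∑ i ∈ Finset.range N, sampleVar M (response h θ ξ ω i)) / M ≤ innerError κ h θ ξ N M ω := by
  rw [Finset.sum_div]
  exact Finset.sum_le_sum fun i _ => le_add_of_nonneg_left (sq_nonneg _)

/-- The sample variance at the selected scenario is one of those summed in `innerError`, whichever
scenario is selected. -/
lemma abs_tauV_div_le (hα1 : α < 1) {N M : ℕ} (hN : 0 < N) (hM : 0 < M) (ω : Ω) :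
    |tauV α N M (response h θ ξ ω) / √(M : ℝ)| ≤ 1 * √(innerError κ h θ ξ N M ω) := by
  rw [abs_of_nonneg (by unfold tauV; positivity), one_mul, tauV,
    ← Real.sqrt_div (sampleVar_nonneg hM _)]
  refine Real.sqrt_le_sqrt (le_trans ?_ (sum_sampleVar_div_le_innerError N M ω))
  gcongr
  exact Finset.single_le_sum (f := fun i => sampleVar M (response h θ ξ ω i))
    (fun i _ => sampleVar_nonneg hM _) (Finset.mem_range.2 (quantileIndex_lt hα1 hN _))

lemma abs_tauC_div_le (hα1 : α < 1) {N M : ℕ} (hN : 0 < N) (hM : 0 < M) (ω : Ω) :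
    |tauC α N M (response h θ ξ ω) / √((1 - α) * N * M)| ≤
      ((1 - α) * N)⁻¹ * √(innerError κ h θ ξ N M ω) := by
  have hN' : (0 : ℝ) < N := by exact_mod_cast hN
  have hM' : (0 : ℝ) < M := by exact_mod_cast hM
  have hα : 0 < 1 - α := by linarith
  have hpos : 0 < (1 - α) * N := by positivity
  have hnn : 0 ≤ ∑ i ∈ Finset.range N with varEst α N (innerMean M (response h θ ξ ω)) ≤
      innerMean M (response h θ ξ ω) i, sampleVar M (response h θ ξ ω i) :=
    Finset.sum_nonneg fun i _ => sampleVar_nonneg hM _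
  rw [abs_of_nonneg (by unfold tauC; positivity), tauC, ← Real.sqrt_div (div_nonneg hnn hpos.le),
    ← Real.sqrt_sq (inv_nonneg.2 hpos.le), ← Real.sqrt_mul (sq_nonneg _)]
  refine Real.sqrt_le_sqrt ?_
  have h1 := sum_sampleVar_div_le_innerError (κ := κ) (h := h) (θ := θ) (ξ := ξ) N M ω
  have h2 : (∑ i ∈ Finset.range N with varEst α N (innerMean M (response h θ ξ ω)) ≤
      innerMean M (response h θ ξ ω) i, sampleVar M (response h θ ξ ω i)) ≤
      ∑ i ∈ Finset.range N, sampleVar M (response h θ ξ ω i) :=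
    Finset.sum_le_sum_of_subset_of_nonneg (Finset.filter_subset _ _)
      fun i _ _ => sampleVar_nonneg hM _
  -- The factor `(1 - α) N` occurs twice, once in the average defining `tauC` and once in the
  -- normalisation of the interval.
  calc _ = ((1 - α) * N)⁻¹ ^ 2 * ((∑ i ∈ Finset.range N with
        varEst α N (innerMean M (response h θ ξ ω)) ≤ innerMean M (response h θ ξ ω) i,
          sampleVar M (response h θ ξ ω i)) / M) := by
        field_simp
    _ ≤ _ := by
        refine mul_le_mul_of_nonneg_left (le_trans ?_ h1) (sq_nonneg _)
        gcongr

lemma exists_tendsto_tQuantile {γ : ℝ} (h0 : 0 < γ) (h1 : γ < 1) {d : ℕ → ℝ}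
    (hd : Tendsto d atTop atTop) : ∃ z, Tendsto (fun M => tQuantile γ (d M)) atTop (𝓝 z) := by
  obtain ⟨z, hz⟩ := exists_normalCDF_eq h0 h1
  exact ⟨z, (tendsto_tQuantile hz).comp hd⟩

/-- The inner limit is the coverage of the single-level interval built from the exact mean responses
at level `βO`. The inner half-width vanishes with `M`, so `βI` does not enter the final limit. -/
theorem IsNestedSample.iteratedLimit_weakCIV (hs : IsNestedSample belief κ P θ ξ)
    (hh : Measurable (Function.uncurry h)) (hw : WeakAssumption belief κ h α) (hα0 : 0 < α)
    (hα1 : α < 1) {b : ℕ → ℝ} (hb : ∀ N, 0 < b N) (hb0 : Tendsto b atTop (𝓝 0))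
    (hnb : Tendsto (fun N : ℕ => (N : ℝ) * b N) atTop atTop) {βO βI : ℝ} (hO0 : 0 < βO)
    (hO1 : βO < 1) (hI0 : 0 < βI) (hI1 : βI < 1) :
    IteratedLimit (fun N M =>
      P.real {ω | VaR belief κ h α ∈ weakCIV α βO βI (b N) N M (response h θ ξ ω)}) (1 - βO) := by
  obtain ⟨c, hc⟩ := hs.exists_isRegularArray_limit hh hw hα0 hα1
  refine ⟨fun N => P.real {ω | VaR belief κ h α ∈
    sampleCIV α βO (b N) N fun i => meanResponse κ h (θ i ω)}, ?_, ?_⟩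
  · filter_upwards [eventually_gt_atTop 0] with N hN
    have hd : Tendsto (fun M : ℕ => (M : ℝ) - 1) atTop atTop :=
      tendsto_atTop_add_const_right _ _ tendsto_natCast_atTop_atTop
    obtain ⟨z₁, hz₁⟩ := exists_tendsto_tQuantile (γ := βI / 2) (by linarith) (by linarith) hd
    obtain ⟨z₂, hz₂⟩ := exists_tendsto_tQuantile (γ := 1 - βI / 2) (by linarith) (by linarith) hd
    have := hs.tendsto_measureReal_twoLevel hh hw.secondMoment hw.absolutelyContinuous hN
      (isLocationStatistic_endpointV hα0 hα1 hN (hb N) (tQuantile (βO / 2) (N - 1)))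
      (isLocationStatistic_endpointV hα0 hα1 hN (hb N) (tQuantile (1 - βO / 2) (N - 1))) hz₁ hz₂
      (fun M => (measurable_tauV (α := α) hs hh N M).div_const √(M : ℝ))
      (fun M hM ω => abs_tauV_div_le hα1 hN hM ω) (VaR belief κ h α)
    simp only [← mul_div_assoc] at this
    exact this
  · rw [← tendsto_add_atTop_iff_nat 1]
    exact hc.tendsto_sampleCIV (b := fun k => b (k + 1)) (fun k => hb _)
      (hb0.comp (tendsto_add_atTop_nat 1)) (hnb.comp (tendsto_add_atTop_nat 1)) hO0 hO1

theorem IsNestedSample.iteratedLimit_weakCIC (hs : IsNestedSample belief κ P θ ξ)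
    (hh : Measurable (Function.uncurry h)) (hw : WeakAssumption belief κ h α) (hα0 : 0 < α)
    (hα1 : α < 1) {βO βI : ℝ} (hO0 : 0 < βO)
    (hO1 : βO < 1) (hI0 : 0 < βI) (hI1 : βI < 1) :
    IteratedLimit (fun N M =>
      P.real {ω | CVaR belief κ h α ∈ weakCIC α βO βI N M (response h θ ξ ω)}) (1 - βO) := by
  obtain ⟨c, hc⟩ := hs.exists_isRegularArray_limit hh hw hα0 hα1
  refine ⟨fun N => P.real {ω | CVaR belief κ h α ∈
    sampleCIC α βO N fun i => meanResponse κ h (θ i ω)}, ?_, ?_⟩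
  · filter_upwards [eventually_gt_atTop 0] with N hN
    have hN' : (0 : ℝ) < N := by exact_mod_cast hN
    have hpos : 0 < (1 - α) * N := mul_pos (by linarith) hN'
    have hd : Tendsto (fun M : ℕ => (1 - α) * N * M - 1) atTop atTop :=
      tendsto_atTop_add_const_right _ _ (tendsto_natCast_atTop_atTop.const_mul_atTop hpos)
    obtain ⟨z₁, hz₁⟩ := exists_tendsto_tQuantile (γ := βI / 2) (by linarith) (by linarith) hd
    obtain ⟨z₂, hz₂⟩ := exists_tendsto_tQuantile (γ := 1 - βI / 2) (by linarith) (by linarith) hd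
    have := hs.tendsto_measureReal_twoLevel hh hw.secondMoment hw.absolutelyContinuous hN
      (isLocationStatistic_endpointC hα0 hα1 hN (tQuantile (βO / 2) (N - 1)))
      (isLocationStatistic_endpointC hα0 hα1 hN (tQuantile (1 - βO / 2) (N - 1))) hz₁ hz₂
      (fun M => (measurable_tauC hs hh hα0 hα1 hN M).div_const √((1 - α) * N * M))
      (fun M hM ω => abs_tauC_div_le hα1 hN hM ω) (CVaR belief κ h α)
    simp only [← mul_div_assoc] at this
    exact this
  · rw [← tendsto_add_atTop_iff_nat 1, hs.CVaR_eq hh]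
    exact hc.tendsto_sampleCIC hO0 hO1

end Weak

/-- A pair with a joint density `p` that is Lipschitz in its first variable, where `ε` is
uncorrelated with every function of `H`. -/
structure IsRegularPair {Ω : Type*} [MeasurableSpace Ω] (P : Measure Ω) (H ε : Ω → ℝ)
    (p : ℝ → ℝ → ℝ) (g₀ g₁ : ℝ → ℝ) (C : ℝ) : Prop where
  meas_fst : Measurable H
  meas_snd : Measurable ε
  meas_density : Measurable fun z : ℝ × ℝ => p z.1 z.2
  nonneg : ∀ y e, 0 ≤ p y e
  law : P.map (fun ω => (H ω, ε ω)) =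
    (volume : Measure (ℝ × ℝ)).withDensity fun z => ENNReal.ofReal (p z.1 z.2)
  le_bound : ∀ y e, p y e ≤ g₀ e
  lipschitz : ∀ y y' e, |p y e - p y' e| ≤ g₁ e * |y - y'|
  integrable_abs_bound : Integrable fun e => |e| * g₀ e
  integrable_sq_bound : Integrable fun e => e ^ 2 * g₀ e
  integrable_abs_lipschitz : Integrable fun e => |e| * g₁ e
  integrable_sq_lipschitz : Integrable fun e => e ^ 2 * g₁ e
  integral_sq_bound_le : ∫ e, e ^ 2 * g₀ e ≤ C
  integral_abs_lipschitz_le : ∫ e, |e| * g₁ e ≤ C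
  integral_sq_lipschitz_le : ∫ e, e ^ 2 * g₁ e ≤ C
  integrable_snd : Integrable ε P
  orthogonal : ∀ A, MeasurableSet A → ∫ ω in H ⁻¹' A, ε ω ∂P = 0

/-! ### Expansions for a small perturbation of a variable with a joint density. -/

namespace IsRegularPair

variable {Ω : Type*} [MeasurableSpace Ω] {P : Measure Ω} {H ε : Ω → ℝ} {p : ℝ → ℝ → ℝ}
  {g₀ g₁ : ℝ → ℝ} {C : ℝ}

lemma integral_comp (h : IsRegularPair P H ε p g₀ g₁ C) {φ : ℝ × ℝ → ℝ} (hφ : Measurable φ)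
    (hint : Integrable (fun ω => φ (H ω, ε ω)) P) :
    Integrable (fun z => φ z * p z.1 z.2) (volume.prod volume : Measure (ℝ × ℝ)) ∧
      ∫ ω, φ (H ω, ε ω) ∂P = ∫ e, ∫ y, φ (y, e) * p y e := by
  have hm := (h.meas_fst.prodMk h.meas_snd).aemeasurable (μ := P)
  have hpm := h.meas_density.ennreal_ofReal
  have hlt : ∀ᵐ z ∂(volume : Measure (ℝ × ℝ)), ENNReal.ofReal (p z.1 z.2) < ⊤ :=
    ae_of_all _ fun _ => ENNReal.ofReal_lt_top
  have h1 := (integrable_map_measure hφ.aestronglyMeasurable hm).2 hint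
  rw [h.law, integrable_withDensity_iff hpm hlt] at h1
  simp only [ENNReal.toReal_ofReal (h.nonneg _ _)] at h1
  refine ⟨h1, ?_⟩
  have h2 := integral_map (f := φ) hm hφ.aestronglyMeasurable
  rw [← h2, h.law, integral_withDensity_eq_integral_toReal_smul hpm hlt]
  simp only [ENNReal.toReal_ofReal (h.nonneg _ _), smul_eq_mul, mul_comm _ (φ _)]
  rw [Measure.volume_eq_prod, integral_prod_symm _ h1]

lemma continuous_density (h : IsRegularPair P H ε p g₀ g₁ C) (e : ℝ) :
    Continuous fun y => p y e := by
  refine (LipschitzWith.of_dist_le_mul (K := (g₁ e).toNNReal) fun y y' => ?_).continuous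
  rw [Real.dist_eq, Real.dist_eq]
  exact (h.lipschitz y y' e).trans
    (mul_le_mul_of_nonneg_right (Real.le_coe_toNNReal _) (abs_nonneg _))

lemma integrableOn_density (h : IsRegularPair P H ε p g₀ g₁ C) (e s : ℝ) {A : Set ℝ}
    (hA : volume A < ⊤) : IntegrableOn (fun y => p (y - s) e) A := by
  refine Measure.integrableOn_of_bounded (M := g₀ e) hA.ne
    ((h.continuous_density e).comp (by fun_prop)).aestronglyMeasurable (ae_of_all _ fun y => ?_)
  rw [Real.norm_of_nonneg (h.nonneg _ _)]
  exact h.le_bound _ _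

variable [IsProbabilityMeasure P]

/-- Translation of the first variable by `a e` for each fixed `e`, then Fubini: the dependence on
`a` moves from the event into the density. -/
lemma measureReal_comp (h : IsRegularPair P H ε p g₀ g₁ C) (a : ℝ) {A : Set ℝ}
    (hA : MeasurableSet A) :
    Integrable (fun e => ∫ y in A, p (y - a * e) e) ∧
      P.real {ω | H ω + a * ε ω ∈ A} = ∫ e, ∫ y in A, p (y - a * e) e := by
  set φ : ℝ × ℝ → ℝ := fun z => A.indicator (fun _ => 1) (z.1 + a * z.2) with hφdef
  have hφ : Measurable φ :=
    (measurable_const.indicator hA).comp (by fun_prop : Measurable fun z : ℝ × ℝ => z.1 + a * z.2)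
  have hset : MeasurableSet {ω | H ω + a * ε ω ∈ A} :=
    (h.meas_fst.add (h.meas_snd.const_mul a)) hA
  have e1 : (fun ω => φ (H ω, ε ω)) = {ω | H ω + a * ε ω ∈ A}.indicator fun _ => 1 := by
    ext ω; simp only [hφdef, Set.indicator, Set.mem_ofPred_eq]
  have hint : Integrable (fun ω => φ (H ω, ε ω)) P := by
    rw [e1]; exact (integrable_const _).indicator hset
  obtain ⟨h1, h2⟩ := h.integral_comp hφ hint
  have e2 : ∀ e, ∫ y, φ (y, e) * p y e = ∫ y in A, p (y - a * e) e := by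
    intro e
    rw [← integral_indicator hA,
      ← integral_sub_right_eq_self (fun y => φ (y, e) * p y e) (a * e)]
    congr 1
    ext y
    change A.indicator (fun _ => (1 : ℝ)) (y - a * e + a * e) * _ = _
    rw [sub_add_cancel]
    simp only [Set.indicator]
    split_ifs <;> simp
  have h3 := h1.integral_prod_right
  simp only [e2] at h2 h3
  refine ⟨h3, ?_⟩
  rw [← h2, e1, integral_indicator_const _ hset, smul_eq_mul, mul_one]

lemma measureReal_fst (h : IsRegularPair P H ε p g₀ g₁ C) {A : Set ℝ} (hA : MeasurableSet A) :
    Integrable (fun e => ∫ y in A, p y e) ∧ P.real {ω | H ω ∈ A} = ∫ e, ∫ y in A, p y e := by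
  simpa using h.measureReal_comp 0 hA

/-- The law of `H + a ε` differs from the law of `H` by a measure with a density of order `a`. -/
lemma abs_measureReal_sub_le (h : IsRegularPair P H ε p g₀ g₁ C) {a : ℝ} (ha : 0 ≤ a) {A : Set ℝ}
    (hA : MeasurableSet A) (hvol : volume A < ⊤) :
    |P.real {ω | H ω + a * ε ω ∈ A} - P.real {ω | H ω ∈ A}| ≤ a * C * volume.real A := by
  obtain ⟨h1, h2⟩ := h.measureReal_comp a hA
  obtain ⟨h3, h4⟩ := h.measureReal_fst hA
  rw [h2, h4, ← integral_sub h1 h3]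
  have hle : ∀ e, ‖(∫ y in A, p (y - a * e) e) - ∫ y in A, p y e‖ ≤
      a * volume.real A * (|e| * g₁ e) := by
    intro e
    have hi : IntegrableOn (fun y => p y e) A := by simpa using h.integrableOn_density e 0 hvol
    rw [← integral_sub (h.integrableOn_density e (a * e) hvol) hi]
    refine (norm_setIntegral_le_of_norm_le_const (C := g₁ e * |a * e|) hvol fun y _ => ?_).trans
      (le_of_eq ?_)
    · have := h.lipschitz (y - a * e) y e
      rwa [sub_sub_cancel_left, abs_neg] at this
    · rw [abs_mul, abs_of_nonneg ha]; ring
  refine (norm_integral_le_of_norm_le (h.integrable_abs_lipschitz.const_mul _)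
    (ae_of_all _ hle)).trans ?_
  rw [integral_const_mul]
  calc _ ≤ a * volume.real A * C :=
        mul_le_mul_of_nonneg_left h.integral_abs_lipschitz_le (by positivity)
    _ = _ := by ring

/-- First order expansion of the integral of the density. -/
lemma abs_intervalIntegral_sub_le (h : IsRegularPair P H ε p g₀ g₁ C) (v s e : ℝ) :
    |(∫ y in v..(v + s), p y e) - s * p v e| ≤ s ^ 2 * g₁ e := by
  have hg : 0 ≤ g₁ e := by simpa using (abs_nonneg _).trans (h.lipschitz 1 0 e)
  have h1 : (∫ y in v..(v + s), p y e) - s * p v e = ∫ y in v..(v + s), (p y e - p v e) := by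
    rw [intervalIntegral.integral_sub ((h.continuous_density e).intervalIntegrable _ _)
      (continuous_const.intervalIntegrable _ _), intervalIntegral.integral_const,
      add_sub_cancel_left, smul_eq_mul]
  rw [h1, ← Real.norm_eq_abs]
  refine (intervalIntegral.norm_integral_le_of_norm_le_const (C := g₁ e * |s|)
    fun y hy => ?_).trans (le_of_eq ?_)
  · refine (h.lipschitz y v e).trans (mul_le_mul_of_nonneg_left ?_ hg)
    have := Set.abs_sub_left_of_mem_uIcc (Set.uIoc_subset_uIcc hy)
    rwa [add_sub_cancel_left] at this
  · rw [add_sub_cancel_left, mul_assoc, abs_mul_abs_self]; ring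

lemma integrable_mul_density (h : IsRegularPair P H ε p g₀ g₁ C) (v : ℝ) :
    Integrable fun e => e * p v e := by
  refine h.integrable_abs_bound.mono' (Measurable.aestronglyMeasurable ?_) (ae_of_all _ fun e => ?_)
  · exact measurable_id.mul (h.meas_density.comp (measurable_const.prodMk measurable_id))
  · rw [norm_mul, Real.norm_eq_abs, Real.norm_of_nonneg (h.nonneg _ _)]
    exact mul_le_mul_of_nonneg_left (h.le_bound _ _) (abs_nonneg _)

/-- The conditional mean of `ε` vanishes at every value of `H`. -/
lemma integral_mul_density (h : IsRegularPair P H ε p g₀ g₁ C) (v : ℝ) :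
    ∫ e, e * p v e = 0 := by
  -- Orthogonality to the event `v < H ≤ v + s` holds for every `s`. Dividing by `s`, the Lipschitz
  -- property replaces the average of `p` over the interval by its value at `v` up to order `s`.
  have key : ∀ s > 0, |∫ e, e * p v e| ≤ s * C := by
    intro s hs
    set A := Set.Ioc v (v + s)
    set φ : ℝ × ℝ → ℝ := fun z => A.indicator (fun _ => z.2) z.1 with hφdef
    have hφ : Measurable φ := by
      have : φ = (Prod.fst ⁻¹' A).indicator Prod.snd := by
        ext z; simp only [hφdef, Set.indicator, Set.mem_preimage]
      rw [this]
      exact measurable_snd.indicator (measurable_fst measurableSet_Ioc)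
    have hset : MeasurableSet (H ⁻¹' A) := h.meas_fst measurableSet_Ioc
    have e1 : (fun ω => φ (H ω, ε ω)) = (H ⁻¹' A).indicator ε := by
      ext ω; simp only [hφdef, Set.indicator, Set.mem_preimage]
    obtain ⟨h1, h2⟩ := h.integral_comp hφ (by rw [e1]; exact h.integrable_snd.indicator hset)
    have e2 : ∀ e, ∫ y, φ (y, e) * p y e = e * ∫ y in v..(v + s), p y e := by
      intro e
      rw [intervalIntegral.integral_of_le (by linarith), ← integral_const_mul,
        ← integral_indicator measurableSet_Ioc]
      congr 1
      ext y
      simp only [hφdef, Set.indicator]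
      split_ifs <;> simp_all [A]
    have h3 := h1.integral_prod_right
    simp only [e2] at h2 h3
    rw [e1, integral_indicator hset, h.orthogonal A measurableSet_Ioc] at h2
    have h4 := (h.integrable_mul_density v).const_mul s
    have h5 : s * ∫ e, e * p v e = -∫ e, (e * (∫ y in v..(v + s), p y e) - s * (e * p v e)) := by
      rw [integral_sub h3 h4, ← h2, integral_const_mul]; ring
    have h6 : |∫ e, (e * (∫ y in v..(v + s), p y e) - s * (e * p v e))| ≤ s ^ 2 * C := by
      rw [← Real.norm_eq_abs]
      refine (norm_integral_le_of_norm_le (h.integrable_abs_lipschitz.const_mul (s ^ 2))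
        (ae_of_all _ fun e => ?_)).trans ?_
      · have : e * (∫ y in v..(v + s), p y e) - s * (e * p v e) =
            e * ((∫ y in v..(v + s), p y e) - s * p v e) := by ring
        rw [this, Real.norm_eq_abs, abs_mul]
        calc _ ≤ |e| * (s ^ 2 * g₁ e) :=
              mul_le_mul_of_nonneg_left (h.abs_intervalIntegral_sub_le v s e) (abs_nonneg _)
          _ = _ := by ring
      · rw [integral_const_mul]
        exact mul_le_mul_of_nonneg_left h.integral_abs_lipschitz_le (sq_nonneg _)
    rw [← abs_neg, ← h5, abs_mul, abs_of_pos hs, sq, mul_assoc] at h6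
    exact le_of_mul_le_mul_left h6 hs
  have hlim : Tendsto (fun s : ℝ => s * C) (𝓝[>] 0) (𝓝 0) := by
    have : Continuous fun s : ℝ => s * C := by fun_prop
    simpa using (this.tendsto 0).mono_left nhdsWithin_le_nhds
  have h0 := ge_of_tendsto hlim (by filter_upwards [self_mem_nhdsWithin] with s hs using key s hs)
  exact abs_nonpos_iff.1 h0

/-- The distribution functions of `H + a ε` and `H` differ by a term of order `a²`. -/
lemma abs_cdf_sub_le (h : IsRegularPair P H ε p g₀ g₁ C) (a v : ℝ) :
    |P.real {ω | H ω + a * ε ω ≤ v} - P.real {ω | H ω ≤ v}| ≤ a ^ 2 * C := by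
  obtain ⟨h1, h2⟩ := h.measureReal_comp a (A := Set.Iic v) measurableSet_Iic
  obtain ⟨h3, h4⟩ := h.measureReal_fst (A := Set.Iic v) measurableSet_Iic
  simp only [Set.mem_Iic] at h2 h4
  -- Needed to subtract integrals over unbounded half-lines; it is the sectionwise integrability of
  -- the joint density.
  have hint : ∀ᵐ e, Integrable fun y => p y e := by
    have := (h.integral_comp (φ := fun _ => 1) measurable_const (integrable_const _)).1.prod_left_ae
    simpa using this
  have hae : ∀ᵐ e, (∫ y in Set.Iic v, p (y - a * e) e) - ∫ y in Set.Iic v, p y e =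
      ∫ y in v..(v + -(a * e)), p y e := by
    filter_upwards [hint] with e he
    rw [← intervalIntegral.integral_Iic_sub_Iic he.integrableOn he.integrableOn]
    congr 1
    rw [← integral_indicator measurableSet_Iic, ← integral_indicator measurableSet_Iic,
      ← integral_sub_right_eq_self ((Set.Iic (v + -(a * e))).indicator fun y => p y e) (a * e)]
    congr 1
    ext y
    have : y ≤ v ↔ y - a * e ≤ v + -(a * e) := by constructor <;> intro _ <;> linarith
    simp only [Set.indicator, Set.mem_Iic, this]
  have h5 := (h.integrable_mul_density v).const_mul a
  have h6 := (h1.sub h3).congr hae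
  -- The first order term `-a e p(v, e)` of the inner integral has integral zero, so it can be
  -- removed; the remainder is quadratic in `a e`.
  have h7 : ∫ e, (∫ y in v..(v + -(a * e)), p y e) =
      ∫ e, ((∫ y in v..(v + -(a * e)), p y e) + a * (e * p v e)) := by
    rw [integral_add h6 h5, integral_const_mul, h.integral_mul_density, mul_zero, add_zero]
  rw [h2, h4, ← integral_sub h1 h3, integral_congr_ae hae, h7, ← Real.norm_eq_abs]
  refine (norm_integral_le_of_norm_le (h.integrable_sq_lipschitz.const_mul (a ^ 2))
    (ae_of_all _ fun e => ?_)).trans ?_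
  · have := h.abs_intervalIntegral_sub_le v (-(a * e)) e
    rw [neg_mul, sub_neg_eq_add, neg_sq, mul_pow, mul_assoc a e, mul_assoc] at this
    exact this
  · rw [integral_const_mul]
    exact mul_le_mul_of_nonneg_left h.integral_sq_lipschitz_le (sq_nonneg _)

/-- The mean excesses of `H + a ε` and `H` differ by a term of order `a²`. -/
lemma abs_integral_excess_sub_le (h : IsRegularPair P H ε p g₀ g₁ C) (hH : Integrable H P) (a v : ℝ) :
    |(∫ ω, max (H ω + a * ε ω - v) 0 ∂P) - ∫ ω, max (H ω - v) 0 ∂P| ≤ a ^ 2 * (2 * C) := by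
  have hi1 : Integrable (fun ω => max (H ω + a * ε ω - v) 0) P :=
    ((hH.add (h.integrable_snd.const_mul a)).sub (integrable_const v)).pos_part
  have hi2 : Integrable (fun ω => max (H ω - v) 0) P := (hH.sub (integrable_const v)).pos_part
  have hset : MeasurableSet (H ⁻¹' Set.Ioi v) := h.meas_fst measurableSet_Ioi
  have hi3 : Integrable (fun ω => a * (H ⁻¹' Set.Ioi v).indicator ε ω) P :=
    (h.integrable_snd.indicator hset).const_mul a
  have h0 : ∫ ω, a * (H ⁻¹' Set.Ioi v).indicator ε ω ∂P = 0 := by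
    rw [integral_const_mul, integral_indicator hset, h.orthogonal _ measurableSet_Ioi, mul_zero]
  -- After subtracting `a ε` on `H > v`, which has mean zero, the difference of the excesses is
  -- nonzero only if the perturbation can cross `v`, and is then at most `|a ε|`.
  set φ : ℝ × ℝ → ℝ := fun z => if |z.1 - v| ≤ |a * z.2| then |a * z.2| else 0 with hφdef
  have hφ : Measurable φ :=
    Measurable.ite (measurableSet_le (by fun_prop) (by fun_prop)) (by fun_prop) measurable_const
  have hφi : Integrable (fun ω => φ (H ω, ε ω)) P := by
    refine (h.integrable_snd.const_mul a).abs.mono'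
      (hφ.comp (h.meas_fst.prodMk h.meas_snd)).aestronglyMeasurable (ae_of_all _ fun ω => ?_)
    simp only [hφdef]
    split_ifs
    · simp
    · simp only [norm_zero]; exact abs_nonneg _
  have hle : ∀ ω, ‖max (H ω + a * ε ω - v) 0 - max (H ω - v) 0 -
      a * (H ⁻¹' Set.Ioi v).indicator ε ω‖ ≤ φ (H ω, ε ω) := by
    intro ω
    simp only [hφdef, Set.indicator, Set.mem_preimage, Set.mem_Ioi, Real.norm_eq_abs, mul_ite,
      mul_zero]
    generalize a * ε ω = d
    generalize H ω = y
    have hd1 := le_abs_self d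
    have hd2 := neg_abs_le d
    split_ifs with c1 c2 c2
    · rw [max_eq_left (a := y - v) (by linarith), abs_le]
      constructor
      · linarith [le_max_left (y + d - v) 0]
      · rw [abs_of_pos (by linarith)] at c2
        rcases max_cases (y + d - v) 0 with ⟨h1, _⟩ | ⟨h1, _⟩ <;> rw [h1] <;> linarith
    · rw [abs_of_pos (by linarith), not_le] at c2
      rw [max_eq_left (by linarith), max_eq_left (by linarith)]
      simp
    · rw [max_eq_right (a := y - v) (by linarith), abs_le]
      constructor
      · linarith [le_max_right (y + d - v) 0]
      · rcases max_cases (y + d - v) 0 with ⟨h1, _⟩ | ⟨h1, _⟩ <;> rw [h1] <;> linarith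
    · rw [abs_of_nonpos (by linarith), not_le] at c2
      rw [max_eq_right (by linarith), max_eq_right (by linarith)]
      simp
  obtain ⟨h1, h2⟩ := h.integral_comp hφ hφi
  have h3 := h1.integral_prod_right
  -- Height `|a e|`, on a strip of width `2 |a e|` where the density is at most `g₀ e`.
  have hbound : ∀ e, ∫ y, φ (y, e) * p y e ≤ a ^ 2 * 2 * (e ^ 2 * g₀ e) := by
    intro e
    have e1 : ∀ y, φ (y, e) * p y e =
        (Set.Icc (v - |a * e|) (v + |a * e|)).indicator (fun y => |a * e| * p y e) y := by
      intro y
      have : |y - v| ≤ |a * e| ↔ v - |a * e| ≤ y ∧ y ≤ v + |a * e| := by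
        rw [abs_le]; constructor <;> rintro ⟨_, _⟩ <;> constructor <;> linarith
      simp only [hφdef, Set.indicator, Set.mem_Icc, this]
      split_ifs <;> simp
    simp only [e1]
    rw [integral_indicator measurableSet_Icc, integral_const_mul]
    have h4 := norm_setIntegral_le_of_norm_le_const (f := fun y => p y e) (C := g₀ e)
      (s := Set.Icc (v - |a * e|) (v + |a * e|)) (μ := volume) measure_Icc_lt_top fun y _ => by
        rw [Real.norm_of_nonneg (h.nonneg _ _)]; exact h.le_bound _ _
    rw [Real.volume_real_Icc_of_le (by linarith [abs_nonneg (a * e)])] at h4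
    calc _ ≤ |a * e| * (g₀ e * (v + |a * e| - (v - |a * e|))) :=
          mul_le_mul_of_nonneg_left ((Real.le_norm_self _).trans h4) (abs_nonneg _)
      _ = 2 * |a * e| ^ 2 * g₀ e := by ring
      _ = _ := by rw [sq_abs]; ring
  have h5 : (∫ ω, max (H ω + a * ε ω - v) 0 ∂P) - ∫ ω, max (H ω - v) 0 ∂P =
      ∫ ω, (max (H ω + a * ε ω - v) 0 - max (H ω - v) 0 -
        a * (H ⁻¹' Set.Ioi v).indicator ε ω) ∂P := by
    have h6 := integral_sub (hi1.sub hi2) hi3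
    simp only [Pi.sub_apply] at h6
    rw [h6, h0, sub_zero, integral_sub hi1 hi2]
  rw [h5, ← Real.norm_eq_abs]
  refine (norm_integral_le_of_norm_le hφi (ae_of_all _ hle)).trans ?_
  rw [h2]
  refine (integral_mono h3 (h.integrable_sq_bound.const_mul _) hbound).trans ?_
  rw [integral_const_mul, mul_assoc]
  gcongr
  exact h.integral_sq_bound_le

end IsRegularPair

/-! ### The single-level intervals under the Strong Assumption. -/

section Strong

variable {Θ Ξ Ω : Type*} [MeasurableSpace Θ] [MeasurableSpace Ξ] [MeasurableSpace Ω]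
  {belief : Measure Θ} {κ : Kernel Θ Ξ} {h : Θ → Ξ → ℝ} {P : Measure Ω} {θ : ℕ → Ω → Θ}
  {ξ : ℕ → ℕ → Ω → Ξ} {α : ℝ}

lemma innerMean_response_eq {M : ℕ} (hM : 0 < M) (i : ℕ) (ω : Ω) :
    innerMean M (response h θ ξ ω) i =
      meanResponse κ h (θ i ω) + (√(M : ℝ))⁻¹ * normalizedNoise κ h θ ξ M i ω := by
  have h0 : √(M : ℝ) ≠ 0 := (Real.sqrt_pos.2 (by exact_mod_cast hM)).ne'
  have h1 := innerMean_response_sub (κ := κ) (h := h) (θ := θ) (ξ := ξ) hM i ω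
  rw [normalizedNoise, inv_mul_cancel_left₀ h0]
  exact eq_add_of_sub_eq' h1

variable [IsProbabilityMeasure belief] [IsMarkovKernel κ] [IsProbabilityMeasure P]

/-- The mean value inequality turns the bound on the first derivative into a Lipschitz bound, and
orthogonality is the vanishing conditional mean of the deviations. The constant `C` comes from the
moments of orders one and two and is common to all `M`. -/
lemma IsNestedSample.exists_isRegularPair (hs : IsNestedSample belief κ P θ ξ)
    (hh : Measurable (Function.uncurry h)) (hm : FiniteSecondMoment belief κ h)
    (hd : RegularJointDensity κ h P θ ξ) :
    ∃ C, 0 ≤ C ∧ ∀ M, 0 < M → ∃ p g₀ g₁, IsRegularPair P (fun ω => meanResponse κ h (θ 0 ω))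
      (normalizedNoise κ h θ ξ M 0) p g₀ g₁ C := by
  obtain ⟨p, g, hpg, hmom⟩ := hd
  obtain ⟨C₁, hC₁⟩ := hmom 1 (by norm_num) (by norm_num)
  obtain ⟨C₂, hC₂⟩ := hmom 2 (by norm_num) (by norm_num)
  simp only [Real.rpow_one] at hC₁
  simp only [Real.rpow_two, sq_abs] at hC₂
  refine ⟨max (max C₁ C₂) 0, le_max_right _ _, fun M hM => ⟨p M, g 0 M, g 1 M, ?_⟩⟩
  obtain ⟨h1, h2, h3, h4, -, -, h7, h8, -⟩ := hpg M hM
  have hH := measurable_meanResponse (κ := κ) hh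
  have hdm := measurable_deviation (κ := κ) hh
  have hεeq : normalizedNoise κ h θ ξ M 0 = fun ω => ∑ j ∈ Finset.range M,
      √(M : ℝ) / M * deviation κ h (θ 0 ω) (ξ 0 j ω) := by
    ext ω
    rw [normalizedNoise, ← Finset.mul_sum]
    simp only [deviation]
    ring
  have hεi : ∀ j, Integrable (fun ω => √(M : ℝ) / M * deviation κ h (θ 0 ω) (ξ 0 j ω)) P :=
    fun j => ((hs.memLp_deviation hh hm 0 j).integrable (by norm_num)).const_mul _
  have hle1 : C₁ ≤ max (max C₁ C₂) 0 := (le_max_left _ _).trans (le_max_left _ _)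
  have hle2 : C₂ ≤ max (max C₁ C₂) 0 := (le_max_right _ _).trans (le_max_left _ _)
  refine
  { meas_fst := hH.comp (hs.measurable_scenario 0)
    meas_snd := ?_
    meas_density := h1
    nonneg := h2
    law := h3
    le_bound := h7
    lipschitz := fun y y' e => ?_
    integrable_abs_bound := (hC₁ 0 M hM).1
    integrable_sq_bound := (hC₂ 0 M hM).1
    integrable_abs_lipschitz := (hC₁ 1 M hM).1
    integrable_sq_lipschitz := (hC₂ 1 M hM).1
    integral_sq_bound_le := (hC₂ 0 M hM).2.trans hle2
    integral_abs_lipschitz_le := (hC₁ 1 M hM).2.trans hle1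
    integral_sq_lipschitz_le := (hC₂ 1 M hM).2.trans hle2
    integrable_snd := ?_
    orthogonal := fun A hA => ?_ }
  · rw [hεeq]
    exact Finset.measurable_sum _ fun j _ => (hdm.comp ((hs.measurable_scenario 0).prodMk
      (hs.measurable_noise 0 j))).const_mul _
  · exact convex_univ.norm_image_sub_le_of_norm_deriv_le (f := fun y => p M y e) (C := g 1 M e)
      (fun x _ => (h4 e).differentiableAt) (fun x _ => h8 x e) (Set.mem_univ y') (Set.mem_univ y)
  · rw [hεeq]
    exact integrable_finsetSum _ fun j _ => hεi j
  · rw [hεeq, integral_finsetSum _ fun j _ => (hεi j).integrableOn]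
    refine Finset.sum_eq_zero fun j _ => ?_
    rw [integral_const_mul]
    have hset : MeasurableSet ((fun ω => meanResponse κ h (θ 0 ω)) ⁻¹' A) :=
      (hH.comp (hs.measurable_scenario 0)) hA
    have h5 := hs.integral_deviation_mul hh hm 0 j
      (g := (meanResponse κ h ⁻¹' A).indicator fun _ => 1) (measurable_const.indicator (hH hA))
      (C := 1) (fun t => by simp only [Set.indicator]; split_ifs <;> norm_num)
    rw [← integral_indicator hset, ← mul_zero (√(M : ℝ) / M), ← h5]
    congr 2
    ext ω
    by_cases hω : meanResponse κ h (θ 0 ω) ∈ A <;> simp [Set.indicator, hω]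

/-- The form in which the growth condition acts: a bias of order `1 / M` multiplied by `√N`. -/
lemma tendsto_sqrt_div {N M : ℕ → ℕ}
    (hNM : Tendsto (fun k => (N k : ℝ) / (M k : ℝ) ^ 2) atTop (𝓝 0)) :
    Tendsto (fun k => √(N k : ℝ) / M k) atTop (𝓝 0) := by
  have h1 := hNM.sqrt
  rw [Real.sqrt_zero] at h1
  refine h1.congr fun k => ?_
  rw [Real.sqrt_div (Nat.cast_nonneg _), Real.sqrt_sq (Nat.cast_nonneg _)]

/-- Under the Strong Assumption the inner averages form a regular array when `N = o(M²)`. -/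
lemma IsNestedSample.exists_isRegularArray (hs : IsNestedSample belief κ P θ ξ)
    (hh : Measurable (Function.uncurry h)) (hst : StrongAssumption belief κ h α P θ ξ)
    (hα0 : 0 < α) (hα1 : α < 1) {N M : ℕ → ℕ} (hN : Tendsto N atTop atTop)
    (hM : Tendsto M atTop atTop)
    (hNM : Tendsto (fun k => (N k : ℝ) / (M k : ℝ) ^ 2) atTop (𝓝 0)) :
    ∃ c, IsRegularArray P (fun k i ω => innerMean (M k) (response h θ ξ ω) i)
      (fun i ω => meanResponse κ h (θ i ω)) (fun k => max (N k) 1) α (VaR belief κ h α) c := by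
  have hw := hst.toWeakAssumption
  have hmom := hw.secondMoment
  obtain ⟨c, hc, hd⟩ := hw.exists_hasLocalDensity hh
  obtain ⟨C, hC0, hC⟩ := hs.exists_isRegularPair hh hmom hst.jointDensity
  have hca := hs.isCoupledArray hh hmom hM
  have hmap := hs.map_meanResponse hh 0
  have hcdf := hs.cdf_meanResponse hh hw hα0 hα1
  have hMpos : ∀ᶠ k in atTop, 0 < M k := hM.eventually (eventually_gt_atTop 0)
  have hNpos : ∀ᶠ k in atTop, 0 < N k := hN.eventually (eventually_gt_atTop 0)
  have hinv : ∀ k, ((√(M k : ℝ))⁻¹) ^ 2 = (M k : ℝ)⁻¹ := fun k => by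
    rw [inv_pow, Real.sq_sqrt (Nat.cast_nonneg _)]
  have hlaw : ∀ k, 0 < M k → ∀ A, MeasurableSet A → volume A < ⊤ →
      |(P.map fun ω => innerMean (M k) (response h θ ξ ω) 0).real A -
        (belief.map (meanResponse κ h)).real A| ≤ (√(M k : ℝ))⁻¹ * C * volume.real A := by
    intro k hk A hA hvol
    obtain ⟨p, g₀, g₁, hp⟩ := hC (M k) hk
    have := hp.abs_measureReal_sub_le (a := (√(M k : ℝ))⁻¹) (by positivity) hA hvol
    rw [map_measureReal_apply (hca.meas_fst k 0) hA, ← hmap,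
      map_measureReal_apply (hca.meas_snd 0) hA]
    simp only [← innerMean_response_eq hk] at this
    exact this
  have hbias : ∀ B : ℝ, Tendsto (fun k => √(N k : ℝ) / M k * B) atTop (𝓝 0) := fun B => by
    simpa using (tendsto_sqrt_div hNM).mul_const B
  exact ⟨c, { hca with
    level_pos := hα0
    level_lt_one := hα1
    -- The maximum with one makes every row nonempty and changes only finitely many sizes.
    tendsto_size := tendsto_atTop_mono (fun k => le_max_left _ _) hN
    size_pos := fun k => lt_of_lt_of_le one_pos (le_max_right _ _)
    noAtoms_snd := fun x => by rw [hmap]; exact hw.noAtoms x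
    cdf_snd := hcdf
    noAtoms_fst := by
      filter_upwards [hMpos] with k hk x
      have h1 := hlaw k hk {x} (measurableSet_singleton x) (by simp)
      rw [measureReal_def volume, measure_singleton, ENNReal.toReal_zero, mul_zero,
        measureReal_def (belief.map _), hw.noAtoms x, ENNReal.toReal_zero, sub_zero] at h1
      exact (measureReal_eq_zero_iff (measure_ne_top _ _)).1 (abs_nonpos_iff.1 h1)
    density_pos := hc
    density := by
      intro ε hε
      obtain ⟨δ, hδ, hev⟩ := hd (ε / 2) (by positivity)
      have hlim : Tendsto (fun k => (√(M k : ℝ))⁻¹ * C) atTop (𝓝 0) := by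
        have := (tendsto_inv_atTop_zero.comp (Real.tendsto_sqrt_atTop.comp
          (tendsto_natCast_atTop_atTop.comp hM))).mul_const C
        rwa [zero_mul] at this
      refine ⟨δ, hδ, ?_⟩
      -- The law of the mean response does not depend on `k`, so a single index gives its local
      -- density; the inner averages add an error of order `1 / √M`.
      obtain ⟨k₀, hk₀⟩ := hev.exists
      filter_upwards [hMpos, hlim.eventually (gt_mem_nhds (show 0 < ε / 2 by positivity))]
        with k hk hk' A hA hsub
      have h1 := hk₀ A hA hsub
      have h2 := hlaw k hk A hA ((measure_mono hsub).trans_lt measure_Ioo_lt_top)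
      have h3 : (√(M k : ℝ))⁻¹ * C * volume.real A ≤ ε / 2 * volume.real A := by gcongr
      rw [abs_le] at h1 h2 ⊢
      constructor <;> linarith
    bias_cdf := by
      refine squeeze_zero_norm' ?_ (hbias C)
      filter_upwards [hMpos, hNpos] with k hk hk'
      obtain ⟨p, g₀, g₁, hp⟩ := hC (M k) hk
      have h1 := hp.abs_cdf_sub_le (√(M k : ℝ))⁻¹ (VaR belief κ h α)
      simp only [← innerMean_response_eq hk] at h1
      rw [hcdf, hinv] at h1
      rw [max_eq_left (Nat.succ_le_of_lt hk'), norm_mul, Real.norm_of_nonneg (Real.sqrt_nonneg _),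
        div_eq_mul_inv, mul_assoc]
      exact mul_le_mul_of_nonneg_left h1 (Real.sqrt_nonneg _)
    bias_excess := by
      refine squeeze_zero_norm' ?_ (hbias (2 * C))
      filter_upwards [hMpos, hNpos] with k hk hk'
      obtain ⟨p, g₀, g₁, hp⟩ := hC (M k) hk
      have h1 := hp.abs_integral_excess_sub_le (hca.memLp_snd.integrable (by norm_num))
        (√(M k : ℝ))⁻¹ (VaR belief κ h α)
      simp only [← innerMean_response_eq hk] at h1
      rw [hinv] at h1
      rw [max_eq_left (Nat.succ_le_of_lt hk'), norm_mul, Real.norm_of_nonneg (Real.sqrt_nonneg _),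
        div_eq_mul_inv, mul_assoc]
      exact mul_le_mul_of_nonneg_left h1 (Real.sqrt_nonneg _) }⟩

theorem IsNestedSample.jointLimit_strongCIV (hs : IsNestedSample belief κ P θ ξ)
    (hh : Measurable (Function.uncurry h)) (hst : StrongAssumption belief κ h α P θ ξ)
    (hα0 : 0 < α) (hα1 : α < 1) {b : ℕ → ℝ} (hb : ∀ N, 0 < b N) (hb0 : Tendsto b atTop (𝓝 0))
    (hnb : Tendsto (fun N : ℕ => (N : ℝ) * b N) atTop atTop) {β : ℝ} (hβ0 : 0 < β) (hβ1 : β < 1) :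
    JointLimit (fun N M => P.real {ω | VaR belief κ h α ∈
      strongCIV α β (b N) N M (response h θ ξ ω)}) (1 - β) := by
  intro N M hN hM hNM
  obtain ⟨c, hc⟩ := hs.exists_isRegularArray hh hst hα0 hα1 hN hM hNM
  have hN1 : ∀ᶠ k in atTop, max (N k) 1 = N k := by
    filter_upwards [hN.eventually (eventually_ge_atTop 1)] with k hk using max_eq_left hk
  refine (hc.tendsto_sampleCIV (b := fun k => b (max (N k) 1)) (fun k => hb _)
    (hb0.comp hc.tendsto_size) (hnb.comp hc.tendsto_size) hβ0 hβ1).congr' ?_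
  filter_upwards [hN1] with k hk
  simp only [hk]
  rfl

theorem IsNestedSample.jointLimit_strongCIC (hs : IsNestedSample belief κ P θ ξ)
    (hh : Measurable (Function.uncurry h)) (hst : StrongAssumption belief κ h α P θ ξ)
    (hα0 : 0 < α) (hα1 : α < 1) {β : ℝ} (hβ0 : 0 < β) (hβ1 : β < 1) :
    JointLimit (fun N M => P.real {ω | CVaR belief κ h α ∈
      strongCIC α β N M (response h θ ξ ω)}) (1 - β) := by
  intro N M hN hM hNM
  obtain ⟨c, hc⟩ := hs.exists_isRegularArray hh hst hα0 hα1 hN hM hNM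
  rw [hs.CVaR_eq hh]
  refine (hc.tendsto_sampleCIC hβ0 hβ1).congr' ?_
  filter_upwards [hN.eventually (eventually_ge_atTop 1)] with k hk
  simp only [max_eq_left hk]
  rfl

end Strong

end NestedCI

end

theorem theorem3p5 {Θ Ξ Ω : Type*} [MeasurableSpace Θ] [MeasurableSpace Ξ] [MeasurableSpace Ω]
    (belief : Measure Θ) [IsProbabilityMeasure belief] (κ : Kernel Θ Ξ) [IsMarkovKernel κ]
    (h : Θ → Ξ → ℝ) (hh : Measurable (Function.uncurry h))
    (P : Measure Ω) [IsProbabilityMeasure P] (θ : ℕ → Ω → Θ) (ξ : ℕ → ℕ → Ω → Ξ)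
    (hsample : IsNestedSample belief κ P θ ξ)
    (α : ℝ) (hα0 : 0 < α) (hα1 : α < 1)
    (b : ℕ → ℝ) (hb_pos : ∀ N, 0 < b N) (hb_zero : Tendsto b atTop (𝓝 0))
    (hb_top : Tendsto (fun N : ℕ => (N : ℝ) * b N) atTop atTop) :
    (WeakAssumption belief κ h α →
      ∀ β βO βI : ℝ, 0 < βO → 0 < βI → βO + βI = β → β < 1 →
        (∃ L : ℝ, 1 - β ≤ L ∧ IteratedLimit (fun N M =>
          P.real {ω | VaR belief κ h α ∈ weakCIV α βO βI (b N) N M (response h θ ξ ω)}) L) ∧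
        (∃ L : ℝ, 1 - β ≤ L ∧ IteratedLimit (fun N M =>
          P.real {ω | CVaR belief κ h α ∈ weakCIC α βO βI N M (response h θ ξ ω)}) L)) ∧
    (StrongAssumption belief κ h α P θ ξ →
      ∀ β : ℝ, 0 < β → β < 1 →
        (∃ L : ℝ, 1 - β ≤ L ∧ JointLimit (fun N M =>
          P.real {ω | VaR belief κ h α ∈ strongCIV α β (b N) N M (response h θ ξ ω)}) L) ∧
        (∃ L : ℝ, 1 - β ≤ L ∧ JointLimit (fun N M =>
          P.real {ω | CVaR belief κ h α ∈ strongCIC α β N M (response h θ ξ ω)}) L)) := by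
  refine ⟨fun hw β βO βI hO hI hβ hβ1 => ⟨⟨1 - βO, by linarith, ?_⟩, ⟨1 - βO, by linarith, ?_⟩⟩,
    fun hst β hβ0 hβ1 => ⟨⟨1 - β, le_rfl, ?_⟩, ⟨1 - β, le_rfl, ?_⟩⟩⟩
  · exact hsample.iteratedLimit_weakCIV hh hw hα0 hα1 hb_pos hb_zero hb_top hO (by linarith) hI
      (by linarith)
  · exact hsample.iteratedLimit_weakCIC hh hw hα0 hα1 hO (by linarith) hI (by linarith)
  · exact hsample.jointLimit_strongCIV hh hst hα0 hα1 hb_pos hb_zero hb_top hβ0 hβ1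
  · exact hsample.jointLimit_strongCIC hh hst hα0 hα1 hβ0 hβ1
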